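/- An algebraic integer $\alpha\in\mathbf{C}$ has degree $N$ if its minimal polynomial over $\mathbf{Q}$ has degree $N$; its conjugates are the complex roots of that polynomial, and its house is the largest absolute value of a conjugate. Call $\alpha$ a Perron number if $|\alpha|>|\beta|$ for every conjugate $\beta\neq\alpha$ (no sign condition on $\alpha$). For $N\ge 1$ let $\mathcal{A}_N$ be the set of algebraic integers of degree $N$, and let $\mathcal{A}^P_N,\mathcal{A}^+_N,\mathcal{A}^-_N\subset\mathcal{A}_N$ be the subsets of those that are conjugate to a Perron number, totally real (all conjugates real), and totally complex (no conjugate real), respectively. For real $X$ let $\mathcal{A}^*_N(X)$ be the set of elements of $\mathcal{A}^*_N$ with house at most $X$. Fix $N\ge 1$, and let $*$ be unadorned, $P$, $+$, or, if $N$ is even, $-$. As $X\to\infty$, the number of Galois conjugacy classes in $\mathcal{A}^*_N(X)$ (equivalently, of minimal polynomials of its elements) is $$D^*_N\, X^{N(N+1)/2}\left(1+O\left(\tfrac1X\right)\right),$$ and hence $$|\mathcal{A}^*_N(X)| = N\, D^*_N\, X^{N(N+1)/2}\left(1+O\left(\tfrac1X\right)\right),$$ where the implied constants depend only on $N$, and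 $$D_{2m}=\prod_{k=0}^{m-1}\left(\frac{k!^2\,2^{2k+1}}{(2k+1)!}\right)^2,\qquad D_{2m+1}=\frac{m!^2\,2^{2m+1}}{(2m+1)!}\prod_{k=0}^{m-1}\left(\frac{k!^2\,2^{2k+1}}{(2k+1)!}\right)^2,$$ $$D^P_N=\frac{D_N}{N+1}\ (N\text{ even}),\qquad D^P_N=\frac{D_N}{N}\ (N\text{ odd}),$$ $$D^+_N=\prod_{k=0}^{N-1}\frac{2^{k+1}\,k!^2}{(2k+1)!},\qquad D^-_{2n}=\frac{2^{2n(n-1)}\,(2n)!}{n!^2}\,D^+_{2n}.$$ -/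

import Mathlib

open Filter Asymptotics

noncomputable section

namespace PerronCount

/-- The house of an algebraic number `α`: the largest absolute value of a conjugate of `α` over `ℚ`
(for algebraic `α` the set of conjugates is finite and contains `α`). -/
def house (α : ℂ) : ℝ :=
  sSup ((fun β : ℂ => ‖β‖) '' {β : ℂ | IsConjRoot ℚ α β})

/-- Algebraic integers of degree `N` in `ℂ`. -/
def algInt (N : ℕ) : Set ℂ :=
  {α | IsIntegral ℤ α ∧ (minpoly ℚ α).natDegree = N}

/-- Perron numbers: algebraic integers strictly larger in absolute value than each of their
other conjugates (no sign condition). -/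
def IsPerron (α : ℂ) : Prop :=
  IsIntegral ℤ α ∧ ∀ β : ℂ, IsConjRoot ℚ α β → β ≠ α → ‖β‖ < ‖α‖

/-- Algebraic integers of degree `N` that are conjugate to a Perron number. -/
def algIntPerron (N : ℕ) : Set ℂ :=
  {α ∈ algInt N | ∃ β : ℂ, IsConjRoot ℚ α β ∧ IsPerron β}

/-- Totally real algebraic integers of degree `N`. -/
def algIntReal (N : ℕ) : Set ℂ :=
  {α ∈ algInt N | ∀ β : ℂ, IsConjRoot ℚ α β → β.im = 0}

/-- Totally complex algebraic integers of degree `N`. -/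
def algIntComplex (N : ℕ) : Set ℂ :=
  {α ∈ algInt N | ∀ β : ℂ, IsConjRoot ℚ α β → β.im ≠ 0}

/-- The elements of `S` of house at most `X`. -/
def houseLE (S : Set ℂ) (X : ℝ) : Set ℂ :=
  {α ∈ S | house α ≤ X}

/-- The Galois conjugacy classes (over `ℚ`) of the elements of `S`. -/
def conjClasses (S : Set ℂ) : Set (Quotient (IsConjRoot.setoid ℚ ℂ)) :=
  (fun α : ℂ => Quotient.mk (IsConjRoot.setoid ℚ ℂ) α) '' S

/-- `f X = c * X ^ e * (1 + O(1 / X))` as the real variable `X` tends to infinity. -/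
def HasAsymp (f : ℝ → ℝ) (c : ℝ) (e : ℕ) : Prop :=
  ∃ E : ℝ → ℝ, E =O[atTop] (fun X : ℝ => 1 / X) ∧
    ∀ᶠ X : ℝ in atTop, f X = X ^ e * c * (1 + E X)

/-- For a class `S` of algebraic integers of degree `N`: the number of conjugacy classes in `S` with
house at most `X` is `c * X ^ (N(N+1)/2) * (1 + O(1/X))`, and the number of elements of `S` with
house at most `X` is `N` times as large, `N * c * X ^ (N(N+1)/2) * (1 + O(1/X))`. -/
def CountAsymp (N : ℕ) (S : Set ℂ) (c : ℝ) : Prop :=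
  HasAsymp (fun X => ((conjClasses (houseLE S X)).ncard : ℝ)) c (N * (N + 1) / 2) ∧
  HasAsymp (fun X => ((houseLE S X).ncard : ℝ)) (N * c) (N * (N + 1) / 2)

/-- The factor `k!² 2^(2k+1) / (2k+1)!`. -/
def factor (k : ℕ) : ℝ :=
  (k.factorial : ℝ) ^ 2 * 2 ^ (2 * k + 1) / ((2 * k + 1).factorial : ℝ)

/-- `D_N`, for `N = 2m` and `N = 2m + 1` (in both cases `m = N / 2`). -/
def D (N : ℕ) : ℝ :=
  if Even N then ∏ k ∈ Finset.range (N / 2), factor k ^ 2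
  else factor (N / 2) * ∏ k ∈ Finset.range (N / 2), factor k ^ 2

/-- `D^P_N`. -/
def DPerron (N : ℕ) : ℝ :=
  if Even N then D N / ((N : ℝ) + 1) else D N / (N : ℝ)

/-- `D^+_N`. -/
def DReal (N : ℕ) : ℝ :=
  ∏ k ∈ Finset.range N, (2 : ℝ) ^ (k + 1) * (k.factorial : ℝ) ^ 2 / ((2 * k + 1).factorial : ℝ)

/-- The constant `D^-_{2n}`, as a function of `n`. -/
def DComplex (n : ℕ) : ℝ :=
  (2 : ℝ) ^ (2 * n * (n - 1)) * ((2 * n).factorial : ℝ) / (n.factorial : ℝ) ^ 2 * DReal (2 * n)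

end PerronCount

end

/-! A conjugacy class of algebraic integers of degree `N` is an irreducible monic integral
polynomial, that is, a vector of `ℤ^N`. Dividing the roots by `X` multiplies the coefficient of
index `i` by `X^(i-N)`. The polynomials with all roots of modulus at most `X` thus become points of
a lattice of covolume `X^(-N(N+1)/2)` in a fixed bounded region: the monic real polynomials with all
roots in the unit disc and root set of the prescribed type (`unitRegion`). The leading constant is
the volume of this region.

The relative error is of the order of the coarsest lattice step `1/X`, for three reasons. Away from
the zero set of one nonzero polynomial `R` in the coefficients, which detects accidental relations
between roots, the type is locally constant; the boundary is therefore algebraic, and slicing gives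
the lattice point count (`exists_abs_latticeCount_sub_volume_le`). The lattice points on `R = 0` are
few by Schwartz–Zippel (`latticeCount_zeroLocus_le`). Reducible polynomials lose at least one power
of `X` (`ncard_reducible_le`). These facts combine in `ncard_irredVectors_asymp`.

The four volumes are computed separately. All polynomials: the Schur recursion `P ↦ zP + kP*` with
`|k| < 1` parametrizes the polynomials with roots in the open disc, and its Jacobian is explicit
(`stableMoment_succ`). Dominant root `r`: write the polynomial as `(X - r) r^N Q(X/r)` with `Q`
stable. The Jacobian brings in `|Q(1)|`, whose integral obeys the same recursion (`volume_domSet`).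
All roots real: passing to the roots turns the volume into the integral over a cube of the absolute
Vandermonde product, a Selberg integral with exponent 1/2, evaluated by Aomoto's integration by
parts (`discMoment_empty`). No real root: in terms of the roots in the upper half plane the Jacobian
is a determinant of constant sign, so the absolute value can be dropped. The integral of the
determinant collapses to a Cauchy determinant of half the size (`integral_det_powMatrix`,
`abs_det_cauchy`). -/

namespace PerronCount

open MeasureTheory Set

/-! ### Lattice points in bounded regions with algebraic boundary -/

section LatticeCount

/-- Otherwise the interior of `S` and the exterior of `S` would separate `t`. -/
lemma inter_frontier_nonempty_of_isPreconnected {α : Type*} [TopologicalSpace α] {t S : Set α}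
    (ht : IsPreconnected t) (h1 : (t ∩ S).Nonempty) (h2 : (t ∩ Sᶜ).Nonempty) :
    (t ∩ frontier S).Nonempty := by
  by_contra hcon
  rw [not_nonempty_iff_eq_empty, ← disjoint_iff_inter_eq_empty, Set.disjoint_left] at hcon
  have key : ∀ x ∈ t, x ∈ closure S → x ∈ interior S := fun x hx hc => by
    by_contra hi; exact hcon hx ⟨hc, hi⟩
  obtain ⟨x, hx, hxS⟩ := h1
  obtain ⟨y, hy, hyS⟩ := h2
  obtain ⟨z, -, hz1, hz2⟩ := ht (interior S) (closure S)ᶜ isOpen_interior isClosed_closure.isOpen_compl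
    (fun z hz => (em (z ∈ closure S)).imp (key z hz) id)
    ⟨x, hx, key x hx (subset_closure hxS)⟩ ⟨y, hy, fun hc => hyS (interior_subset (key y hy hc))⟩
  exact hz2 (subset_closure (interior_subset hz1))

/-- Cut the line into cells `[s m, s (m+1))`. A cell without frontier point is connected, hence
inside or outside `S`, and contributes equally to both terms; every other cell costs at most `s`. -/
lemma abs_count_mul_sub_volume_le {s B : ℝ} (hs : 0 < s) {S : Set ℝ} (hS : MeasurableSet S)
    (hB : S ⊆ Icc (-B) B) {F : Finset ℝ} (hF : frontier S ⊆ F) :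
    |({m : ℤ | s * m ∈ S}.ncard : ℝ) * s - volume.real S| ≤ F.card * s := by
  classical
  set K : Finset ℤ := Finset.Icc ⌊-B / s⌋ ⌊B / s⌋ with hK
  have hmemK : ∀ x ∈ S, ⌊x / s⌋ ∈ K := by
    intro x hx
    have := hB hx
    rw [hK, Finset.mem_Icc]
    exact ⟨Int.floor_mono (by gcongr; exact this.1), Int.floor_mono (by gcongr; exact this.2)⟩
  have hfl : ∀ m : ℤ, ⌊s * m / s⌋ = m := by
    intro m; rw [mul_div_cancel_left₀ _ hs.ne']; simp
  set T : ℤ → Set ℝ := fun m => Ico (s * m) (s * (m + 1)) with hT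
  have hmemT : ∀ x m, x ∈ T m ↔ ⌊x / s⌋ = m := by
    intro x m
    rw [Int.floor_eq_iff, le_div_iff₀ hs, div_lt_iff₀ hs]
    simp [hT, mul_comm]
  have hcount : {m : ℤ | s * m ∈ S} = ((K.filter fun m => s * m ∈ S : Finset ℤ) : Set ℤ) := by
    ext m
    simp only [mem_ofPred_eq, Finset.coe_filter]
    refine ⟨fun h => ⟨?_, h⟩, fun h => h.2⟩
    simpa [hfl] using hmemK _ h
  have hvol : volume.real S = ∑ m ∈ K, volume.real (S ∩ T m) := by
    rw [← measureReal_biUnion_finset (h := fun m _ =>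
      ((measure_mono inter_subset_right).trans_lt (by simp [hT])).ne)]
    · congr 1
      ext x
      simp only [mem_iUnion, mem_inter_iff, exists_prop]
      exact ⟨fun h => ⟨_, hmemK x h, h, (hmemT _ _).2 rfl⟩, fun ⟨_, _, h, _⟩ => h⟩
    · intro m _ m' _ hne
      refine Set.disjoint_left.2 fun x hx hx' => hne ?_
      rw [← (hmemT _ _).1 hx.2, (hmemT _ _).1 hx'.2]
    · intro m _
      exact hS.inter measurableSet_Ico
  have hTvol : ∀ m, volume.real (T m) = s := by
    intro m
    simp only [hT, Measure.real, Real.volume_Ico]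
    rw [ENNReal.toReal_ofReal (by nlinarith)]; ring
  have hterm : ∀ m : ℤ, |(if s * m ∈ S then s else 0) - volume.real (S ∩ T m)|
      ≤ if m ∈ F.image (fun x => ⌊x / s⌋) then s else 0 := by
    intro m
    have h1 : volume.real (S ∩ T m) ≤ s := by
      rw [← hTvol m]
      exact measureReal_mono inter_subset_right (by simp [hT])
    have h0 : 0 ≤ volume.real (S ∩ T m) := measureReal_nonneg
    split_ifs with h2 h3 h3
    · rw [abs_le]; constructor <;> linarith
    · have hsm : s * m ∈ T m := (hmemT _ _).2 (hfl m)
      have : T m ⊆ S := by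
        by_contra hcon
        obtain ⟨y, hy, hyS⟩ := not_subset.1 hcon
        obtain ⟨z, hz⟩ := inter_frontier_nonempty_of_isPreconnected
          (isPreconnected_Ico (a := s * m) (b := s * (m + 1))) (S := S) ⟨_, hsm, h2⟩ ⟨y, hy, hyS⟩
        exact h3 (Finset.mem_image.2 ⟨z, hF hz.2, (hmemT _ _).1 hz.1⟩)
      rw [inter_eq_right.2 this, hTvol]; simp
    · rw [abs_le]; constructor <;> linarith
    · have hsm : s * m ∈ T m := (hmemT _ _).2 (hfl m)
      have : S ∩ T m = ∅ := by
        by_contra hcon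
        obtain ⟨y, hyS, hy⟩ := nonempty_iff_ne_empty.2 hcon
        obtain ⟨z, hz⟩ := inter_frontier_nonempty_of_isPreconnected
          (isPreconnected_Ico (a := s * m) (b := s * (m + 1))) (S := S) ⟨_, hy, hyS⟩ ⟨_, hsm, h2⟩
        exact h3 (Finset.mem_image.2 ⟨z, hF hz.2, (hmemT _ _).1 hz.1⟩)
      simp [this]
  have hc2 : ({m : ℤ | s * m ∈ S}.ncard : ℝ) * s = ∑ m ∈ K, if s * m ∈ S then s else 0 := by
    rw [hcount, ncard_coe_finset, ← Finset.sum_filter, Finset.sum_const, nsmul_eq_mul]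
  rw [hc2, hvol, ← Finset.sum_sub_distrib]
  calc _ ≤ ∑ m ∈ K, if m ∈ F.image (fun x => ⌊x / s⌋) then s else 0 :=
        (Finset.abs_sum_le_sum_abs _ _).trans (Finset.sum_le_sum fun m _ => hterm m)
    _ = ((K.filter fun m => m ∈ F.image (fun x => ⌊x / s⌋)).card : ℝ) * s := by
        rw [← Finset.sum_filter, Finset.sum_const, nsmul_eq_mul]
    _ ≤ F.card * s := by
        gcongr
        refine (Finset.card_le_card (t := F.image (fun x => ⌊x / s⌋)) ?_).trans Finset.card_image_le
        intro m hm
        exact (Finset.mem_filter.1 hm).2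

/-- The number of points of the lattice `∏ s i ℤ` in `S`. -/
noncomputable def latticeCount {n : ℕ} (s : Fin n → ℝ) (S : Set (Fin n → ℝ)) : ℕ :=
  {a : Fin n → ℤ | (fun i => s i * a i) ∈ S}.ncard

lemma measurePreserving_cons (n : ℕ) :
    MeasurePreserving (fun p : ℝ × (Fin n → ℝ) => (Fin.cons p.1 p.2 : Fin (n + 1) → ℝ)) := by
  have := (volume_preserving_piFinSuccAbove (fun _ : Fin (n + 1) => ℝ) 0).symm
  convert! this using 1
  ext p i
  simp [MeasurableEquiv.piFinSuccAbove, Fin.insertNthEquiv]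

lemma volume_eq_lintegral_cons {n : ℕ} {S : Set (Fin (n + 1) → ℝ)} (hS : MeasurableSet S) :
    volume S = ∫⁻ t : ℝ, volume {y : Fin n → ℝ | (Fin.cons t y : Fin (n + 1) → ℝ) ∈ S} := by
  rw [← (measurePreserving_cons n).measure_preimage hS.nullMeasurableSet, Measure.volume_eq_prod,
    Measure.prod_apply ((measurePreserving_cons n).measurable hS)]
  rfl

lemma volume_eq_lintegral_cons_symm {n : ℕ} {S : Set (Fin (n + 1) → ℝ)} (hS : MeasurableSet S) :
    volume S = ∫⁻ y : Fin n → ℝ, volume {t : ℝ | (Fin.cons t y : Fin (n + 1) → ℝ) ∈ S} := by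
  rw [← (measurePreserving_cons n).measure_preimage hS.nullMeasurableSet, Measure.volume_eq_prod,
    Measure.prod_apply_symm ((measurePreserving_cons n).measurable hS)]
  rfl

/-- The polynomial in one variable obtained by specializing all variables but the first. -/
noncomputable def specializeTail {n : ℕ} (R : MvPolynomial (Fin (n + 1)) ℝ) (y : Fin n → ℝ) :
    Polynomial ℝ :=
  (MvPolynomial.finSuccEquiv ℝ n R).map (MvPolynomial.eval y)

/-- The polynomial obtained by specializing the first variable. -/
noncomputable def specializeHead {n : ℕ} (R : MvPolynomial (Fin (n + 1)) ℝ) (t : ℝ) :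
    MvPolynomial (Fin n) ℝ :=
  (MvPolynomial.finSuccEquiv ℝ n R).eval (MvPolynomial.C t)

lemma eval_specializeTail {n : ℕ} (R : MvPolynomial (Fin (n + 1)) ℝ) (y : Fin n → ℝ) (t : ℝ) :
    (specializeTail R y).eval t = MvPolynomial.eval (Fin.cons t y) R :=
  (MvPolynomial.eval_eq_eval_mv_eval' y t R).symm

lemma eval_specializeHead {n : ℕ} (R : MvPolynomial (Fin (n + 1)) ℝ) (y : Fin n → ℝ) (t : ℝ) :
    MvPolynomial.eval y (specializeHead R t) = MvPolynomial.eval (Fin.cons t y) R := by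
  rw [MvPolynomial.eval_eq_eval_mv_eval', specializeHead, Polynomial.eval_map,
    Polynomial.eval, Polynomial.hom_eval₂]
  simp [Polynomial.eval₂_eq_sum]

lemma natDegree_specializeTail_le {n : ℕ} (R : MvPolynomial (Fin (n + 1)) ℝ) (y : Fin n → ℝ) :
    (specializeTail R y).natDegree ≤ R.degreeOf 0 :=
  Polynomial.natDegree_map_le.trans (MvPolynomial.natDegree_finSuccEquiv R).le

lemma degreeOf_specializeHead_le {n : ℕ} (R : MvPolynomial (Fin (n + 1)) ℝ) (t : ℝ) (j : Fin n) :
    (specializeHead R t).degreeOf j ≤ R.degreeOf j.succ := by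
  rw [specializeHead, Polynomial.eval_eq_sum_range]
  refine (MvPolynomial.degreeOf_sum_le _ _ _).trans (Finset.sup_le fun i _ => ?_)
  refine (MvPolynomial.degreeOf_mul_le _ _ _).trans ?_
  rw [← map_pow, MvPolynomial.degreeOf_C, add_zero]
  exact MvPolynomial.degreeOf_coeff_finSuccEquiv R j i

/-- Seen as a polynomial in the first variable, `R` has at most `R.degreeOf 0` constant roots. -/
lemma exists_specializeHead_ne_zero {n : ℕ} {R : MvPolynomial (Fin (n + 1)) ℝ} (hR : R ≠ 0) :
    ∃ F : Finset ℝ, F.card ≤ R.degreeOf 0 ∧ ∀ t ∉ F, specializeHead R t ≠ 0 := by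
  classical
  have hQ : MvPolynomial.finSuccEquiv ℝ n R ≠ 0 := by simpa using hR
  refine ⟨(MvPolynomial.finSuccEquiv ℝ n R).roots.toFinset.preimage MvPolynomial.C
    (MvPolynomial.C_injective _ _).injOn, ?_, fun t ht h => ht ?_⟩
  · refine (Finset.card_le_card_of_injOn MvPolynomial.C (fun x hx => Finset.mem_preimage.1 hx)
      (MvPolynomial.C_injective _ _).injOn).trans ?_
    refine (Multiset.toFinset_card_le _).trans ?_
    rw [← MvPolynomial.natDegree_finSuccEquiv]
    exact Polynomial.card_roots' _
  · simpa [hQ, specializeHead] using h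

/-- Fubini and induction: all but finitely many slices are zero loci of nonzero polynomials in one
variable less. -/
lemma volume_zeroLocus_eq_zero {n : ℕ} {R : MvPolynomial (Fin n) ℝ} (hR : R ≠ 0) :
    volume {x : Fin n → ℝ | MvPolynomial.eval x R = 0} = 0 := by
  induction n with
  | zero =>
    obtain ⟨c, rfl⟩ := MvPolynomial.C_surjective (Fin 0) R
    have hc : c ≠ 0 := by rintro rfl; simp at hR
    simp [hc]
  | succ n ih =>
    have hcl : MeasurableSet {x : Fin (n + 1) → ℝ | MvPolynomial.eval x R = 0} :=
      (isClosed_eq (MvPolynomial.continuous_eval R) continuous_const).measurableSet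
    rw [volume_eq_lintegral_cons hcl]
    obtain ⟨F, -, hF⟩ := exists_specializeHead_ne_zero hR
    rw [← lintegral_zero (α := ℝ) (μ := volume)]
    refine lintegral_congr_ae ?_
    have : ∀ᵐ t : ℝ, t ∉ F := by
      rw [ae_iff]; simpa using F.finite_toSet.measure_zero volume
    filter_upwards [this] with t ht
    simpa [eval_specializeHead] using ih (hF t ht)

/-- The bad `y` are zeros of the leading coefficient of `R` in the first variable. -/
lemma ae_specializeTail_ne_zero {n : ℕ} {R : MvPolynomial (Fin (n + 1)) ℝ} (hR : R ≠ 0) :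
    ∀ᵐ y : Fin n → ℝ, specializeTail R y ≠ 0 := by
  have hQ : MvPolynomial.finSuccEquiv ℝ n R ≠ 0 := by simpa using hR
  have h := volume_zeroLocus_eq_zero (Polynomial.leadingCoeff_ne_zero.2 hQ)
  rw [ae_iff]
  refine measure_mono_null (fun y hy => ?_) h
  simp only [not_not, mem_ofPred_eq] at hy ⊢
  have := congrArg (fun p => p.coeff (MvPolynomial.finSuccEquiv ℝ n R).natDegree) hy
  simpa [specializeTail, Polynomial.coeff_map] using this

lemma isOpen_section_head {n : ℕ} {S : Set (Fin (n + 1) → ℝ)} (hS : IsOpen S) (t : ℝ) :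
    IsOpen {y : Fin n → ℝ | (Fin.cons t y : Fin (n + 1) → ℝ) ∈ S} :=
  hS.preimage (by fun_prop)

/-- There are `2⌊B/s⌋ + 1` integers; the summand `1` costs `s ≤ 1 ≤ B`, whence `3 * B` instead of `2
* B`. -/
lemma card_Icc_floor_mul_le {s B : ℝ} (hs : 0 < s) (hs1 : s ≤ 1) (hB : 1 ≤ B) :
    ((Finset.Icc (-⌊B / s⌋) ⌊B / s⌋).card : ℝ) * s ≤ 3 * B := by
  have h0 : 0 ≤ ⌊B / s⌋ := Int.floor_nonneg.2 (by positivity)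
  have : ((Finset.Icc (-⌊B / s⌋) ⌊B / s⌋).card : ℝ) = 2 * ⌊B / s⌋ + 1 := by
    rw [Int.card_Icc, ← Int.cast_natCast (R := ℝ), Int.toNat_of_nonneg (by linarith)]
    push_cast; ring
  have h2 : (⌊B / s⌋ : ℝ) * s ≤ B := (le_div_iff₀ hs).1 (Int.floor_le (B / s))
  rw [this]; nlinarith

lemma mem_Icc_floor {s B : ℝ} (hs : 0 < s) {m : ℤ} (hm : s * m ∈ Icc (-B) B) :
    m ∈ Finset.Icc (-⌊B / s⌋) ⌊B / s⌋ := by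
  rw [Finset.mem_Icc, neg_le, Int.le_floor, Int.le_floor, le_div_iff₀ hs, le_div_iff₀ hs]
  push_cast
  exact ⟨by linarith [hm.1], by linarith [hm.2]⟩

lemma setOf_lattice_subset {n : ℕ} {B : ℝ} {s : Fin n → ℝ} (hs : ∀ i, 0 < s i)
    {S : Set (Fin n → ℝ)} (hS : S ⊆ Icc (fun _ => -B) (fun _ => B)) :
    {a : Fin n → ℤ | (fun i => s i * a i) ∈ S} ⊆
      (Fintype.piFinset fun i => Finset.Icc (-⌊B / s i⌋) ⌊B / s i⌋ : Finset (Fin n → ℤ)) := by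
  intro a ha
  rw [Finset.mem_coe, Fintype.mem_piFinset]
  intro i
  exact mem_Icc_floor (hs i) ⟨(hS ha).1 i, (hS ha).2 i⟩

lemma latticeCount_mul_prod_le {n : ℕ} {B : ℝ} (hB : 1 ≤ B) {s : Fin n → ℝ} (hs : ∀ i, 0 < s i)
    (hs1 : ∀ i, s i ≤ 1) {S : Set (Fin n → ℝ)} (hS : S ⊆ Icc (fun _ => -B) (fun _ => B)) :
    (latticeCount s S : ℝ) * ∏ i, s i ≤ (3 * B) ^ n := by
  have h1 : (latticeCount s S : ℝ) ≤ ∏ i, ((Finset.Icc (-⌊B / s i⌋) ⌊B / s i⌋).card : ℝ) := by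
    rw [latticeCount]
    have := ncard_le_ncard (setOf_lattice_subset hs hS) (Finset.finite_toSet _)
    rw [ncard_coe_finset, Fintype.card_piFinset] at this
    exact_mod_cast this
  calc _ ≤ (∏ i, ((Finset.Icc (-⌊B / s i⌋) ⌊B / s i⌋).card : ℝ)) * ∏ i, s i := by
        gcongr; exact Finset.prod_nonneg fun i _ => (hs i).le
    _ = ∏ i, (((Finset.Icc (-⌊B / s i⌋) ⌊B / s i⌋).card : ℝ) * s i) := by
        rw [Finset.prod_mul_distrib]
    _ ≤ ∏ _i : Fin n, 3 * B := Finset.prod_le_prod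
        (fun i _ => mul_nonneg (Nat.cast_nonneg _) (hs i).le)
        fun i _ => card_Icc_floor_mul_le (hs i) (hs1 i) hB
    _ = (3 * B) ^ n := by simp

lemma volume_real_box (n : ℕ) {B : ℝ} (hB : 0 ≤ B) :
    volume.real (Icc (fun _ : Fin n => -B) (fun _ => B)) = (2 * B) ^ n := by
  rw [Measure.real, Real.volume_Icc_pi_toReal (fun i => by linarith)]
  simp [two_mul]

lemma volume_real_le_of_subset_box {n : ℕ} {B : ℝ} (hB : 0 ≤ B) {S : Set (Fin n → ℝ)}
    (hS : S ⊆ Icc (fun _ => -B) (fun _ => B)) : volume.real S ≤ (2 * B) ^ n := by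
  rw [← volume_real_box n hB]
  exact measureReal_mono hS isCompact_Icc.measure_lt_top.ne

lemma latticeCount_succ {n : ℕ} {B : ℝ} {s : Fin (n + 1) → ℝ} (hs : ∀ i, 0 < s i)
    {S : Set (Fin (n + 1) → ℝ)} (hS : S ⊆ Icc (fun _ => -B) (fun _ => B)) :
    latticeCount s S = ∑ m ∈ Finset.Icc (-⌊B / s 0⌋) ⌊B / s 0⌋,
      latticeCount (fun i => s i.succ) {y : Fin n → ℝ | (Fin.cons (s 0 * m) y : Fin (n + 1) → ℝ) ∈ S} := by
  classical
  have hfin : {a : Fin (n + 1) → ℤ | (fun i => s i * a i) ∈ S}.Finite :=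
    (Finset.finite_toSet _).subset (setOf_lattice_subset hs hS)
  have hcons : ∀ (m : ℤ) (a : Fin n → ℤ),
      (fun i => s i * ((Fin.cons m a : Fin (n + 1) → ℤ) i : ℝ)) =
        Fin.cons (s 0 * m) (fun i => s i.succ * a i) := by
    intro m a; ext i; refine Fin.cases ?_ (fun j => ?_) i <;> simp
  rw [latticeCount, ncard_eq_toFinset_card _ hfin, Finset.card_eq_sum_card_fiberwise
    (f := fun a => a 0) (t := Finset.Icc (-⌊B / s 0⌋) ⌊B / s 0⌋)]
  · refine Finset.sum_congr rfl fun m _ => ?_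
    rw [latticeCount, ← ncard_coe_finset]
    refine (ncard_congr (fun a _ => (Fin.cons m a : Fin (n + 1) → ℤ)) ?_ ?_ ?_).symm
    · intro a ha
      simpa [hcons] using ha
    · intro a b _ _ h
      exact (Fin.cons_inj.1 h).2
    · intro b hb
      simp only [Finset.coe_filter, Finite.mem_toFinset, mem_ofPred_eq] at hb
      refine ⟨Fin.tail b, ?_, ?_⟩
      · have := hb.1
        rw [← Fin.cons_self_tail b, hcons, hb.2] at this
        exact this
      · rw [← hb.2]; exact Fin.cons_self_tail b
  · intro a ha
    have ha' := setOf_lattice_subset hs hS (hfin.mem_toFinset.1 ha)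
    exact Fintype.mem_piFinset.1 ha' 0

/-- A Riemann sum of slice volumes. By Fubini it may be compared with the volume fibre by fibre in
the first coordinate, where the one-dimensional count applies: for almost every `y` the frontier of
the fibre lies in the roots of `specializeTail R y`. -/
lemma abs_sum_volume_section_sub_volume_le {n : ℕ} {B s : ℝ} (hB : 1 ≤ B) (hs : 0 < s)
    {S : Set (Fin (n + 1) → ℝ)} (hSo : IsOpen S) (hS : S ⊆ Icc (fun _ => -B) (fun _ => B))
    {R : MvPolynomial (Fin (n + 1)) ℝ} (hR : R ≠ 0)
    (hfr : frontier S ⊆ {x | MvPolynomial.eval x R = 0}) :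
    |∑ m ∈ Finset.Icc (-⌊B / s⌋) ⌊B / s⌋,
        volume.real {y : Fin n → ℝ | (Fin.cons (s * m) y : Fin (n + 1) → ℝ) ∈ S} * s - volume.real S|
      ≤ R.degreeOf 0 * s * (2 * B) ^ n := by
  classical
  set K := Finset.Icc (-⌊B / s⌋) ⌊B / s⌋ with hK
  set box : Set (Fin n → ℝ) := Icc (fun _ => -B) (fun _ => B) with hbox
  have hmem : ∀ t y, (Fin.cons t y : Fin (n + 1) → ℝ) ∈ S → t ∈ Icc (-B) B ∧ y ∈ box := by
    intro t y h
    have := hS h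
    exact ⟨⟨this.1 0, this.2 0⟩, fun i => this.1 i.succ, fun i => this.2 i.succ⟩
  have hSfin : volume S ≠ ⊤ := ((measure_mono hS).trans_lt isCompact_Icc.measure_lt_top).ne
  have hpre : MeasurableSet ((fun p : ℝ × (Fin n → ℝ) => (Fin.cons p.1 p.2 : Fin (n + 1) → ℝ)) ⁻¹' S) :=
    (measurePreserving_cons n).measurable hSo.measurableSet
  have hvS := volume_eq_lintegral_cons_symm hSo.measurableSet
  have hmeas : Measurable fun y : Fin n → ℝ => volume {t : ℝ | (Fin.cons t y : Fin (n + 1) → ℝ) ∈ S} :=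
    measurable_measure_prodMk_right hpre
  have hlt : ∀ᵐ y : Fin n → ℝ, volume {t : ℝ | (Fin.cons t y : Fin (n + 1) → ℝ) ∈ S} < ⊤ :=
    ae_lt_top hmeas (by rw [← hvS]; exact hSfin)
  have hvR : volume.real S = ∫ y : Fin n → ℝ, volume.real {t : ℝ | (Fin.cons t y : Fin (n + 1) → ℝ) ∈ S} := by
    rw [Measure.real, hvS, ← integral_toReal hmeas.aemeasurable hlt]; rfl
  have hint : Integrable fun y : Fin n → ℝ => volume.real {t : ℝ | (Fin.cons t y : Fin (n + 1) → ℝ) ∈ S} :=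
    integrable_toReal_of_lintegral_ne_top hmeas.aemeasurable (by rw [← hvS]; exact hSfin)
  have hsec : ∀ t, MeasurableSet {y : Fin n → ℝ | (Fin.cons t y : Fin (n + 1) → ℝ) ∈ S} :=
    fun t => (isOpen_section_head hSo t).measurableSet
  have hsecfin : ∀ t, volume {y : Fin n → ℝ | (Fin.cons t y : Fin (n + 1) → ℝ) ∈ S} ≠ ⊤ := fun t =>
    ((measure_mono fun y hy => (hmem t y hy).2).trans_lt isCompact_Icc.measure_lt_top).ne
  have hind : ∀ t, Integrable ({y : Fin n → ℝ | (Fin.cons t y : Fin (n + 1) → ℝ) ∈ S}.indicator fun _ => s) :=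
    fun t => (integrable_indicator_iff (hsec t)).2 (integrableOn_const (hsecfin t))
  have hsum : ∑ m ∈ K, volume.real {y : Fin n → ℝ | (Fin.cons (s * m) y : Fin (n + 1) → ℝ) ∈ S} * s
      = ∫ y : Fin n → ℝ, ∑ m ∈ K,
        {y : Fin n → ℝ | (Fin.cons (s * m) y : Fin (n + 1) → ℝ) ∈ S}.indicator (fun _ => s) y := by
    rw [integral_finsetSum _ fun m _ => hind _]
    refine Finset.sum_congr rfl fun m _ => ?_
    rw [integral_indicator (hsec _), setIntegral_const, smul_eq_mul]
  rw [hvR, hsum, ← integral_sub (integrable_finsetSum _ fun m _ => hind _) hint]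
  have hbint : Integrable (box.indicator fun _ => (R.degreeOf 0 : ℝ) * s) :=
    (integrable_indicator_iff measurableSet_Icc).2
      (integrableOn_const isCompact_Icc.measure_lt_top.ne)
  rw [← Real.norm_eq_abs]
  refine (norm_integral_le_of_norm_le hbint ?_).trans ?_
  · filter_upwards [ae_specializeTail_ne_zero hR] with y hy
    by_cases hyb : y ∈ box
    · rw [indicator_of_mem hyb]
      have hcnt : ∑ m ∈ K, {y : Fin n → ℝ | (Fin.cons (s * m) y : Fin (n + 1) → ℝ) ∈ S}.indicator
          (fun _ => s) y = ({m : ℤ | s * m ∈ {t : ℝ | (Fin.cons t y : Fin (n + 1) → ℝ) ∈ S}}.ncard : ℝ) * s := by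
        have : {m : ℤ | s * m ∈ {t : ℝ | (Fin.cons t y : Fin (n + 1) → ℝ) ∈ S}} =
            ((K.filter fun m : ℤ => (Fin.cons (s * m) y : Fin (n + 1) → ℝ) ∈ S : Finset ℤ) : Set ℤ) := by
          ext m
          simp only [mem_ofPred_eq, Finset.coe_filter]
          exact ⟨fun h => ⟨mem_Icc_floor hs (hmem _ _ h).1, h⟩, fun h => h.2⟩
        rw [this, ncard_coe_finset, ← nsmul_eq_mul, ← Finset.sum_const, Finset.sum_filter]
        rfl
      rw [hcnt, Real.norm_eq_abs]
      have hcont : Continuous fun t : ℝ => (Fin.cons t y : Fin (n + 1) → ℝ) := by fun_prop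
      refine (abs_count_mul_sub_volume_le (F := (specializeTail R y).roots.toFinset) hs
        (hSo.preimage hcont).measurableSet (fun t ht => (hmem t y ht).1) ?_).trans ?_
      · intro t ht
        have := hfr (hcont.frontier_preimage_subset S ht)
        simpa [hy, eval_specializeTail] using this
      · gcongr
        exact (Multiset.toFinset_card_le _).trans ((Polynomial.card_roots' _).trans
          (natDegree_specializeTail_le R y))
    · have h1 : {t : ℝ | (Fin.cons t y : Fin (n + 1) → ℝ) ∈ S} = ∅ :=
        eq_empty_of_forall_notMem fun t ht => hyb (hmem t y ht).2
      have h2 : ∀ t, y ∉ {y : Fin n → ℝ | (Fin.cons t y : Fin (n + 1) → ℝ) ∈ S} :=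
        fun t ht => hyb (hmem t y ht).2
      simp [h1, h2, hyb]
  · rw [integral_indicator measurableSet_Icc, setIntegral_const,
      volume_real_box n (by linarith), smul_eq_mul, mul_comm]

/-- Davenport's principle, by induction on slices of constant first coordinate. The constant depends
only on the dimension, the box and the degree bound, so that it serves for all slices at once. -/
theorem exists_abs_latticeCount_sub_volume_le (n h : ℕ) {B : ℝ} (hB : 1 ≤ B) :
    ∃ C : ℝ, 0 ≤ C ∧ ∀ (s : Fin n → ℝ) (σ : ℝ), (∀ i, 0 < s i) → (∀ i, s i ≤ σ) → 0 ≤ σ → σ ≤ 1 →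
      ∀ S : Set (Fin n → ℝ), IsOpen S → S ⊆ Icc (fun _ => -B) (fun _ => B) →
      ∀ R : MvPolynomial (Fin n) ℝ, R ≠ 0 → (∀ i, R.degreeOf i ≤ h) →
      frontier S ⊆ {x | MvPolynomial.eval x R = 0} →
      |(latticeCount s S : ℝ) * ∏ i, s i - volume.real S| ≤ C * σ := by
  induction n with
  | zero =>
    refine ⟨0, le_rfl, fun s σ _ _ _ _ S _ _ R _ _ _ => ?_⟩
    rcases S.eq_empty_or_nonempty with rfl | hne
    · simp [latticeCount]
    · rw [Subsingleton.eq_univ_of_nonempty hne, Measure.real, Measure.volume_pi_eq_dirac 0]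
      simp [latticeCount]
  | succ n ih =>
    obtain ⟨C, hC, ih⟩ := ih
    -- The terms are: the inductive error over all slices; the at most `h` slices on which `R`
    -- vanishes identically, bounded trivially; the passage from slice volumes to the volume.
    refine ⟨3 * B * C + h * (3 * B) ^ n + h * (2 * B) ^ n, by positivity, ?_⟩
    intro s σ hs hsσ hσ hσ1 S hSo hS R hR hdeg hfr
    set K := Finset.Icc (-⌊B / s 0⌋) ⌊B / s 0⌋ with hK
    set sec : ℝ → Set (Fin n → ℝ) := fun t => {y | (Fin.cons t y : Fin (n + 1) → ℝ) ∈ S} with hsec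
    have hsecb : ∀ t, sec t ⊆ Icc (fun _ => -B) (fun _ => B) := fun t y hy =>
      ⟨fun i => (hS hy).1 i.succ, fun i => (hS hy).2 i.succ⟩
    obtain ⟨F, hFc, hF⟩ := exists_specializeHead_ne_zero hR
    have h2 := abs_sum_volume_section_sub_volume_le hB (hs 0) hSo hS hR hfr
    have h1 : |(latticeCount s S : ℝ) * ∏ i, s i - ∑ m ∈ K, volume.real (sec (s 0 * m)) * s 0|
        ≤ 3 * B * C * σ + h * (3 * B) ^ n * σ := by
      rw [latticeCount_succ hs hS, Fin.prod_univ_succ]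
      push_cast
      rw [Finset.sum_mul, ← Finset.sum_sub_distrib]
      have hterm : ∀ m ∈ K, |(latticeCount (fun i => s i.succ) (sec (s 0 * m)) : ℝ) *
          (s 0 * ∏ i : Fin n, s i.succ) - volume.real (sec (s 0 * m)) * s 0| ≤
          s 0 * (C * σ) + if s 0 * m ∈ F then s 0 * (3 * B) ^ n else 0 := by
        intro m _
        rw [show (latticeCount (fun i => s i.succ) (sec (s 0 * m)) : ℝ) *
          (s 0 * ∏ i : Fin n, s i.succ) - volume.real (sec (s 0 * m)) * s 0 =
          s 0 * ((latticeCount (fun i => s i.succ) (sec (s 0 * m)) : ℝ) * ∏ i : Fin n, s i.succ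
            - volume.real (sec (s 0 * m))) by ring, abs_mul, abs_of_pos (hs 0)]
        split_ifs with hmF
        · rw [← mul_add]
          refine mul_le_mul_of_nonneg_left ?_ (hs 0).le
          have e1 := latticeCount_mul_prod_le hB (s := fun i => s i.succ) (fun i => hs _)
            (fun i => (hsσ _).trans hσ1) (hsecb (s 0 * m))
          have e2 := volume_real_le_of_subset_box (by linarith) (hsecb (s 0 * m))
          have e3 : 0 ≤ (latticeCount (fun i => s i.succ) (sec (s 0 * m)) : ℝ) *
            ∏ i : Fin n, s i.succ := mul_nonneg (Nat.cast_nonneg _)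
              (Finset.prod_nonneg fun i _ => (hs _).le)
          have e4 : 0 ≤ volume.real (sec (s 0 * m)) := measureReal_nonneg
          have e5 : (2 * B) ^ n ≤ (3 * B) ^ n := by gcongr; norm_num
          have e6 : 0 ≤ C * σ := by positivity
          rw [abs_le]; constructor <;> linarith
        · rw [add_zero]
          refine mul_le_mul_of_nonneg_left ?_ (hs 0).le
          refine ih _ σ (fun i => hs _) (fun i => hsσ _) hσ hσ1 _ (isOpen_section_head hSo _)
            (hsecb _) _ (hF _ hmF) (fun i => (degreeOf_specializeHead_le R _ i).trans (hdeg _)) ?_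
          intro y hy
          have hcont : Continuous fun y : Fin n → ℝ => (Fin.cons (s 0 * m) y : Fin (n + 1) → ℝ) := by
            fun_prop
          have := hfr (hcont.frontier_preimage_subset S hy)
          simpa [eval_specializeHead] using this
      refine (Finset.abs_sum_le_sum_abs _ _).trans ((Finset.sum_le_sum hterm).trans ?_)
      rw [Finset.sum_add_distrib, Finset.sum_const, nsmul_eq_mul, ← Finset.sum_filter,
        Finset.sum_const, nsmul_eq_mul]
      have hcard : ((K.filter fun m : ℤ => s 0 * m ∈ F).card : ℝ) ≤ h := by
        have : (K.filter fun m : ℤ => s 0 * m ∈ F).card ≤ F.card :=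
          Finset.card_le_card_of_injOn (fun m => s 0 * m) (fun m hm => (Finset.mem_filter.1 hm).2)
            fun m _ m' _ hmm => by simpa [(hs 0).ne'] using hmm
        exact_mod_cast this.trans (hFc.trans (hdeg 0))
      have hKc := card_Icc_floor_mul_le (hs 0) ((hsσ 0).trans hσ1) hB
      refine add_le_add ?_ ?_
      · calc (K.card : ℝ) * (s 0 * (C * σ)) = K.card * s 0 * (C * σ) := by ring
          _ ≤ 3 * B * (C * σ) := by gcongr
          _ = _ := by ring
      · calc _ ≤ (h : ℝ) * (σ * (3 * B) ^ n) := by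
              have := hsσ 0
              have := (hs 0).le
              gcongr
          _ = _ := by ring
    have h3 : (R.degreeOf 0 : ℝ) * s 0 * (2 * B) ^ n ≤ h * (2 * B) ^ n * σ := by
      have : (R.degreeOf 0 : ℝ) ≤ h := by exact_mod_cast hdeg 0
      calc _ ≤ (h : ℝ) * σ * (2 * B) ^ n := by
            have := hsσ 0
            have := (hs 0).le
            gcongr
        _ = _ := by ring
    have := abs_sub_le ((latticeCount s S : ℝ) * ∏ i, s i)
      (∑ m ∈ K, volume.real (sec (s 0 * m)) * s 0) (volume.real S)
    linarith [h2.trans h3]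

/-- Schwartz–Zippel on the grid of lattice points in the box: each direction has at least `B / s i ≥
1 / σ` points, so the proportion of zeros is at most `n * h * σ`. -/
theorem latticeCount_zeroLocus_le {n h : ℕ} {B : ℝ} (hB : 1 ≤ B) {s : Fin n → ℝ} {σ : ℝ}
    (hs : ∀ i, 0 < s i) (hsσ : ∀ i, s i ≤ σ) (hσ1 : σ ≤ 1)
    {R : MvPolynomial (Fin n) ℝ} (hR : R ≠ 0) (hdeg : ∀ i, R.degreeOf i ≤ h) :
    (latticeCount s (Icc (fun _ => -B) (fun _ => B) ∩ {x | MvPolynomial.eval x R = 0}) : ℝ) *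
      ∏ i, s i ≤ (3 * B) ^ n * (n * (h * σ)) := by
  classical
  set K : Fin n → Finset ℤ := fun i => Finset.Icc (-⌊B / s i⌋) ⌊B / s i⌋ with hK
  set T : Fin n → Finset ℝ := fun i => (K i).image fun m : ℤ => s i * m with hT
  have hTc : ∀ i, (T i).card = (K i).card := fun i =>
    Finset.card_image_of_injective _ fun a b hab => by simpa [(hs i).ne'] using hab
  have hKpos : ∀ i, B ≤ (K i).card * s i := by
    intro i
    have h0 : 0 ≤ ⌊B / s i⌋ := Int.floor_nonneg.2 (div_nonneg (by linarith) (hs i).le)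
    have h1 : ((K i).card : ℝ) = 2 * ⌊B / s i⌋ + 1 := by
      rw [hK, Int.card_Icc, ← Int.cast_natCast (R := ℝ), Int.toNat_of_nonneg (by linarith)]
      push_cast; ring
    have h2 := (Int.lt_floor_add_one (B / s i)).le
    rw [div_le_iff₀ (hs i)] at h2
    refine h2.trans (mul_le_mul_of_nonneg_right ?_ (hs i).le)
    rw [h1]
    have : (0 : ℝ) ≤ ⌊B / s i⌋ := by exact_mod_cast h0
    linarith
  have hcard0 : ∀ i, 0 < ((K i).card : ℝ) := fun i => by
    by_contra hc
    have := hKpos i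
    nlinarith [hs i, not_lt.1 hc]
  have hsz := MvPolynomial.schwartz_zippel_sum_degreeOf hR T
  have hsz' : ((Finset.filter (fun x => MvPolynomial.eval x R = 0) (Fintype.piFinset T)).card : ℝ) /
      ∏ i, ((K i).card : ℝ) ≤ ∑ i, (R.degreeOf i : ℝ) / (K i).card := by
    have := (NNRat.cast_le (K := ℝ)).2 hsz
    simp only [hTc] at this
    push_cast at this
    exact this
  have hcnt : (latticeCount s (Icc (fun _ => -B) (fun _ => B) ∩ {x | MvPolynomial.eval x R = 0})) ≤
      (Finset.filter (fun x => MvPolynomial.eval x R = 0) (Fintype.piFinset T)).card := by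
    rw [latticeCount, ← ncard_coe_finset]
    refine ncard_le_ncard_of_injOn (fun a i => s i * (a i : ℝ)) ?_ ?_ (Finset.finite_toSet _)
    · intro a ha
      simp only [Finset.coe_filter, Fintype.mem_piFinset, mem_ofPred_eq]
      refine ⟨fun i => Finset.mem_image.2 ⟨a i, ?_, rfl⟩, ha.2⟩
      exact Fintype.mem_piFinset.1 (setOf_lattice_subset hs inter_subset_left ha) i
    · intro a _ b _ hab
      ext i
      simpa [(hs i).ne'] using congrFun hab i
  have hP : 0 < ∏ i, ((K i).card : ℝ) := Finset.prod_pos fun i _ => hcard0 i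
  rw [div_le_iff₀ hP] at hsz'
  calc _ ≤ ((∑ i, (R.degreeOf i : ℝ) / (K i).card) * ∏ i, ((K i).card : ℝ)) * ∏ i, s i := by
        have h1 : 0 ≤ ∏ i, s i := Finset.prod_nonneg fun i _ => (hs i).le
        exact mul_le_mul_of_nonneg_right ((Nat.cast_le.2 hcnt).trans hsz') h1
    _ = (∏ i, ((K i).card : ℝ) * s i) * ∑ i, (R.degreeOf i : ℝ) / (K i).card := by
        rw [Finset.prod_mul_distrib]; ring
    _ ≤ (3 * B) ^ n * (n * (h * σ)) := by
        have e1 : ∏ i, ((K i).card : ℝ) * s i ≤ (3 * B) ^ n := by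
          calc _ ≤ ∏ _i : Fin n, 3 * B := Finset.prod_le_prod
                (fun i _ => mul_nonneg (Nat.cast_nonneg _) (hs i).le)
                fun i _ => card_Icc_floor_mul_le (hs i) ((hsσ i).trans hσ1) hB
            _ = _ := by simp
        have e2 : ∑ i, (R.degreeOf i : ℝ) / (K i).card ≤ n * (h * σ) := by
          calc _ ≤ ∑ _i : Fin n, (h * σ : ℝ) := by
                refine Finset.sum_le_sum fun i _ => ?_
                rw [div_le_iff₀ (hcard0 i), mul_assoc]
                have a1 : (R.degreeOf i : ℝ) ≤ h := by exact_mod_cast hdeg i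
                have a2 : 1 ≤ σ * (K i).card := by
                  nlinarith [hKpos i, hsσ i, hcard0 i]
                nlinarith [Nat.cast_nonneg (α := ℝ) h]
            _ = _ := by simp
        refine mul_le_mul e1 e2 (Finset.sum_nonneg fun i _ => by positivity) (by positivity)

end LatticeCount

end PerronCount

namespace PerronCount

open Polynomial

/-! ### Real monic polynomials, their roots, and generic position -/

section MonicPoly

/-- The monic polynomial `X ^ N + ∑ i < N, a i * X ^ i`. -/
noncomputable def monicPoly {R : Type*} [CommRing R] {N : ℕ} (a : Fin N → R) : R[X] :=
  X ^ N + ∑ i, C (a i) * X ^ (i : ℕ)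

variable {R S : Type*} [CommRing R] [CommRing S] {N : ℕ}

lemma degree_monicPoly_tail_lt (a : Fin N → R) :
    (∑ i, C (a i) * X ^ (i : ℕ)).degree < (N : WithBot ℕ) := by
  refine (degree_sum_le _ _).trans_lt ((Finset.sup_lt_iff (WithBot.bot_lt_coe N)).2 fun i _ => ?_)
  exact (degree_C_mul_X_pow_le _ _).trans_lt (WithBot.coe_lt_coe.2 i.2)

lemma monic_monicPoly (a : Fin N → R) : (monicPoly a).Monic :=
  monic_X_pow_add (degree_monicPoly_tail_lt a)

lemma natDegree_monicPoly [Nontrivial R] (a : Fin N → R) : (monicPoly a).natDegree = N := by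
  refine natDegree_eq_of_degree_eq_some ?_
  rw [monicPoly, degree_add_eq_left_of_degree_lt, degree_X_pow]
  rw [degree_X_pow]; exact degree_monicPoly_tail_lt a

lemma coeff_monicPoly (a : Fin N → R) (i : Fin N) : (monicPoly a).coeff i = a i := by
  simp [monicPoly, coeff_X_pow, i.2.ne, Finset.sum_ite_eq, Fin.val_inj]

lemma map_monicPoly (f : R →+* S) (a : Fin N → R) :
    (monicPoly a).map f = monicPoly fun i => f (a i) := by
  simp [monicPoly, Polynomial.map_sum]

lemma eval_monicPoly (a : Fin N → R) (z : R) :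
    (monicPoly a).eval z = z ^ N + ∑ i, a i * z ^ (i : ℕ) := by
  simp [monicPoly, eval_finsetSum]

lemma monicPoly_injective : Function.Injective (monicPoly : (Fin N → R) → R[X]) := by
  intro a b h
  ext i
  rw [← coeff_monicPoly a, h, coeff_monicPoly]

lemma monicPoly_coeff {p : R[X]} (hp : p.Monic) (hN : p.natDegree = N) :
    monicPoly (fun i : Fin N => p.coeff i) = p := by
  conv_rhs => rw [hp.as_sum, hN, Finset.sum_range]
  rfl

/-- The complex roots of `monicPoly a`. -/
def croots (a : Fin N → ℝ) : Set ℂ :=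
  {z | z ^ N + ∑ i, (a i : ℂ) * z ^ (i : ℕ) = 0}

lemma mem_croots {a : Fin N → ℝ} {z : ℂ} :
    z ∈ croots a ↔ (monicPoly fun i => (a i : ℂ)).eval z = 0 := by
  rw [eval_monicPoly]; rfl

/-- `z` lists the complex roots of `monicPoly a` with multiplicity. -/
def IsRootList (a : Fin N → ℝ) (z : Fin N → ℂ) : Prop :=
  (monicPoly fun i => (a i : ℂ)) = ∏ i, (X - C (z i))

lemma exists_isRootList (a : Fin N → ℝ) : ∃ z, IsRootList a z := by
  set p : ℂ[X] := monicPoly fun i => (a i : ℂ)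
  have hs : p.Splits := IsAlgClosed.splits p
  have hcard : Multiset.card p.roots = N := by
    rw [← hs.natDegree_eq_card_roots, natDegree_monicPoly]
  obtain ⟨l, hl⟩ := Quot.exists_rep p.roots
  have hlen : l.length = N := by rw [← hcard, ← hl]; rfl
  subst hlen
  refine ⟨fun i => l.get i, ?_⟩
  have h := hs.eq_prod_roots_of_monic (monic_monicPoly _)
  rw [IsRootList]
  refine h.trans ?_
  rw [← hl]
  change (Multiset.map _ (l : Multiset ℂ)).prod = _
  rw [Multiset.map_coe, Multiset.prod_coe, ← List.prod_ofFn]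
  congr 1
  conv_lhs => rw [← List.ofFn_get l]
  rw [List.map_ofFn]; rfl

namespace IsRootList

variable {a : Fin N → ℝ} {z : Fin N → ℂ}

lemma eval_eq (h : IsRootList a z) (w : ℂ) :
    w ^ N + ∑ i, (a i : ℂ) * w ^ (i : ℕ) = ∏ i, (w - z i) := by
  rw [← eval_monicPoly, show (monicPoly fun i => (a i : ℂ)) = _ from h, eval_prod]
  simp

lemma croots_eq (h : IsRootList a z) : croots a = Set.range z := by
  ext w
  rw [croots, Set.mem_ofPred_eq, h.eval_eq, Finset.prod_eq_zero_iff]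
  simp [sub_eq_zero, eq_comm]

lemma mem (h : IsRootList a z) (i : Fin N) : z i ∈ croots a := by
  rw [h.croots_eq]; exact ⟨i, rfl⟩

lemma coeff_eq (h : IsRootList a z) (i : Fin N) :
    (a i : ℂ) = (-1) ^ (N - i) * (Finset.univ.val.map z).esymm (N - i) := by
  rw [← coeff_monicPoly (fun i => (a i : ℂ)) i, show (monicPoly fun i => (a i : ℂ)) = _ from h]
  have := Multiset.prod_X_sub_C_coeff (Finset.univ.val.map z) (k := i) (by simp [i.2.le])
  rw [Multiset.map_map] at this
  rw [Finset.prod_eq_multiset_prod]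
  simpa only [Function.comp_def, Multiset.card_map, Finset.card_val, Finset.card_univ, Fintype.card_fin] using this

end IsRootList

lemma conj_mem_croots {a : Fin N → ℝ} {z : ℂ} (hz : z ∈ croots a) :
    (starRingEnd ℂ) z ∈ croots a := by
  have := congrArg (starRingEnd ℂ) (show _ = _ from hz)
  simpa [croots, map_sum] using this

/-- The product of `F` over all permutations of the variables is symmetric, hence a polynomial in
the elementary symmetric functions, that is, in the coefficients up to sign. An algebraic relation
between roots therefore forces one between coefficients. -/
theorem exists_coeff_polynomial {F : MvPolynomial (Fin N) ℝ} (hF : F ≠ 0) :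
    ∃ R : MvPolynomial (Fin N) ℝ, R ≠ 0 ∧ ∀ (a : Fin N → ℝ) (z : Fin N → ℂ), IsRootList a z →
      MvPolynomial.aeval z F = 0 → MvPolynomial.eval a R = 0 := by
  classical
  set G : MvPolynomial (Fin N) ℝ := ∏ σ : Equiv.Perm (Fin N), MvPolynomial.rename σ F with hG
  have hGsymm : G.IsSymmetric := by
    intro τ
    rw [hG, map_prod]
    simp only [MvPolynomial.rename_rename]
    exact Fintype.prod_equiv (Equiv.mulLeft τ) _ _ fun σ => rfl
  have hG0 : G ≠ 0 := Finset.prod_ne_zero_iff.2 fun σ _ => by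
    rw [Ne, map_eq_zero_iff _ (MvPolynomial.rename_injective _ σ.injective)]; exact hF
  obtain ⟨Q, hQ⟩ := (MvPolynomial.esymmAlgEquiv (Fin N) ℝ (n := N) (by simp)).surjective ⟨G, hGsymm⟩
  have hQ' : MvPolynomial.aeval (fun i : Fin N => MvPolynomial.esymm (Fin N) ℝ (i + 1)) Q = G := by
    have := congrArg Subtype.val hQ
    rw [MvPolynomial.esymmAlgEquiv_apply, MvPolynomial.esymmAlgHom_apply] at this
    exact this
  -- The elementary symmetric function of degree `i + 1` of the roots is `(-1) ^ (i + 1)` times the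
  -- coefficient of index `N - 1 - i`.
  set R : MvPolynomial (Fin N) ℝ :=
    MvPolynomial.aeval (fun i : Fin N => (-1) ^ ((i : ℕ) + 1) * MvPolynomial.X i.rev) Q with hR
  have key : ∀ (a : Fin N → ℝ) (z : Fin N → ℂ), IsRootList a z →
      ((MvPolynomial.eval a R : ℝ) : ℂ) = MvPolynomial.aeval z G := by
    intro a z h
    have e1 : ((MvPolynomial.eval a R : ℝ) : ℂ) =
        MvPolynomial.aeval (fun i : Fin N => (-1) ^ ((i : ℕ) + 1) * (a i.rev : ℂ)) Q := by
      have : ((MvPolynomial.eval a R : ℝ) : ℂ) = MvPolynomial.aeval (fun i => (a i : ℂ)) R := by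
        have := MvPolynomial.aeval_algebraMap_apply ℂ a R
        simpa [MvPolynomial.aeval_eq_eval, Function.comp_def] using this.symm
      rw [this, hR, ← AlgHom.comp_apply, MvPolynomial.comp_aeval]
      simp
    rw [e1, ← hQ', ← AlgHom.comp_apply, MvPolynomial.comp_aeval]
    congr 2
    ext i
    have hi : N - (i.rev : ℕ) = i + 1 := by have := i.2; rw [Fin.val_rev]; omega
    rw [h.coeff_eq, hi, ← mul_assoc, ← pow_add, MvPolynomial.aeval_esymm_eq_multiset_esymm,
      Even.neg_one_pow (by simp), one_mul]
  refine ⟨R, ?_, ?_⟩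
  · intro h0
    -- `R` is nonzero because it does not vanish at the polynomial whose roots form a real point
    -- where `G ≠ 0`.
    obtain ⟨x, hx⟩ : ∃ x : Fin N → ℝ, MvPolynomial.eval x G ≠ 0 := by
      by_contra! hc
      exact hG0 (MvPolynomial.funext fun x => by simpa using hc x)
    set p : ℝ[X] := ∏ i, (X - C (x i))
    have hp : p.Monic := monic_prod_of_monic _ _ fun i _ => monic_X_sub_C _
    have hdeg : p.natDegree = N := by
      rw [natDegree_prod_of_monic _ _ fun i _ => monic_X_sub_C _]; simp
    have hlist : IsRootList (fun i : Fin N => p.coeff i) (fun i => (x i : ℂ)) := by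
      have := congrArg (Polynomial.map Complex.ofRealHom) (monicPoly_coeff hp hdeg)
      rw [map_monicPoly] at this
      refine Eq.trans this ?_
      simp [p, Polynomial.map_prod]
    have := key _ _ hlist
    rw [h0, map_zero, Complex.ofReal_zero] at this
    refine hx ?_
    have e2 := MvPolynomial.aeval_algebraMap_apply ℂ x G
    have e3 : ((MvPolynomial.eval x G : ℝ) : ℂ) = 0 := by
      rw [this]
      simpa [MvPolynomial.aeval_eq_eval, Function.comp_def] using e2.symm
    exact_mod_cast e3
  · intro a z h hz
    have := key a z h
    rw [hG, map_prod, Finset.prod_eq_zero (Finset.mem_univ 1)] at this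
    · exact_mod_cast this
    · simpa using hz

/-- The roots `z i` avoid finitely many algebraic coincidences. -/
structure IsGeneric (z : Fin N → ℂ) : Prop where
  sq_ne_one : ∀ i, z i ^ 2 ≠ 1
  mul_ne_one : ∀ i j, i ≠ j → z i * z j ≠ 1
  injective : ∀ i j, i ≠ j → z i ≠ z j
  add_ne_zero : ∀ i j, i ≠ j → z i + z j ≠ 0
  sq_ne_mul : ∀ i j k, i ≠ j → i ≠ k → j ≠ k → z k ^ 2 ≠ z i * z j
  add_ne_add : ∀ i j k l, i ≠ j → i ≠ k → i ≠ l → z i + z j ≠ z k + z l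

/-- Each excluded relation is a nonzero polynomial in the roots, so their product can be eliminated
at once. With conjugation, the relations `sq_ne_one` and `mul_ne_one` keep roots off the unit
circle, `add_ne_zero` and `sq_ne_mul` keep other roots from having the modulus of a real root, and
`add_ne_add` gives distinct conjugate pairs distinct real parts. -/
theorem exists_generic_polynomial (N : ℕ) :
    ∃ R : MvPolynomial (Fin N) ℝ, R ≠ 0 ∧ ∀ (a : Fin N → ℝ) (z : Fin N → ℂ), IsRootList a z →
      MvPolynomial.eval a R ≠ 0 → IsGeneric z := by
  classical
  set F : MvPolynomial (Fin N) ℝ :=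
    (∏ i, (MvPolynomial.X i ^ 2 - 1)) *
    (∏ i, ∏ j, if i ≠ j then (MvPolynomial.X i * MvPolynomial.X j - 1) *
      (MvPolynomial.X i - MvPolynomial.X j) * (MvPolynomial.X i + MvPolynomial.X j) else 1) *
    (∏ i, ∏ j, ∏ k, if i ≠ j ∧ i ≠ k ∧ j ≠ k then
      MvPolynomial.X k ^ 2 - MvPolynomial.X i * MvPolynomial.X j else 1) *
    (∏ i, ∏ j, ∏ k, ∏ l, if i ≠ j ∧ i ≠ k ∧ i ≠ l then
      MvPolynomial.X i + MvPolynomial.X j - MvPolynomial.X k - MvPolynomial.X l else 1) with hF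
  have ne_of_eval : ∀ (p : MvPolynomial (Fin N) ℝ) (x : Fin N → ℝ), MvPolynomial.eval x p ≠ 0 → p ≠ 0 :=
    fun p x h h0 => h (by rw [h0, map_zero])
  have hF0 : F ≠ 0 := by
    refine mul_ne_zero (mul_ne_zero (mul_ne_zero ?_ ?_) ?_) ?_
    · refine Finset.prod_ne_zero_iff.2 fun i _ => ne_of_eval _ 0 (by simp)
    · refine Finset.prod_ne_zero_iff.2 fun i _ => Finset.prod_ne_zero_iff.2 fun j _ => ?_
      split_ifs with h
      · refine mul_ne_zero (mul_ne_zero (ne_of_eval _ 0 (by simp)) ?_) ?_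
        · exact ne_of_eval _ (Pi.single i 1) (by simp [h.symm])
        · exact ne_of_eval _ (Pi.single i 1) (by simp [h.symm])
      · exact one_ne_zero
    · refine Finset.prod_ne_zero_iff.2 fun i _ => Finset.prod_ne_zero_iff.2 fun j _ =>
        Finset.prod_ne_zero_iff.2 fun k _ => ?_
      split_ifs with h
      · exact ne_of_eval _ (Pi.single k 1) (by simp [h.2.1])
      · exact one_ne_zero
    · refine Finset.prod_ne_zero_iff.2 fun i _ => Finset.prod_ne_zero_iff.2 fun j _ =>
        Finset.prod_ne_zero_iff.2 fun k _ => Finset.prod_ne_zero_iff.2 fun l _ => ?_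
      split_ifs with h
      · exact ne_of_eval _ (Pi.single i 1) (by simp [h.1.symm, h.2.1.symm, h.2.2.symm])
      · exact one_ne_zero
  obtain ⟨R, hR0, hR⟩ := exists_coeff_polynomial hF0
  refine ⟨R, hR0, fun a z hz ha => ?_⟩
  have h : ¬ MvPolynomial.aeval z F = 0 := fun h0 => ha (hR a z hz h0)
  rw [hF, map_mul, map_mul, map_mul] at h
  simp only [map_prod, mul_eq_zero, not_or, Finset.prod_eq_zero_iff, Finset.mem_univ, true_and,
    not_exists] at h
  obtain ⟨⟨⟨h1, h2⟩, h3⟩, h4⟩ := h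
  refine ⟨fun i => ?_, fun i j hij => ?_, fun i j hij => ?_, fun i j hij => ?_,
    fun i j k hij hik hjk => ?_, fun i j k l hij hik hil => ?_⟩
  · simpa [sub_eq_zero] using h1 i
  · have := h2 i j
    simp only [ne_eq, hij, not_false_eq_true, if_true, map_mul, mul_eq_zero, not_or] at this
    simpa [sub_eq_zero] using this.1.1
  · have := h2 i j
    simp only [ne_eq, hij, not_false_eq_true, if_true, map_mul, mul_eq_zero, not_or] at this
    simpa [sub_eq_zero] using this.1.2
  · have := h2 i j
    simp only [ne_eq, hij, not_false_eq_true, if_true, map_mul, mul_eq_zero, not_or] at this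
    simpa using this.2
  · simpa [hij, hik, hjk, sub_eq_zero] using h3 i j k
  · have := h4 i j k l
    simpa [hij, hik, hil, sub_eq_zero, sub_sub] using this

lemma IsRootList.comp_perm {a : Fin N → ℝ} {z : Fin N → ℂ} (h : IsRootList a z)
    (σ : Equiv.Perm (Fin N)) : IsRootList a (z ∘ σ) := by
  rw [IsRootList, show (monicPoly fun i => (a i : ℂ)) = _ from h]
  exact (Equiv.prod_comp σ fun i => X - C (z i)).symm

open scoped Topology

/-- Continuity of roots: `∏ |z i - v j|`, the modulus at `z i` of the nearby polynomial, drops below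
`ε ^ N`, so some root `v j` is within `ε` of `z i`. Separation by `2 * ε` makes the choice of `j`
injective, hence a permutation. -/
theorem eventually_exists_isRootList_close {a : Fin N → ℝ} {z : Fin N → ℂ} (h : IsRootList a z)
    {ε : ℝ} (hε : 0 < ε)
    (hsep : ∀ i j, i ≠ j → 2 * ε ≤ ‖z i - z j‖) :
    ∀ᶠ b in 𝓝 a, ∃ w, IsRootList b w ∧ ∀ i, ‖w i - z i‖ < ε := by
  have hev : ∀ᶠ b in 𝓝 a, ∀ i, ‖z i ^ N + ∑ j : Fin N, (b j : ℂ) * z i ^ (j : ℕ)‖ < ε ^ N := by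
    refine eventually_all.2 fun i => ?_
    have hc : Continuous fun b : Fin N → ℝ => ‖z i ^ N + ∑ j : Fin N, (b j : ℂ) * z i ^ (j : ℕ)‖ := by
      fun_prop
    refine (hc.tendsto a).eventually_lt_const ?_
    have : z i ∈ croots a := h.mem i
    rw [show z i ^ N + ∑ j : Fin N, (a j : ℂ) * z i ^ (j : ℕ) = 0 from this, norm_zero]
    positivity
  filter_upwards [hev] with b hb
  obtain ⟨v, hv⟩ := exists_isRootList b
  have hex : ∀ i, ∃ j, ‖v j - z i‖ < ε := by
    intro i
    by_contra! hcon
    have := hb i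
    rw [hv.eval_eq, norm_prod] at this
    refine this.not_ge ?_
    calc ε ^ N = ∏ _j : Fin N, ε := by simp
      _ ≤ _ := Finset.prod_le_prod (fun _ _ => hε.le) fun j _ => by
        rw [norm_sub_rev]; exact hcon j
  choose τ hτ using hex
  have hinj : Function.Injective τ := by
    intro i j hij
    by_contra hne
    have h1 := hτ i
    rw [hij, norm_sub_rev] at h1
    have := norm_sub_le_norm_sub_add_norm_sub (z i) (v (τ j)) (z j)
    linarith [hτ j, hsep i j hne]
  exact ⟨v ∘ τ, hv.comp_perm (Equiv.ofBijective τ (Finite.injective_iff_bijective.1 hinj)), hτ⟩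

lemma IsRootList.exists_conj {a : Fin N → ℝ} {z : Fin N → ℂ} (h : IsRootList a z) (i : Fin N) :
    ∃ j, z j = (starRingEnd ℂ) (z i) := by
  have := conj_mem_croots (h.mem i)
  rwa [h.croots_eq] at this

lemma IsGeneric.norm_ne_one {a : Fin N → ℝ} {z : Fin N → ℂ} (hg : IsGeneric z)
    (h : IsRootList a z) (i : Fin N) : ‖z i‖ ≠ 1 := by
  intro h1
  obtain ⟨j, hj⟩ := h.exists_conj i
  have h2 : z i * z j = 1 := by
    rw [hj, Complex.mul_conj, Complex.normSq_eq_norm_sq, h1]; simp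
  by_cases hij : i = j
  · subst hij; exact hg.sq_ne_one i (by rw [sq]; exact h2)
  · exact hg.mul_ne_one i j hij h2

/-- Near a generic polynomial the roots keep their position with respect to the unit circle, the
real axis and each other. -/
theorem IsGeneric.eventually_exists {a : Fin N → ℝ} {z : Fin N → ℂ} (hg : IsGeneric z)
    (h : IsRootList a z) : ∀ᶠ b in 𝓝 a, ∃ w, IsRootList b w ∧ (∀ i j, i ≠ j → w i ≠ w j) ∧
      (∀ i, ‖w i‖ < 1 ↔ ‖z i‖ < 1) ∧ (∀ i, (w i).im = 0 ↔ (z i).im = 0) ∧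
      ∀ i j, ‖z i‖ < ‖z j‖ → ‖w i‖ < ‖w j‖ := by
  have small : ∀ {c : ℝ}, 0 < c → ∀ᶠ ε : ℝ in 𝓝[>] 0, 2 * ε < c := fun {c} hc => by
    filter_upwards [Ioo_mem_nhdsGT (half_pos hc)] with ε hε
    linarith [hε.2]
  have hex : ∀ᶠ ε : ℝ in 𝓝[>] 0, 0 < ε ∧ (∀ i j, i ≠ j → 2 * ε < ‖z i - z j‖) ∧
      (∀ i, 2 * ε < |‖z i‖ - 1|) ∧ (∀ i, (z i).im ≠ 0 → 2 * ε < |(z i).im|) ∧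
      ∀ i j, ‖z i‖ < ‖z j‖ → 2 * ε < ‖z j‖ - ‖z i‖ := by
    refine Filter.Eventually.and self_mem_nhdsWithin (.and ?_ (.and ?_ (.and ?_ ?_)))
    · refine eventually_all.2 fun i => eventually_all.2 fun j => ?_
      by_cases hij : i = j
      · simp [hij]
      · filter_upwards [small (norm_pos_iff.2 (sub_ne_zero.2 (hg.injective i j hij)))] with ε hε _
        exact hε
    · refine eventually_all.2 fun i => small ?_
      exact abs_pos.2 (sub_ne_zero.2 (hg.norm_ne_one h i))
    · refine eventually_all.2 fun i => ?_
      by_cases hi : (z i).im = 0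
      · simp [hi]
      · filter_upwards [small (abs_pos.2 hi)] with ε hε _
        exact hε
    · refine eventually_all.2 fun i => eventually_all.2 fun j => ?_
      by_cases hij : ‖z i‖ < ‖z j‖
      · filter_upwards [small (sub_pos.2 hij)] with ε hε _
        exact hε
      · simp [hij]
  obtain ⟨ε, hε, h1, h2, h3, h4⟩ := hex.exists
  filter_upwards [eventually_exists_isRootList_close h hε fun i j hij => (h1 i j hij).le]
    with b ⟨w, hw, hwz⟩
  have hn : ∀ i, |‖w i‖ - ‖z i‖| < ε := fun i => (abs_norm_sub_norm_le _ _).trans_lt (hwz i)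
  refine ⟨w, hw, fun i j hij hne => ?_, fun i => ?_, fun i => ⟨fun hi => ?_, fun hi => ?_⟩,
    fun i j hij => ?_⟩
  · have a1 := hwz i
    rw [hne, norm_sub_rev] at a1
    have := norm_sub_le_norm_sub_add_norm_sub (z i) (w j) (z j)
    linarith [hwz j, h1 i j hij]
  · have a1 := abs_lt.1 (hn i)
    have a2 := h2 i
    rcases lt_or_ge ‖z i‖ 1 with hz | hz
    · rw [abs_of_neg (by linarith)] at a2
      exact ⟨fun _ => hz, fun _ => by linarith [a1.2]⟩
    · rw [abs_of_nonneg (by linarith)] at a2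
      exact ⟨fun _ => by linarith [a1.1], fun _ => by linarith [a1.1]⟩
  · by_contra hzi
    have a1 := (Complex.abs_im_le_norm (w i - z i)).trans_lt (hwz i)
    rw [Complex.sub_im, hi, zero_sub, abs_neg] at a1
    linarith [h3 i hzi]
  -- If `z i` is real, the conjugate of `w i` is also close to `z i`; only one root is, so `w i` is
  -- its own conjugate.
  · obtain ⟨j, hj⟩ := hw.exists_conj i
    have hzc : (starRingEnd ℂ) (z i) = z i := Complex.conj_eq_iff_im.2 hi
    have a1 : ‖w j - z i‖ < ε := by
      rw [hj, ← hzc, ← map_sub, Complex.norm_conj]; exact hwz i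
    have hji : j = i := by
      by_contra hne
      have := norm_sub_le_norm_sub_add_norm_sub (z j) (w j) (z i)
      have a2 := hwz j
      rw [norm_sub_rev] at a2
      linarith [h1 j i hne]
    rw [hji] at hj
    exact Complex.conj_eq_iff_im.1 hj.symm
  · have a1 := abs_lt.1 (hn i)
    have a2 := abs_lt.1 (hn j)
    linarith [h4 i j hij, a1.2, a2.1]

/-- Some element of `Z` strictly dominates all the others in absolute value. -/
def HasDominant (Z : Set ℂ) : Prop := ∃ z ∈ Z, ∀ w ∈ Z, w ≠ z → ‖w‖ < ‖z‖

/-- All elements of `Z` are real. -/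
def AllReal (Z : Set ℂ) : Prop := ∀ z ∈ Z, z.im = 0

/-- No element of `Z` is real. -/
def NoneReal (Z : Set ℂ) : Prop := ∀ z ∈ Z, z.im ≠ 0

/-- A property of sets of complex numbers which, for roots of real polynomials, is locally constant
at generic polynomials. -/
def IsLocallyConstantType (N : ℕ) (T : Set ℂ → Prop) : Prop :=
  ∀ (a : Fin N → ℝ) (z : Fin N → ℂ), IsRootList a z → IsGeneric z →
    ∀ᶠ b in 𝓝 a, (T (croots b) ↔ T (croots a))

lemma isLocallyConstantType_true : IsLocallyConstantType N fun _ => True :=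
  fun _ _ _ _ => by simp

lemma isLocallyConstantType_allReal : IsLocallyConstantType N AllReal := by
  intro a z h hg
  filter_upwards [hg.eventually_exists h] with b ⟨w, hw, _, _, hr, _⟩
  simp [AllReal, hw.croots_eq, h.croots_eq, hr]

lemma isLocallyConstantType_noneReal : IsLocallyConstantType N NoneReal := by
  intro a z h hg
  filter_upwards [hg.eventually_exists h] with b ⟨w, hw, _, _, hr, _⟩
  simp [NoneReal, hw.croots_eq, h.croots_eq, hr]

lemma isLocallyConstantType_norm_lt_one :
    IsLocallyConstantType N fun Z => ∀ z ∈ Z, ‖z‖ < 1 := by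
  intro a z h hg
  filter_upwards [hg.eventually_exists h] with b ⟨w, hw, _, hr, _, _⟩
  simp [hw.croots_eq, h.croots_eq, hr]

/-- Equal moduli mean `z i ^ 2 = z j * conj (z j)`. For real `z j` this is `z j = ± z i`; otherwise
it is a relation between three distinct roots, excluded by `sq_ne_mul`. -/
lemma IsGeneric.norm_ne_norm {a : Fin N → ℝ} {z : Fin N → ℂ} (hg : IsGeneric z)
    (h : IsRootList a z) {i j : Fin N} (hij : i ≠ j) (hi : (z i).im = 0) : ‖z j‖ ≠ ‖z i‖ := by
  intro hn
  have hzi : z i ^ 2 = ((‖z i‖ ^ 2 : ℝ) : ℂ) := by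
    rw [← Complex.normSq_eq_norm_sq, ← Complex.mul_conj, Complex.conj_eq_iff_im.2 hi, sq]
  obtain ⟨k, hk⟩ := h.exists_conj j
  have hzj : z j * z k = ((‖z i‖ ^ 2 : ℝ) : ℂ) := by
    rw [hk, Complex.mul_conj, Complex.normSq_eq_norm_sq, hn]
  by_cases hjk : j = k
  · subst hjk
    have : (z i - z j) * (z i + z j) = 0 := by linear_combination hzi - hzj
    rcases mul_eq_zero.1 this with h0 | h0
    · exact hg.injective i j hij (sub_eq_zero.1 h0)
    · exact hg.add_ne_zero i j hij h0
  · refine hg.sq_ne_mul j k i hjk hij.symm ?_ (hzi.trans hzj.symm)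
    rintro rfl
    have : z j = z k := by
      rw [← Complex.conj_conj (z j), ← hk, Complex.conj_eq_iff_im.2 hi]
    exact hg.injective j k hjk this

/-- A dominant root is real, since its conjugate has the same modulus. By genericity no other root
shares the modulus of a real one, so all comparisons involved are strict and survive perturbation.
-/
lemma isLocallyConstantType_hasDominant : IsLocallyConstantType N HasDominant := by
  intro a z h hg
  filter_upwards [hg.eventually_exists h] with b ⟨w, hw, hwinj, _, hr, hlt⟩
  simp only [HasDominant, hw.croots_eq, h.croots_eq, Set.exists_range_iff, Set.forall_mem_range]
  constructor
  · rintro ⟨i, hi⟩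
    have hwi : (w i).im = 0 := by
      obtain ⟨j, hj⟩ := hw.exists_conj i
      by_contra hne
      have hji : w j ≠ w i := fun he => hne (Complex.conj_eq_iff_im.1 (hj.symm.trans he))
      have := hi j hji
      rw [hj, Complex.norm_conj] at this
      exact lt_irrefl _ this
    refine ⟨i, fun j hj => ?_⟩
    have hij : i ≠ j := fun he => hj (by rw [he])
    have hne := hg.norm_ne_norm h hij ((hr i).1 hwi)
    refine lt_of_le_of_ne (not_lt.1 fun hc => ?_) hne
    exact lt_asymm (hlt i j hc) (hi j (hwinj j i hij.symm))
  · rintro ⟨i, hi⟩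
    refine ⟨i, fun j hj => hlt j i (hi j ?_)⟩
    refine hg.injective j i ?_
    rintro rfl; exact hj rfl

end MonicPoly

end PerronCount

namespace PerronCount

open Polynomial MeasureTheory
open scoped Topology

/-! ### From volumes to counts of irreducible integral polynomials -/

section Counting

variable {N : ℕ}

/-- The `N`-th triangular number. -/
def tri (N : ℕ) : ℕ := N * (N + 1) / 2

lemma tri_succ (N : ℕ) : tri (N + 1) = tri N + (N + 1) := by
  rw [tri, tri, show (N + 1) * (N + 1 + 1) = N * (N + 1) + 2 * (N + 1) by ring]
  omega

/-- The cross term `k * l` is the number of powers of `X` lost by products of factors of degrees `k`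
and `l`. -/
lemma tri_add (k l : ℕ) : tri (k + l) = tri k + tri l + k * l := by
  induction l with
  | zero => simp [tri]
  | succ l ih => rw [← add_assoc, tri_succ, tri_succ, ih]; ring

lemma tri_pos (hN : 1 ≤ N) : 1 ≤ tri N := by
  obtain ⟨M, rfl⟩ := Nat.exists_eq_add_of_le' hN
  rw [tri_succ]; omega

lemma sum_sub_eq_tri (N : ℕ) : ∑ i : Fin N, (N - (i : ℕ)) = tri N := by
  induction N with
  | zero => simp [tri]
  | succ N ih => rw [Fin.sum_univ_succ, tri_succ, ← ih, add_comm]; simp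

/-- The weights by which the coefficients of a monic polynomial of degree `N` scale when its roots
are divided by `X`. -/
noncomputable def scaling (N : ℕ) (X : ℝ) (i : Fin N) : ℝ := (X ^ (N - (i : ℕ)))⁻¹

lemma scaling_pos {X : ℝ} (hX : 1 ≤ X) (i : Fin N) : 0 < scaling N X i := by
  unfold scaling; positivity

lemma scaling_le {X : ℝ} (hX : 1 ≤ X) (i : Fin N) : scaling N X i ≤ X⁻¹ := by
  unfold scaling
  have := i.2
  exact inv_anti₀ (by linarith) (le_self_pow₀ hX (by omega))

lemma prod_scaling (N : ℕ) (X : ℝ) : ∏ i, scaling N X i = (X ^ tri N)⁻¹ := by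
  simp only [scaling, Finset.prod_inv_distrib, Finset.prod_pow_eq_pow_sum, sum_sub_eq_tri]

lemma mem_croots_scaling {X : ℝ} (hX : 1 ≤ X) {a : Fin N → ℝ} {z : ℂ} :
    z ∈ croots (fun i => scaling N X i * a i) ↔ (X : ℂ) * z ∈ croots a := by
  have hX0 : (X : ℂ) ≠ 0 := by exact_mod_cast (by linarith : X ≠ 0)
  have : ((X : ℂ) * z) ^ N + ∑ i, (a i : ℂ) * (X * z) ^ (i : ℕ) =
      (X : ℂ) ^ N * (z ^ N + ∑ i, ((scaling N X i * a i : ℝ) : ℂ) * z ^ (i : ℕ)) := by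
    rw [mul_add, Finset.mul_sum, mul_pow]
    congr 1
    refine Finset.sum_congr rfl fun i _ => ?_
    have : (X : ℂ) ^ N = X ^ (N - (i : ℕ)) * X ^ (i : ℕ) := by
      rw [← pow_add]; congr 1; have := i.2; omega
    rw [this, scaling]
    push_cast
    rw [mul_pow]
    field_simp
  rw [croots, croots, Set.mem_ofPred_eq, Set.mem_ofPred_eq, this, mul_eq_zero]
  simp [hX0]

lemma norm_coeff_le_of_roots_le {a : Fin N → ℝ} (ha : ∀ z ∈ croots a, ‖z‖ ≤ 1) (i : Fin N) :
    |a i| ≤ 2 ^ N := by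
  have h := coeff_le_of_roots_le (p := monicPoly fun i => (a i : ℂ)) (f := RingHom.id ℂ) (B := 1)
    (i : ℕ) (monic_monicPoly _) (IsAlgClosed.splits _) (by
      intro z hz
      rw [Polynomial.map_id, mem_roots (monic_monicPoly _).ne_zero] at hz
      exact ha z (mem_croots.2 hz))
  rw [Polynomial.map_id, coeff_monicPoly, one_pow, one_mul, natDegree_monicPoly, Complex.norm_real] at h
  exact h.trans (by exact_mod_cast Nat.choose_le_two_pow N i)

lemma mem_box_of_roots_le {a : Fin N → ℝ} (ha : ∀ z ∈ croots a, ‖z‖ ≤ 1) :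
    a ∈ Set.Icc (fun _ => -(2 : ℝ) ^ N) (fun _ => (2 : ℝ) ^ N) :=
  ⟨fun i => (abs_le.1 (norm_coeff_le_of_roots_le ha i)).1,
    fun i => (abs_le.1 (norm_coeff_le_of_roots_le ha i)).2⟩

/-- The integral coefficient vectors of the monic polynomials all of whose roots have absolute
value at most `X`. -/
def intBounded (N : ℕ) (X : ℝ) : Set (Fin N → ℤ) :=
  {a | ∀ z ∈ croots (fun i => (a i : ℝ)), ‖z‖ ≤ X}

lemma norm_le_one_of_mem_croots_scaling {X : ℝ} (hX : 1 ≤ X) {a : Fin N → ℝ}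
    (ha : ∀ z ∈ croots a, ‖z‖ ≤ X) :
    ∀ z ∈ croots (fun i => scaling N X i * a i), ‖z‖ ≤ 1 := by
  intro z hz
  have := ha _ ((mem_croots_scaling hX).1 hz)
  rw [norm_mul, Complex.norm_real, Real.norm_of_nonneg (by linarith)] at this
  exact le_of_mul_le_mul_left (by linarith) (by linarith : 0 < X)

lemma intBounded_subset {X : ℝ} (hX : 1 ≤ X) : intBounded N X ⊆
    {a | (fun i => scaling N X i * (a i : ℝ)) ∈
      Set.Icc (fun _ => -(2 : ℝ) ^ N) (fun _ => (2 : ℝ) ^ N)} :=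
  fun _ ha => mem_box_of_roots_le (norm_le_one_of_mem_croots_scaling hX ha)

lemma finite_lattice_box {X : ℝ} (hX : 1 ≤ X) : {a : Fin N → ℤ |
    (fun i => scaling N X i * (a i : ℝ)) ∈
      Set.Icc (fun _ => -(2 : ℝ) ^ N) (fun _ => (2 : ℝ) ^ N)}.Finite :=
  (Finset.finite_toSet _).subset
    (setOf_lattice_subset (fun i => scaling_pos hX i) subset_rfl)

lemma finite_intBounded {X : ℝ} (hX : 1 ≤ X) : (intBounded N X).Finite :=
  (finite_lattice_box hX).subset (intBounded_subset hX)

lemma ncard_intBounded_le {X : ℝ} (hX : 1 ≤ X) :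
    ((intBounded N X).ncard : ℝ) ≤ (3 * 2 ^ N) ^ N * X ^ tri N := by
  have h1 : (1 : ℝ) ≤ 2 ^ N := one_le_pow₀ (by norm_num)
  have h := latticeCount_mul_prod_le (B := (2 : ℝ) ^ N) h1 (s := scaling N X)
    (fun i => scaling_pos hX i) (fun i => (scaling_le hX i).trans (inv_le_one_of_one_le₀ hX)) subset_rfl
  rw [prod_scaling, ← div_eq_mul_inv, div_le_iff₀ (by positivity)] at h
  refine le_trans ?_ h
  rw [latticeCount]
  exact_mod_cast Set.ncard_le_ncard (intBounded_subset hX) (finite_lattice_box hX)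

lemma croots_eq_of_int (a : Fin N → ℤ) (z : ℂ) :
    z ∈ croots (fun i => (a i : ℝ)) ↔ ((monicPoly a).map (Int.castRingHom ℂ)).eval z = 0 := by
  rw [mem_croots, map_monicPoly]
  simp

/-- A reducible polynomial is a product of monic integral factors of degrees `k` and `N - k` with `0
< k < N`, whose roots are again bounded by `X`. The number of pairs is of order `X ^ (tri k + tri (N
- k))`, and `tri_add` saves `k * (N - k) ≥ 1` in the exponent. -/
theorem ncard_reducible_le (hN : 1 ≤ N) : ∃ C : ℝ, 0 ≤ C ∧ ∀ X : ℝ, 1 ≤ X →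
    ({a ∈ intBounded N X | ¬ Irreducible (monicPoly a)}.ncard : ℝ) ≤ C * X ^ (tri N - 1) := by
  classical
  refine ⟨∑ k ∈ Finset.Ico 1 N, (3 * 2 ^ k) ^ k * (3 * 2 ^ (N - k)) ^ (N - k), by positivity, ?_⟩
  intro X hX
  set B : (k : ℕ) → Finset (Fin k → ℤ) := fun k => (finite_intBounded (N := k) hX).toFinset with hB
  set U : Finset (Fin N → ℤ) := (Finset.Ico 1 N).biUnion fun k =>
    (B k ×ˢ B (N - k)).image fun p => fun i : Fin N => (monicPoly p.1 * monicPoly p.2).coeff i with hU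
  have hsub : {a ∈ intBounded N X | ¬ Irreducible (monicPoly a)} ⊆ (U : Set (Fin N → ℤ)) := by
    rintro a ⟨ha, hirr⟩
    rw [(monic_monicPoly a).irreducible_iff_natDegree'] at hirr
    -- The irreducibility criterion for monic polynomials excludes `1`, which `hN` rules out.
    have hne1 : monicPoly a ≠ 1 := fun h => by
      have := natDegree_monicPoly a
      rw [h, natDegree_one] at this
      omega
    push Not at hirr
    obtain ⟨f, g, hf, hg, hfg, hmem⟩ := hirr hne1
    rw [natDegree_monicPoly, Finset.mem_Ioc] at hmem
    have hdeg : f.natDegree + g.natDegree = N := by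
      rw [← hf.natDegree_mul hg, hfg, natDegree_monicPoly]
    have hfac : ∀ p : ℤ[X], p.Monic → p ∣ monicPoly a → ∀ k, p.natDegree = k →
        (fun i : Fin k => p.coeff i) ∈ B k := by
      intro p hp hdvd k hk
      rw [hB, Set.Finite.mem_toFinset]
      intro z hz
      refine ha z ?_
      rw [croots_eq_of_int] at hz ⊢
      rw [monicPoly_coeff hp hk] at hz
      exact eval_eq_zero_of_dvd_of_eval_eq_zero (Polynomial.map_dvd _ hdvd) hz
    rw [hU, Finset.mem_coe, Finset.mem_biUnion]
    refine ⟨f.natDegree, Finset.mem_Ico.2 ⟨by omega, by omega⟩, Finset.mem_image.2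
      ⟨(fun i => f.coeff i, fun i => g.coeff i), Finset.mem_product.2
        ⟨hfac f hf ⟨g, hfg.symm⟩ _ rfl,
          hfac g hg ⟨f, by rw [mul_comm]; exact hfg.symm⟩ _ (by omega)⟩, ?_⟩⟩
    ext i
    simp only
    rw [monicPoly_coeff hf rfl, monicPoly_coeff hg (by omega), hfg, coeff_monicPoly]
  have hcard : ((U.card : ℕ) : ℝ) ≤ ∑ k ∈ Finset.Ico 1 N, ((B k).card : ℝ) * (B (N - k)).card := by
    have : U.card ≤ ∑ k ∈ Finset.Ico 1 N, (B k).card * (B (N - k)).card :=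
      Finset.card_biUnion_le.trans (Finset.sum_le_sum fun k _ =>
        Finset.card_image_le.trans (Finset.card_product _ _).le)
    exact_mod_cast this
  have hle := Set.ncard_le_ncard hsub (Finset.finite_toSet _)
  rw [Set.ncard_coe_finset] at hle
  refine (Nat.cast_le.2 hle).trans (hcard.trans ?_)
  rw [Finset.sum_mul]
  refine Finset.sum_le_sum fun k hk => ?_
  rw [Finset.mem_Ico] at hk
  have hBk : ∀ k, ((B k).card : ℝ) ≤ (3 * 2 ^ k) ^ k * X ^ tri k := fun k => by
    rw [hB, ← Set.ncard_eq_toFinset_card _ (finite_intBounded hX)]; exact ncard_intBounded_le hX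
  have htri : tri k + tri (N - k) ≤ tri N - 1 := by
    have := tri_add k (N - k)
    rw [Nat.add_sub_cancel' hk.2.le] at this
    have h2 : 0 < k * (N - k) := Nat.mul_pos (by omega) (by omega)
    omega
  calc ((B k).card : ℝ) * (B (N - k)).card
      ≤ ((3 * 2 ^ k) ^ k * X ^ tri k) * ((3 * 2 ^ (N - k)) ^ (N - k) * X ^ tri (N - k)) := by
        gcongr <;> exact hBk _
    _ = (3 * 2 ^ k) ^ k * (3 * 2 ^ (N - k)) ^ (N - k) * X ^ (tri k + tri (N - k)) := by
        rw [pow_add]; ring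
    _ ≤ _ := by gcongr

/-- Coefficient vectors of the monic real polynomials with all roots in the open unit disc and root
set of type `T`. -/
def unitRegion (N : ℕ) (T : Set ℂ → Prop) : Set (Fin N → ℝ) :=
  {a | (∀ z ∈ croots a, ‖z‖ < 1) ∧ T (croots a)}

/-- The integral coefficient vectors of the irreducible monic polynomials of degree `N` with roots
of absolute value at most `X` and root set of type `T`. -/
def irredVectors (N : ℕ) (T : Set ℂ → Prop) (X : ℝ) : Set (Fin N → ℤ) :=
  {a | Irreducible (monicPoly a) ∧ a ∈ intBounded N X ∧ T (croots fun i => (a i : ℝ))}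

/-- `T` is invariant under multiplication by positive reals. -/
def IsScaleInvariant (T : Set ℂ → Prop) : Prop :=
  ∀ (X : ℝ), 0 < X → ∀ Z : Set ℂ, T {z | (X : ℂ) * z ∈ Z} ↔ T Z

/-- Where `R` does not vanish the roots are generic, so membership in the region is locally constant
there. -/
theorem exists_generic_open_subset {T : Set ℂ → Prop} (hT : IsLocallyConstantType N T)
    {R : MvPolynomial (Fin N) ℝ} (hR : ∀ (a : Fin N → ℝ) (z : Fin N → ℂ), IsRootList a z →
      MvPolynomial.eval a R ≠ 0 → IsGeneric z) :
    IsOpen {a ∈ unitRegion N T | MvPolynomial.eval a R ≠ 0} ∧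
    frontier {a ∈ unitRegion N T | MvPolynomial.eval a R ≠ 0} ⊆
      {a | MvPolynomial.eval a R = 0} := by
  set S := {a ∈ unitRegion N T | MvPolynomial.eval a R ≠ 0} with hS
  have hev : ∀ a, MvPolynomial.eval a R ≠ 0 → ∀ᶠ b in 𝓝 a, (b ∈ S ↔ a ∈ S) := by
    intro a ha
    obtain ⟨z, hz⟩ := exists_isRootList a
    have hg := hR a z hz ha
    filter_upwards [hT a z hz hg, isLocallyConstantType_norm_lt_one a z hz hg,
      (MvPolynomial.continuous_eval R).continuousAt.eventually_ne ha] with b h1 h2 h3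
    simp only [hS, unitRegion, Set.mem_ofPred_eq, h1, h2, ne_eq, h3, ha]
  have hopen : IsOpen S := isOpen_iff_mem_nhds.2 fun a ha => by
    filter_upwards [hev a ha.2] with b hb
    exact hb.2 ha
  refine ⟨hopen, fun a ha => ?_⟩
  by_contra hne
  rw [hopen.frontier_eq] at ha
  obtain ⟨b, hb, hb2⟩ := ((mem_closure_iff_frequently.1 ha.1).and_eventually (hev a hne)).exists
  exact ha.2 (hb2.1 hb)

lemma volume_unitRegion_eq {T : Set ℂ → Prop} {R : MvPolynomial (Fin N) ℝ} (hR : R ≠ 0) :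
    volume {a ∈ unitRegion N T | MvPolynomial.eval a R ≠ 0} = volume (unitRegion N T) := by
  refine measure_congr ?_
  have h0 : ∀ᵐ a : Fin N → ℝ, MvPolynomial.eval a R ≠ 0 := by
    rw [ae_iff]; simpa using volume_zeroLocus_eq_zero hR
  filter_upwards [h0] with a ha
  exact propext (and_iff_left ha)

/-- After scaling, the irreducible vectors and the lattice points of the generic open region `S`
differ only by lattice points on `R = 0` and by reducible polynomials, both of size `O(X ^ (tri N -
1))`. -/
theorem ncard_irredVectors_asymp (hN : 1 ≤ N) {T : Set ℂ → Prop} (hT : IsLocallyConstantType N T)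
    (hTs : IsScaleInvariant T) : ∃ C : ℝ, ∀ X : ℝ, 1 ≤ X →
    |((irredVectors N T X).ncard : ℝ) - volume.real (unitRegion N T) * X ^ tri N| ≤
      C * X ^ (tri N - 1) := by
  obtain ⟨R, hR0, hR⟩ := exists_generic_polynomial N
  obtain ⟨hSo, hSf⟩ := exists_generic_open_subset hT hR
  set S := {a ∈ unitRegion N T | MvPolynomial.eval a R ≠ 0} with hS
  have hB : (1 : ℝ) ≤ 2 ^ N := one_le_pow₀ (by norm_num)
  set h : ℕ := Finset.univ.sup fun i => R.degreeOf i with hh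
  have hdeg : ∀ i, R.degreeOf i ≤ h := fun i => Finset.le_sup (f := fun i => R.degreeOf i) (Finset.mem_univ i)
  obtain ⟨C₁, hC₁, hlat⟩ := exists_abs_latticeCount_sub_volume_le N h hB
  obtain ⟨C₂, hC₂, hred⟩ := ncard_reducible_le hN
  refine ⟨C₁ + (3 * 2 ^ N) ^ N * (N * h) + C₂, fun X hX => ?_⟩
  have hX0 : 0 < X := by linarith
  have hspos := fun i => scaling_pos (N := N) hX i
  have hsle := fun i => scaling_le (N := N) hX i
  have hXi : X⁻¹ ≤ 1 := inv_le_one_of_one_le₀ hX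
  have hbox : S ⊆ Set.Icc (fun _ => -(2 : ℝ) ^ N) (fun _ => (2 : ℝ) ^ N) := fun a ha =>
    mem_box_of_roots_le fun z hz => (ha.1.1 z hz).le
  have e1 := hlat (scaling N X) X⁻¹ hspos hsle (by positivity) hXi S hSo hbox R hR0 hdeg hSf
  have e2 := latticeCount_zeroLocus_le (h := h) hB hspos hsle hXi hR0 hdeg
  have e3 := hred X hX
  set L := {a : Fin N → ℤ | (fun i => scaling N X i * (a i : ℝ)) ∈ S} with hL
  set Z := {a : Fin N → ℤ | (fun i => scaling N X i * (a i : ℝ)) ∈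
    Set.Icc (fun _ => -(2 : ℝ) ^ N) (fun _ => (2 : ℝ) ^ N) ∩ {x | MvPolynomial.eval x R = 0}} with hZ
  set Rd := {a ∈ intBounded N X | ¬ Irreducible (monicPoly a)} with hRd
  have hLfin : L.Finite := (finite_lattice_box hX).subset fun a ha => hbox ha
  have hZfin : Z.Finite := (finite_lattice_box hX).subset fun a ha => ha.1
  have hRfin : Rd.Finite := (finite_intBounded hX).subset fun a ha => ha.1
  have hAfin : (irredVectors N T X).Finite := (finite_intBounded hX).subset fun a ha => ha.2.1
  have hTiff : ∀ a : Fin N → ℤ, T (croots fun i => scaling N X i * (a i : ℝ)) ↔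
      T (croots fun i => (a i : ℝ)) := by
    intro a
    rw [← hTs X hX0 (croots fun i => (a i : ℝ))]
    exact iff_of_eq (congrArg T (Set.ext fun z => mem_croots_scaling hX))
  -- The house may equal `X`, whereas `S` demands scaled roots of modulus below one. A scaled root
  -- of modulus exactly one is not generic, so such vectors fall into `Z`.
  have h1 : irredVectors N T X ⊆ L ∪ Z := by
    rintro a ⟨-, hab, haT⟩
    have hle := norm_le_one_of_mem_croots_scaling hX hab
    by_cases h0 : MvPolynomial.eval (fun i => scaling N X i * (a i : ℝ)) R = 0
    · exact Or.inr ⟨mem_box_of_roots_le hle, h0⟩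
    · obtain ⟨z, hz⟩ := exists_isRootList (fun i => scaling N X i * (a i : ℝ))
      refine Or.inl ⟨⟨fun w hw => lt_of_le_of_ne (hle w hw) ?_, (hTiff a).2 haT⟩, h0⟩
      rw [hz.croots_eq] at hw
      obtain ⟨i, rfl⟩ := hw
      exact (hR _ z hz h0).norm_ne_one hz i
  have h2 : L ⊆ irredVectors N T X ∪ Rd := by
    rintro a ⟨⟨hlt, haT⟩, -⟩
    have hab : a ∈ intBounded N X := by
      intro z hz
      have hX0' : (X : ℂ) ≠ 0 := by exact_mod_cast hX0.ne'
      have := (hlt (z / X) ((mem_croots_scaling hX).2 (by rwa [mul_div_cancel₀ _ hX0']))).le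
      rwa [norm_div, Complex.norm_real, Real.norm_of_nonneg hX0.le, div_le_one hX0] at this
    by_cases hirr : Irreducible (monicPoly a)
    · exact Or.inl ⟨hirr, hab, (hTiff a).1 haT⟩
    · exact Or.inr ⟨hab, hirr⟩
  have n1 : ((irredVectors N T X).ncard : ℝ) ≤ L.ncard + Z.ncard := by
    exact_mod_cast (Set.ncard_le_ncard h1 (hLfin.union hZfin)).trans (Set.ncard_union_le _ _)
  have n2 : (L.ncard : ℝ) ≤ (irredVectors N T X).ncard + Rd.ncard := by
    exact_mod_cast (Set.ncard_le_ncard h2 (hAfin.union hRfin)).trans (Set.ncard_union_le _ _)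
  have hXt : 0 < X ^ tri N := by positivity
  have hXd : X ^ tri N * X⁻¹ = X ^ (tri N - 1) := by
    have := tri_pos hN
    rw [← div_eq_mul_inv, div_eq_iff hX0.ne', ← pow_succ]
    congr 1; omega
  rw [prod_scaling] at e1 e2
  rw [latticeCount] at e1 e2
  have f1 : |(L.ncard : ℝ) - volume.real (unitRegion N T) * X ^ tri N| ≤ C₁ * X ^ (tri N - 1) := by
    have hv : volume.real S = volume.real (unitRegion N T) := by
      rw [Measure.real, Measure.real, volume_unitRegion_eq hR0]
    rw [← hv]
    have : (L.ncard : ℝ) - volume.real S * X ^ tri N =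
        ((L.ncard : ℝ) * (X ^ tri N)⁻¹ - volume.real S) * X ^ tri N := by
      field_simp
    rw [this, abs_mul, abs_of_pos hXt, ← hXd]
    calc _ ≤ C₁ * X⁻¹ * X ^ tri N := by gcongr
      _ = _ := by ring
  have f2 : (Z.ncard : ℝ) ≤ (3 * 2 ^ N) ^ N * (N * h) * X ^ (tri N - 1) := by
    rw [← div_eq_mul_inv, div_le_iff₀ hXt] at e2
    rw [← hXd]
    calc _ ≤ _ := e2
      _ = _ := by ring
  have f1' := abs_le.1 f1
  have f0 : (0 : ℝ) ≤ Z.ncard := Nat.cast_nonneg _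
  have f0' : (0 : ℝ) ≤ Rd.ncard := Nat.cast_nonneg _
  rw [abs_le]
  constructor <;> linarith [f1'.1, f1'.2]

end Counting

end PerronCount

namespace PerronCount

open Polynomial MeasureTheory
open scoped Topology

/-! ### Algebraic integers as roots of irreducible integral polynomials -/

section Algebraic

variable {N : ℕ}

lemma aeval_map_monicPoly_eq_zero_iff {a : Fin N → ℤ} {z : ℂ} :
    aeval z ((monicPoly a).map (Int.castRingHom ℚ)) = 0 ↔ z ∈ croots fun i => (a i : ℝ) := by
  rw [croots_eq_of_int, aeval_def, eval₂_map, ← eval_map,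
    show (algebraMap ℚ ℂ).comp (Int.castRingHom ℚ) = Int.castRingHom ℂ from RingHom.ext_int _ _]

/-- Gauss's lemma: a monic polynomial irreducible over `ℤ` stays irreducible over `ℚ`. -/
lemma minpoly_eq_of_mem_croots {a : Fin N → ℤ} (ha : Irreducible (monicPoly a)) {z : ℂ}
    (hz : z ∈ croots fun i => (a i : ℝ)) :
    minpoly ℚ z = (monicPoly a).map (Int.castRingHom ℚ) := by
  have hm := monic_monicPoly a
  have hirr : Irreducible ((monicPoly a).map (algebraMap ℤ ℚ)) :=
    (hm.irreducible_iff_irreducible_map_fraction_map (K := ℚ)).1 ha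
  refine (minpoly.eq_of_irreducible_of_monic hirr ?_ (hm.map _)).symm
  exact aeval_map_monicPoly_eq_zero_iff.2 hz

lemma isConjRoot_iff_mem_croots {a : Fin N → ℤ} (ha : Irreducible (monicPoly a)) {z w : ℂ}
    (hz : z ∈ croots fun i => (a i : ℝ)) :
    IsConjRoot ℚ z w ↔ w ∈ croots fun i => (a i : ℝ) := by
  constructor
  · intro h
    have h1 : minpoly ℚ z = minpoly ℚ w := h
    rw [← aeval_map_monicPoly_eq_zero_iff, ← minpoly_eq_of_mem_croots ha hz, h1]
    exact minpoly.aeval ℚ w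
  · intro hw
    change minpoly ℚ z = minpoly ℚ w
    rw [minpoly_eq_of_mem_croots ha hz, minpoly_eq_of_mem_croots ha hw]

lemma setOf_isConjRoot_eq {a : Fin N → ℤ} (ha : Irreducible (monicPoly a)) {z : ℂ}
    (hz : z ∈ croots fun i => (a i : ℝ)) :
    {w | IsConjRoot ℚ z w} = croots fun i => (a i : ℝ) :=
  Set.ext fun _ => isConjRoot_iff_mem_croots ha hz

lemma mem_algInt_iff {z : ℂ} : z ∈ algInt N ↔
    ∃ a : Fin N → ℤ, Irreducible (monicPoly a) ∧ z ∈ croots fun i => (a i : ℝ) := by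
  constructor
  · rintro ⟨hint, hdeg⟩
    have hmap := minpoly.isIntegrallyClosed_eq_field_fractions' ℚ hint
    have hm := minpoly.monic hint
    have hd : (minpoly ℤ z).natDegree = N := by
      rw [← hdeg, hmap, hm.natDegree_map]
    refine ⟨fun i => (minpoly ℤ z).coeff i, ?_, ?_⟩
    · rw [monicPoly_coeff hm hd]; exact minpoly.irreducible hint
    · rw [croots_eq_of_int, monicPoly_coeff hm hd]
      have := minpoly.aeval ℤ z
      rw [aeval_def, ← eval_map] at this
      exact this
  · rintro ⟨a, ha, hz⟩
    refine ⟨⟨monicPoly a, monic_monicPoly a, ?_⟩, ?_⟩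
    · rw [croots_eq_of_int] at hz
      rw [← eval_map]; exact hz
    · rw [minpoly_eq_of_mem_croots ha hz, (monic_monicPoly a).natDegree_map, natDegree_monicPoly]

lemma finite_croots (a : Fin N → ℝ) : (croots a).Finite := by
  obtain ⟨z, hz⟩ := exists_isRootList a
  rw [hz.croots_eq]; exact Set.finite_range z

lemma house_le_iff {a : Fin N → ℤ} (ha : Irreducible (monicPoly a)) {z : ℂ}
    (hz : z ∈ croots fun i => (a i : ℝ)) {X : ℝ} : house z ≤ X ↔ a ∈ intBounded N X := by
  rw [house, setOf_isConjRoot_eq ha hz, csSup_le_iff ((finite_croots _).image _).bddAbove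
    ⟨_, z, hz, rfl⟩]
  simp [intBounded]

/-- Algebraic integers of degree `N` whose set of conjugates is of type `T`. -/
def algIntOfType (N : ℕ) (T : Set ℂ → Prop) : Set ℂ :=
  {α ∈ algInt N | T {β | IsConjRoot ℚ α β}}

lemma mem_houseLE_algIntOfType {T : Set ℂ → Prop} {X : ℝ} {z : ℂ} :
    z ∈ houseLE (algIntOfType N T) X ↔
      ∃ a ∈ irredVectors N T X, z ∈ croots fun i => (a i : ℝ) := by
  constructor
  · rintro ⟨⟨hz, hT⟩, hX⟩
    obtain ⟨a, ha, hza⟩ := mem_algInt_iff.1 hz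
    refine ⟨a, ⟨ha, (house_le_iff ha hza).1 hX, ?_⟩, hza⟩
    rwa [← setOf_isConjRoot_eq ha hza]
  · rintro ⟨a, ⟨ha, hX, hT⟩, hza⟩
    refine ⟨⟨mem_algInt_iff.2 ⟨a, ha, hza⟩, ?_⟩, (house_le_iff ha hza).2 hX⟩
    rwa [setOf_isConjRoot_eq ha hza]

lemma eq_of_mem_croots_of_isConjRoot {a b : Fin N → ℤ} (ha : Irreducible (monicPoly a))
    (hb : Irreducible (monicPoly b)) {z w : ℂ} (hz : z ∈ croots fun i => (a i : ℝ))
    (hw : w ∈ croots fun i => (b i : ℝ)) (h : IsConjRoot ℚ z w) : a = b := by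
  have h1 : minpoly ℚ z = minpoly ℚ w := h
  rw [minpoly_eq_of_mem_croots ha hz, minpoly_eq_of_mem_croots hb hw] at h1
  exact monicPoly_injective (Polynomial.map_injective _ (Int.cast_injective) h1)

lemma croots_nonempty (hN : 1 ≤ N) (a : Fin N → ℝ) : (croots a).Nonempty := by
  obtain ⟨z, hz⟩ := exists_isRootList a
  exact ⟨_, hz.mem ⟨0, hN⟩⟩

/-- Send a polynomial to the class of one chosen root. Injectivity holds because conjugate roots
have the same minimal polynomial. -/
theorem ncard_conjClasses (hN : 1 ≤ N) (T : Set ℂ → Prop) (X : ℝ) :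
    (conjClasses (houseLE (algIntOfType N T) X)).ncard = (irredVectors N T X).ncard := by
  choose r hr using fun a : Fin N → ℤ => croots_nonempty hN fun i => (a i : ℝ)
  have himg : conjClasses (houseLE (algIntOfType N T) X) =
      (fun a => Quotient.mk (IsConjRoot.setoid ℚ ℂ) (r a)) '' irredVectors N T X := by
    ext q
    constructor
    · rintro ⟨z, hz, rfl⟩
      obtain ⟨a, ha, hza⟩ := mem_houseLE_algIntOfType.1 hz
      exact ⟨a, ha, Quotient.sound ((isConjRoot_iff_mem_croots ha.1 (hr a)).2 hza)⟩
    · rintro ⟨a, ha, rfl⟩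
      exact ⟨r a, mem_houseLE_algIntOfType.2 ⟨a, ha, hr a⟩, rfl⟩
  rw [himg, Set.InjOn.ncard_image]
  intro a ha b hb hab
  exact eq_of_mem_croots_of_isConjRoot ha.1 hb.1 (hr a) (hr b) (Quotient.exact hab)

/-- Irreducible polynomials over `ℚ` are separable. This gives the factor `N` between counting
classes and counting elements. -/
lemma ncard_croots {a : Fin N → ℤ} (ha : Irreducible (monicPoly a)) :
    (croots fun i => (a i : ℝ)).ncard = N := by
  have hm := monic_monicPoly a
  set p : ℚ[X] := (monicPoly a).map (algebraMap ℤ ℚ) with hp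
  have hirr : Irreducible p := (hm.irreducible_iff_irreducible_map_fraction_map (K := ℚ)).1 ha
  have hcard := card_rootSet_eq_natDegree (K := ℂ) hirr.separable (IsAlgClosed.splits _)
  rw [hp, hm.natDegree_map, natDegree_monicPoly, ← hp] at hcard
  have : (croots fun i => (a i : ℝ)) = p.rootSet ℂ := by
    ext z
    rw [mem_rootSet, ← aeval_map_monicPoly_eq_zero_iff]
    exact (and_iff_right hirr.ne_zero).symm
  rw [this, ← hcard, Set.ncard_eq_toFinset_card', Set.toFinset_card]

theorem ncard_houseLE (T : Set ℂ → Prop) {X : ℝ} (hX : 1 ≤ X) :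
    (houseLE (algIntOfType N T) X).ncard = N * (irredVectors N T X).ncard := by
  classical
  have hfin : (irredVectors N T X).Finite := (finite_intBounded hX).subset fun a ha => ha.2.1
  have : houseLE (algIntOfType N T) X =
      (hfin.toFinset.biUnion fun a => (finite_croots fun i => (a i : ℝ)).toFinset : Finset ℂ) := by
    ext z
    rw [mem_houseLE_algIntOfType]
    simp
  rw [this, Set.ncard_coe_finset, Finset.card_biUnion]
  · rw [Finset.sum_congr rfl (g := fun _ => N), Finset.sum_const, smul_eq_mul, mul_comm,
      ← Set.ncard_eq_toFinset_card _ hfin]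
    intro a ha
    rw [← Set.ncard_eq_toFinset_card _ (finite_croots _)]
    exact ncard_croots (hfin.mem_toFinset.1 ha).1
  · intro a ha b hb hab
    refine Finset.disjoint_left.2 fun z hza hzb => hab ?_
    exact eq_of_mem_croots_of_isConjRoot (hfin.mem_toFinset.1 ha).1 (hfin.mem_toFinset.1 hb).1
      ((finite_croots _).mem_toFinset.1 hza) ((finite_croots _).mem_toFinset.1 hzb)
      (IsConjRoot.refl (R := ℚ) (x := z))

lemma hasAsymp_of_abs_sub_le {f : ℝ → ℝ} {c C : ℝ} {e : ℕ} (hc : 0 < c) (he : 1 ≤ e)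
    (h : ∀ X : ℝ, 1 ≤ X → |f X - c * X ^ e| ≤ C * X ^ (e - 1)) : HasAsymp f c e := by
  -- The relative error is forced by the main term; its definition uses `c ≠ 0`, which is why
  -- positivity of every constant is proved.
  refine ⟨fun X => f X / (X ^ e * c) - 1, ?_, ?_⟩
  · refine IsBigO.of_bound (C / c) ?_
    filter_upwards [eventually_ge_atTop 1] with X hX
    have hX0 : 0 < X := by linarith
    have h1 : f X / (X ^ e * c) - 1 = (f X - c * X ^ e) / (X ^ e * c) := by field_simp
    rw [h1, norm_div, Real.norm_eq_abs, Real.norm_of_nonneg (by positivity : 0 ≤ X ^ e * c),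
      Real.norm_of_nonneg (by positivity), div_le_iff₀ (by positivity)]
    refine (h X hX).trans (le_of_eq ?_)
    have : X ^ e = X ^ (e - 1) * X := by rw [← pow_succ]; congr 1; omega
    rw [this]
    field_simp
  · filter_upwards [eventually_ge_atTop 1] with X hX
    have hX0 : 0 < X := by linarith
    field_simp
    ring

theorem countAsymp_of_type (hN : 1 ≤ N) {T : Set ℂ → Prop} (hT : IsLocallyConstantType N T)
    (hTs : IsScaleInvariant T) {c : ℝ} (hc : 0 < c) (hv : volume.real (unitRegion N T) = c) :
    CountAsymp N (algIntOfType N T) c := by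
  obtain ⟨C, hC⟩ := ncard_irredVectors_asymp hN hT hTs
  have hNr : (0 : ℝ) < N := by exact_mod_cast hN
  constructor
  · refine hasAsymp_of_abs_sub_le (C := C) hc (tri_pos hN) fun X hX => ?_
    rw [ncard_conjClasses hN, ← hv]
    exact hC X hX
  · refine hasAsymp_of_abs_sub_le (C := N * C) (by positivity) (tri_pos hN) fun X hX => ?_
    rw [ncard_houseLE T hX, ← hv]
    push_cast
    rw [mul_assoc, ← mul_sub, abs_mul, abs_of_pos hNr, mul_assoc]
    exact mul_le_mul_of_nonneg_left (hC X hX) hNr.le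

lemma isScaleInvariant_true : IsScaleInvariant fun _ => True := fun _ _ _ => Iff.rfl

lemma isScaleInvariant_of_forall {p : ℂ → Prop} (hp : ∀ X : ℝ, 0 < X → ∀ z : ℂ, p (X * z) ↔ p z) :
    IsScaleInvariant fun Z => ∀ z ∈ Z, p z := by
  intro X hX Z
  have hX0 : (X : ℂ) ≠ 0 := by exact_mod_cast hX.ne'
  constructor
  · intro h z hz
    have := h (z / X) (by simpa [mul_div_cancel₀ _ hX0] using hz)
    rwa [← hp X hX, mul_div_cancel₀ _ hX0] at this
  · intro h z hz
    exact (hp X hX z).1 (h _ hz)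

lemma isScaleInvariant_allReal : IsScaleInvariant AllReal :=
  isScaleInvariant_of_forall fun X hX z => by simp [hX.ne']

lemma isScaleInvariant_noneReal : IsScaleInvariant NoneReal :=
  isScaleInvariant_of_forall fun X hX z => by simp [hX.ne']

lemma isScaleInvariant_hasDominant : IsScaleInvariant HasDominant := by
  intro X hX Z
  have hX0 : (X : ℂ) ≠ 0 := by exact_mod_cast hX.ne'
  have hn : ∀ z : ℂ, ‖(X : ℂ) * z‖ = X * ‖z‖ := fun z => by
    rw [norm_mul, Complex.norm_real, Real.norm_of_nonneg hX.le]
  constructor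
  · rintro ⟨z, hz, h⟩
    refine ⟨X * z, hz, fun w hw hne => ?_⟩
    have hwX : (X : ℂ) * (w / X) = w := mul_div_cancel₀ _ hX0
    have := h (w / X) (by simpa [hwX] using hw) fun he => hne (by rw [← he, hwX])
    rw [← hwX, hn, hn]
    exact mul_lt_mul_of_pos_left this hX
  · rintro ⟨z, hz, h⟩
    have hzX : (X : ℂ) * (z / X) = z := mul_div_cancel₀ _ hX0
    refine ⟨z / X, by simpa [hzX] using hz, fun w hw hne => ?_⟩
    have := h (X * w) hw fun he => hne (by rw [← he, mul_div_cancel_left₀ _ hX0])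
    rw [← hzX, hn, hn] at this
    exact lt_of_mul_lt_mul_left this hX.le

lemma algInt_eq (N : ℕ) : algInt N = algIntOfType N fun _ => True := by
  ext z; simp [algIntOfType]

lemma algIntReal_eq (N : ℕ) : algIntReal N = algIntOfType N AllReal := rfl

lemma algIntComplex_eq (N : ℕ) : algIntComplex N = algIntOfType N NoneReal := rfl

lemma algIntPerron_eq (N : ℕ) : algIntPerron N = algIntOfType N HasDominant := by
  ext z
  refine and_congr_right fun hz => ⟨?_, ?_⟩
  · rintro ⟨β, hβ, -, h⟩
    exact ⟨β, hβ, fun w hw hne => h w (hβ.symm.trans hw) hne⟩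
  · rintro ⟨β, hβ, h⟩
    obtain ⟨a, ha, hza⟩ := mem_algInt_iff.1 hz
    exact ⟨β, hβ, (mem_algInt_iff.2 ⟨a, ha, (isConjRoot_iff_mem_croots ha hza).1 hβ⟩).1, fun w hw hne => h w (hβ.trans hw) hne⟩

end Algebraic

end PerronCount

namespace PerronCount

open MeasureTheory
open scoped Topology ENNReal

/-! ### Fubini and linear change of variables -/

section LinearChange

variable {n : ℕ}

lemma lintegral_cons {g : (Fin (n + 1) → ℝ) → ℝ≥0∞} (hg : Measurable g) :
    ∫⁻ a, g a = ∫⁻ t : ℝ, ∫⁻ y : Fin n → ℝ, g (Fin.cons t y) := by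
  rw [← (measurePreserving_cons n).lintegral_comp hg, Measure.volume_eq_prod]
  exact lintegral_prod _ (hg.comp (measurePreserving_cons n).measurable).aemeasurable

lemma lintegral_eq_det_mul_lintegral_comp {A : (Fin n → ℝ) →ₗ[ℝ] (Fin n → ℝ)}
    (hA : LinearMap.det A ≠ 0) {G : (Fin n → ℝ) → ℝ≥0∞} (hG : Measurable G) :
    ∫⁻ y, G y = ENNReal.ofReal |LinearMap.det A| * ∫⁻ b, G (A b) := by
  have hAm : Measurable A := (LinearMap.continuous_of_finiteDimensional A).measurable
  rw [← lintegral_map hG hAm, Measure.map_linearMap_addHaar_eq_smul_addHaar volume hA,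
    lintegral_smul_measure, smul_eq_mul, ← mul_assoc, ← ENNReal.ofReal_mul (abs_nonneg _), abs_inv,
    mul_inv_cancel₀ (abs_ne_zero.2 hA), ENNReal.ofReal_one, one_mul]

end LinearChange

/-! ### The volume of the stable polynomials by the Schur recursion -/

section Schur

variable {N : ℕ}

/-- The coefficient vectors of the monic real polynomials with all roots in the open unit disc. -/
def stable (N : ℕ) : Set (Fin N → ℝ) := {a | ∀ z ∈ croots a, ‖z‖ < 1}

/-- The value at `z` of the reversed polynomial of `monicPoly a`. -/
noncomputable def revEval (a : Fin N → ℝ) (z : ℂ) : ℂ := 1 + ∑ i, (a i : ℂ) * z ^ (N - (i : ℕ))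

/-- The value at `z` of `monicPoly a`. -/
noncomputable def polyEval (a : Fin N → ℝ) (z : ℂ) : ℂ := z ^ N + ∑ i, (a i : ℂ) * z ^ (i : ℕ)

/-- One step of the Schur recursion: `z P + k P*`, for `P = monicPoly b`. -/
noncomputable def schurStep (k : ℝ) (b : Fin N → ℝ) : Fin (N + 1) → ℝ :=
  Fin.cons k fun i => b i + k * b i.rev

lemma revEval_eq_sum_rev (b : Fin N → ℝ) (z : ℂ) :
    revEval b z = 1 + ∑ i : Fin N, (b i.rev : ℂ) * z ^ ((i : ℕ) + 1) := by
  rw [revEval, ← Equiv.sum_comp Fin.revPerm]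
  congr 1
  refine Finset.sum_congr rfl fun i _ => ?_
  simp only [Fin.revPerm_apply, Fin.val_rev]
  congr 2
  have := i.2; omega

lemma polyEval_schurStep (k : ℝ) (b : Fin N → ℝ) (z : ℂ) :
    polyEval (schurStep k b) z = z * polyEval b z + k * revEval b z := by
  rw [revEval_eq_sum_rev, polyEval, polyEval, Fin.sum_univ_succ]
  simp only [schurStep, Fin.cons_zero, Fin.cons_succ, Fin.val_zero, pow_zero, mul_one, Fin.val_succ,
    mul_add, Finset.mul_sum, Complex.ofReal_add, Complex.ofReal_mul, add_mul, Finset.sum_add_distrib]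
  have h1 : ∑ i : Fin N, (b i : ℂ) * z ^ ((i : ℕ) + 1) = ∑ i : Fin N, z * ((b i : ℂ) * z ^ (i : ℕ)) :=
    Finset.sum_congr rfl fun i _ => by ring
  have h2 : ∑ i : Fin N, (k : ℂ) * (b i.rev : ℂ) * z ^ ((i : ℕ) + 1) =
      ∑ i : Fin N, (k : ℂ) * ((b i.rev : ℂ) * z ^ ((i : ℕ) + 1)) :=
    Finset.sum_congr rfl fun i _ => by ring
  rw [h1, h2]
  ring

lemma revEval_schurStep (k : ℝ) (b : Fin N → ℝ) (z : ℂ) :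
    revEval (schurStep k b) z = revEval b z + k * (z * polyEval b z) := by
  have h3 : polyEval b z = z ^ N + ∑ i : Fin N, (b i.rev : ℂ) * z ^ (N - 1 - (i : ℕ)) := by
    rw [polyEval, ← Equiv.sum_comp Fin.revPerm]
    congr 1
    refine Finset.sum_congr rfl fun i _ => ?_
    simp only [Fin.revPerm_apply, Fin.val_rev]
    congr 2; omega
  rw [h3, revEval, revEval, Fin.sum_univ_succ]
  simp only [schurStep, Fin.cons_zero, Fin.cons_succ, Fin.val_zero, Fin.val_succ,
    mul_add, Finset.mul_sum, Complex.ofReal_add, Complex.ofReal_mul, add_mul, Finset.sum_add_distrib,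
    Nat.add_sub_add_right, Nat.sub_zero]
  have h2 : ∑ i : Fin N, (k : ℂ) * (b i.rev : ℂ) * z ^ (N - (i : ℕ)) =
      ∑ i : Fin N, (k : ℂ) * (z * ((b i.rev : ℂ) * z ^ (N - 1 - (i : ℕ)))) :=
    Finset.sum_congr rfl fun i _ => by
      have : N - (i : ℕ) = N - 1 - i + 1 := by have := i.2; omega
      rw [this]; ring
  rw [h2]
  ring

/-- The difference of the squares is `(|z|² - 1) * (1 - |w|²)`. -/
lemma norm_one_sub_conj_mul_le {z w : ℂ} (hw : ‖w‖ ≤ 1) (hz : 1 ≤ ‖z‖) :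
    ‖1 - (starRingEnd ℂ) w * z‖ ≤ ‖z - w‖ := by
  rw [← sq_le_sq₀ (norm_nonneg _) (norm_nonneg _), ← Complex.normSq_eq_norm_sq,
    ← Complex.normSq_eq_norm_sq]
  have h1 : Complex.normSq w ≤ 1 := by
    rw [Complex.normSq_eq_norm_sq]; nlinarith [norm_nonneg w]
  have h2 : 1 ≤ Complex.normSq z := by
    rw [Complex.normSq_eq_norm_sq]; nlinarith [norm_nonneg z]
  simp only [Complex.normSq_apply, Complex.sub_re, Complex.sub_im, Complex.mul_re, Complex.mul_im,
    Complex.conj_re, Complex.conj_im, Complex.one_re, Complex.one_im] at *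
  nlinarith [mul_nonneg (sub_nonneg.2 h2) (sub_nonneg.2 h1)]

/-- Up to conjugation the reversed polynomial is `∏ (1 - conj (w i) * z)`, to be compared with `∏ (z
- w i)` factor by factor. -/
lemma norm_revEval_le {b : Fin N → ℝ} (hb : b ∈ stable N) {z : ℂ} (hz : 1 ≤ ‖z‖) :
    ‖revEval b z‖ ≤ ‖polyEval b z‖ := by
  obtain ⟨w, hw⟩ := exists_isRootList b
  have hz0 : (starRingEnd ℂ) z ≠ 0 := by
    rw [Ne, map_eq_zero]; rintro rfl; norm_num at hz
  have hconj : (starRingEnd ℂ) (revEval b z) = revEval b ((starRingEnd ℂ) z) := by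
    simp [revEval, map_sum]
  have hrev : revEval b ((starRingEnd ℂ) z) = ∏ i, (1 - w i * (starRingEnd ℂ) z) := by
    set u := (starRingEnd ℂ) z
    have h1 := hw.eval_eq u⁻¹
    have h2 : revEval b u = u ^ N * (u⁻¹ ^ N + ∑ i, (b i : ℂ) * u⁻¹ ^ (i : ℕ)) := by
      rw [revEval, mul_add, ← mul_pow, mul_inv_cancel₀ hz0, one_pow, Finset.mul_sum]
      congr 1
      refine Finset.sum_congr rfl fun i _ => ?_
      rw [pow_sub₀ _ hz0 i.2.le, inv_pow]; ring
    have h3 : u ^ N = ∏ _i : Fin N, u := by simp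
    rw [h2, h1, h3, ← Finset.prod_mul_distrib]
    refine Finset.prod_congr rfl fun i _ => ?_
    rw [mul_sub, mul_inv_cancel₀ hz0, mul_comm]
  rw [polyEval, hw.eval_eq, ← Complex.norm_conj, hconj, hrev, norm_prod, norm_prod]
  refine Finset.prod_le_prod (fun _ _ => norm_nonneg _) fun i _ => ?_
  have := norm_one_sub_conj_mul_le (hb (w i) (hw.mem i)).le hz
  rwa [← Complex.norm_conj, map_sub, map_mul, map_one, Complex.conj_conj] at this

lemma polyEval_ne_zero {b : Fin N → ℝ} (hb : b ∈ stable N) {z : ℂ} (hz : 1 ≤ ‖z‖) :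
    polyEval b z ≠ 0 := fun h => (hb z h).not_ge hz

lemma mem_stable_iff {b : Fin N → ℝ} : b ∈ stable N ↔ ∀ z : ℂ, 1 ≤ ‖z‖ → polyEval b z ≠ 0 :=
  ⟨fun hb _ hz => polyEval_ne_zero hb hz, fun h z hz => not_le.1 fun hle => h z hle hz⟩

/-- Let `A = zP + kP*`, so that `A* = P* + kzP`. If `A` vanishes at some `|z| ≥ 1` with `P` stable,
then `|z P| = |k P*| ≤ |k| |P|`, impossible. If `P` vanishes there with `A` stable, then `|P*| =
|A*| ≤ |A| = |k| |P*|` with `A ≠ 0`, again impossible. -/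
lemma schurStep_mem_stable_iff {k : ℝ} (hk : |k| < 1) {b : Fin N → ℝ} :
    schurStep k b ∈ stable (N + 1) ↔ b ∈ stable N := by
  have hkn : ‖(k : ℂ)‖ = |k| := Complex.norm_real k
  constructor
  · intro h
    rw [mem_stable_iff]
    intro z hz h0
    have h1 := polyEval_schurStep k b z
    have h2 := revEval_schurStep k b z
    rw [h0, mul_zero, zero_add] at h1
    rw [h0, mul_zero, mul_zero, add_zero] at h2
    have h3 := norm_revEval_le h hz
    have h4 := norm_pos_iff.2 (polyEval_ne_zero h hz)
    rw [h2, h1, norm_mul, hkn] at h3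
    rw [h1, norm_mul, hkn] at h4
    nlinarith [norm_nonneg (revEval b z), abs_nonneg k]
  · intro h
    rw [mem_stable_iff]
    intro z hz h0
    rw [polyEval_schurStep, add_eq_zero_iff_eq_neg] at h0
    have h1 := congrArg norm h0
    rw [norm_neg, norm_mul, norm_mul, hkn] at h1
    have h3 := norm_revEval_le h hz
    have h4 := norm_pos_iff.2 (polyEval_ne_zero h hz)
    nlinarith [norm_nonneg (revEval b z), abs_nonneg k]

/-- The constant coefficient is up to sign the product of the roots. Hence only parameters `k` in
`(-1, 1)` contribute to the integral over stable polynomials. -/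
lemma abs_head_lt_one {a : Fin (N + 1) → ℝ} (ha : a ∈ stable (N + 1)) : |a 0| < 1 := by
  obtain ⟨w, hw⟩ := exists_isRootList a
  have h := hw.eval_eq 0
  have h0 : (0 : ℂ) ^ (N + 1) + ∑ i : Fin (N + 1), (a i : ℂ) * 0 ^ (i : ℕ) = a 0 := by
    rw [Fin.sum_univ_succ]; simp
  rw [h0] at h
  have h1 := congrArg norm h
  rw [Complex.norm_real, Real.norm_eq_abs, norm_prod] at h1
  rw [h1]
  have hlt : ∀ i, ‖0 - w i‖ < 1 := fun i => by rw [zero_sub, norm_neg]; exact ha _ (hw.mem i)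
  rw [Fin.prod_univ_succ]
  calc _ ≤ ‖0 - w 0‖ * 1 := by
        gcongr
        exact Finset.prod_le_one (fun _ _ => norm_nonneg _) fun i _ => (hlt _).le
    _ < 1 := by rw [mul_one]; exact hlt 0

/-- Roots of modulus at least one are the inverses of zeros of the reversed polynomial in the closed
disc. The disc is compact, so projecting it away is a closed map. -/
lemma isOpen_stable (N : ℕ) : IsOpen (stable N) := by
  set K := Metric.closedBall (0 : ℂ) 1
  have : (stable N)ᶜ = Prod.fst '' {p : (Fin N → ℝ) × K | revEval p.1 p.2 = 0} := by
    ext a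
    simp only [Set.mem_compl_iff, Set.mem_image, Set.mem_ofPred_eq, Prod.exists, exists_and_right,
      exists_eq_right, Subtype.exists, exists_prop]
    rw [mem_stable_iff]
    push Not
    have hrev : ∀ z : ℂ, z ≠ 0 → revEval a z = z ^ N * polyEval a z⁻¹ := by
      intro z hz
      rw [revEval, polyEval, mul_add, ← mul_pow, mul_inv_cancel₀ hz, one_pow, Finset.mul_sum]
      congr 1
      refine Finset.sum_congr rfl fun i _ => ?_
      rw [pow_sub₀ _ hz i.2.le, inv_pow]; ring
    constructor
    · rintro ⟨z, hz, h0⟩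
      have hz0 : z ≠ 0 := by rintro rfl; norm_num at hz
      refine ⟨z⁻¹, ?_, ?_⟩
      · rw [mem_closedBall_zero_iff, norm_inv]; exact inv_le_one_of_one_le₀ hz
      · rw [hrev _ (inv_ne_zero hz0), inv_inv, h0, mul_zero]
    · rintro ⟨z, hz, h0⟩
      have hz0 : z ≠ 0 := by
        rintro rfl
        refine one_ne_zero (α := ℂ) ?_
        rw [← h0, revEval]
        have : ∀ i : Fin N, (0 : ℂ) ^ (N - (i : ℕ)) = 0 := fun i =>
          zero_pow (by have := i.2; omega)
        simp [this]
      refine ⟨z⁻¹, ?_, ?_⟩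
      · rw [norm_inv]
        exact (one_le_inv₀ (norm_pos_iff.2 hz0)).2 (mem_closedBall_zero_iff.1 hz)
      · rw [hrev z hz0] at h0
        exact (mul_eq_zero.1 h0).resolve_left (pow_ne_zero _ hz0)
  have hK : CompactSpace K := isCompact_iff_compactSpace.1 (isCompact_closedBall _ _)
  rw [← isClosed_compl_iff, this]
  refine isClosedMap_fst_of_compactSpace _ (isClosed_eq ?_ continuous_const)
  unfold revEval
  fun_prop

/-- The matrix of `b ↦ b + k * b ∘ rev`. -/
noncomputable def schurMatrix (N : ℕ) (k : ℝ) : Matrix (Fin N) (Fin N) ℝ :=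
  Matrix.of fun i j => (if i = j then 1 else 0) + k * (if i.rev = j then 1 else 0)

lemma schurMatrix_mulVec (k : ℝ) (b : Fin N → ℝ) :
    (schurMatrix N k).mulVec b = fun i => b i + k * b i.rev := by
  ext i
  simp [schurMatrix, Matrix.mulVec, dotProduct, add_mul, Finset.sum_add_distrib]

/-- The map couples `i` only with `i.rev`: each of the `m` pairs gives a block of determinant `1 - k
^ 2`, and the middle index, present when `r = 1`, gives `1 + k`. -/
lemma det_schurMatrix (m r : ℕ) (hr : r ≤ 1) (k : ℝ) :
    (schurMatrix (2 * m + r) k).det = (1 - k ^ 2) ^ m * (1 + k) ^ r := by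
  set f : (Fin m ⊕ Fin m) ⊕ Fin r → Fin (2 * m + r) := Sum.elim
    (Sum.elim (fun i => ⟨i, by omega⟩) (fun i => ⟨2 * m + r - 1 - i, by omega⟩))
    (fun j => ⟨m + j, by omega⟩) with hf
  have hinj : Function.Injective f := by
    rintro ((i | i) | i) ((j | j) | j) h <;>
      simp only [hf, Sum.elim_inl, Sum.elim_inr, Fin.mk.injEq] at h <;>
      (first
        | (congr 2; ext; omega)
        | (exfalso; omega))
  have hbij : Function.Bijective f := by
    refine (Fintype.bijective_iff_injective_and_card f).2 ⟨hinj, ?_⟩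
    simp; ring
  have hsub : (schurMatrix (2 * m + r) k).submatrix f f =
      Matrix.fromBlocks (Matrix.fromBlocks 1 (k • 1) (k • 1) 1) 0 0 ((1 + k) • 1) := by
    ext x y
    rcases x with (i | i) | i <;> rcases y with (j | j) | j <;>
      simp only [Matrix.submatrix_apply, schurMatrix, Matrix.of_apply, hf, Sum.elim_inl, Sum.elim_inr,
        Matrix.fromBlocks_apply₁₁, Matrix.fromBlocks_apply₁₂, Matrix.fromBlocks_apply₂₁,
        Matrix.fromBlocks_apply₂₂, Matrix.smul_apply, Matrix.one_apply, Fin.ext_iff, Fin.val_rev,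
        Matrix.zero_apply, smul_eq_mul] <;>
      split_ifs <;> first | omega | simp
  have := Matrix.det_submatrix_equiv_self (Equiv.ofBijective f hbij) (schurMatrix (2 * m + r) k)
  rw [← this]
  change ((schurMatrix (2 * m + r) k).submatrix f f).det = _
  rw [hsub, Matrix.det_fromBlocks_zero₂₁, Matrix.det_fromBlocks_one₁₁]
  congr 1
  · have : (1 : Matrix (Fin m) (Fin m) ℝ) - (k • 1) * (k • 1) = (1 - k ^ 2) • 1 := by
      rw [smul_mul_smul_comm, one_mul, sub_smul, one_smul, sq]
    rw [this, Matrix.det_smul, Matrix.det_one, Fintype.card_fin, mul_one]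
  · rw [Matrix.det_smul, Matrix.det_one, Fintype.card_fin, mul_one]

/-- The `s`-th moment of the value at `1` over the stable polynomials of degree `N`. -/
noncomputable def stableMoment (s N : ℕ) : ℝ≥0∞ :=
  ∫⁻ a : Fin N → ℝ, (stable N).indicator (fun a => ENNReal.ofReal (|1 + ∑ i, a i| ^ s)) a

lemma measurable_stableMoment (s N : ℕ) : Measurable fun a : Fin N → ℝ =>
    (stable N).indicator (fun a => ENNReal.ofReal (|1 + ∑ i, a i| ^ s)) a :=
  Measurable.indicator (by fun_prop) (isOpen_stable N).measurableSet

/-- The first coordinate of a coefficient vector is the Schur parameter `k`; for fixed `k` the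
remaining ones are the image of a stable vector under `schurMatrix`. The value at `1` gets
multiplied by `1 + k`, which accounts for the exponent `r + s`. -/
lemma stableMoment_succ (s m r : ℕ) (hr : r ≤ 1) :
    stableMoment s (2 * m + r + 1) =
      (∫⁻ k in Set.Ioo (-1 : ℝ) 1, ENNReal.ofReal ((1 - k ^ 2) ^ m * (1 + k) ^ (r + s))) *
        stableMoment s (2 * m + r) := by
  rw [stableMoment, lintegral_cons (measurable_stableMoment s _), ← lintegral_mul_const _ (by fun_prop),
    ← lintegral_indicator measurableSet_Ioo]
  refine lintegral_congr fun k => ?_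
  by_cases hk : k ∈ Set.Ioo (-1 : ℝ) 1
  · rw [Set.indicator_of_mem hk]
    have hk' : |k| < 1 := abs_lt.2 hk
    have hk2 : 0 < 1 - k ^ 2 := by nlinarith [hk.1, hk.2]
    have hk3 : 0 < 1 + k := by linarith [hk.1]
    have hdet : LinearMap.det (Matrix.toLin' (schurMatrix (2 * m + r) k)) =
        (1 - k ^ 2) ^ m * (1 + k) ^ r := by
      rw [LinearMap.det_toLin', det_schurMatrix m r hr]
    have hpos : 0 < (1 - k ^ 2) ^ m * (1 + k) ^ r := by positivity
    have hmeas : Measurable fun y : Fin (2 * m + r) → ℝ => (stable (2 * m + r + 1)).indicator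
        (fun a => ENNReal.ofReal (|1 + ∑ i, a i| ^ s)) (Fin.cons k y) := by
      have hc : Measurable fun y : Fin (2 * m + r) → ℝ => (Fin.cons k y : Fin (2 * m + r + 1) → ℝ) :=
        (by fun_prop : Continuous _).measurable
      exact (measurable_stableMoment s (2 * m + r + 1)).comp hc
    rw [lintegral_eq_det_mul_lintegral_comp (A := Matrix.toLin' (schurMatrix (2 * m + r) k))
      (by rw [hdet]; exact hpos.ne') hmeas, hdet,
      abs_of_pos hpos, pow_add, ← mul_assoc, ENNReal.ofReal_mul hpos.le, mul_assoc, stableMoment,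
      ← lintegral_const_mul _ (measurable_stableMoment s _)]
    congr 1
    refine lintegral_congr fun b => ?_
    rw [Matrix.toLin'_apply, schurMatrix_mulVec]
    change (stable _).indicator _ (schurStep k b) = _
    by_cases hb : b ∈ stable (2 * m + r)
    · rw [Set.indicator_of_mem ((schurStep_mem_stable_iff hk').2 hb), Set.indicator_of_mem hb,
        ← ENNReal.ofReal_mul (by positivity)]
      congr 1
      have : 1 + ∑ i, schurStep k b i = (1 + k) * (1 + ∑ i, b i) := by
        rw [Fin.sum_univ_succ]
        simp only [schurStep, Fin.cons_zero, Fin.cons_succ, Finset.sum_add_distrib, ← Finset.mul_sum]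
        rw [show ∑ i : Fin (2 * m + r), b i.rev = ∑ i, b i from Equiv.sum_comp Fin.revPerm b]
        ring
      rw [this, abs_mul, mul_pow, abs_of_pos hk3]
    · rw [Set.indicator_of_notMem (fun h => hb ((schurStep_mem_stable_iff hk').1 h)),
        Set.indicator_of_notMem hb, mul_zero]
  · rw [Set.indicator_of_notMem hk, ← lintegral_zero (α := Fin (2 * m + r) → ℝ) (μ := volume)]
    refine lintegral_congr fun y => Set.indicator_of_notMem (fun h => hk ?_) _
    exact abs_lt.1 (abs_head_lt_one h)

lemma lintegral_Ioo_ofReal {a b : ℝ} (hab : a ≤ b) {f : ℝ → ℝ} (hf : Continuous f)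
    (h0 : ∀ x ∈ Set.Ioo a b, 0 ≤ f x) :
    ∫⁻ x in Set.Ioo a b, ENNReal.ofReal (f x) = ENNReal.ofReal (∫ x in a..b, f x) := by
  rw [intervalIntegral.integral_of_le hab, integral_Ioc_eq_integral_Ioo,
    ofReal_integral_eq_lintegral_ofReal]
  · exact (hf.integrableOn_Icc (a := a) (b := b)).mono_set Set.Ioo_subset_Icc_self
  · exact (ae_restrict_iff' measurableSet_Ioo).2 (ae_of_all _ h0)

/-- The function `k * (1 - k ^ 2) ^ (m + 1)` vanishes at both ends, so the integral of its
derivative is zero. -/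
lemma integral_one_sub_sq_pow_succ (m : ℕ) :
    (2 * m + 3 : ℝ) * ∫ k in (-1 : ℝ)..1, (1 - k ^ 2) ^ (m + 1) =
      (2 * m + 2 : ℝ) * ∫ k in (-1 : ℝ)..1, (1 - k ^ 2) ^ m := by
  have hd : ∀ k ∈ Set.uIcc (-1 : ℝ) 1, HasDerivAt (fun k : ℝ => k * (1 - k ^ 2) ^ (m + 1))
      ((2 * m + 3) * (1 - k ^ 2) ^ (m + 1) - (2 * m + 2) * (1 - k ^ 2) ^ m) k := by
    intro k _
    have h1 : HasDerivAt (fun k : ℝ => 1 - k ^ 2) (-(2 * k)) k := by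
      simpa using (hasDerivAt_pow 2 k).const_sub 1
    have h2 := (hasDerivAt_id k).mul (h1.pow (m + 1))
    convert! h2 using 1
    simp
    ring
  have h := intervalIntegral.integral_eq_sub_of_hasDerivAt hd (by
    apply Continuous.intervalIntegrable; fun_prop)
  rw [intervalIntegral.integral_sub (by apply Continuous.intervalIntegrable; fun_prop)
    (by apply Continuous.intervalIntegrable; fun_prop), intervalIntegral.integral_const_mul,
    intervalIntegral.integral_const_mul] at h
  simp at h
  linarith

lemma factor_succ (m : ℕ) : (2 * m + 3) * factor (m + 1) = (2 * m + 2) * factor m := by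
  unfold factor
  rw [show 2 * (m + 1) + 1 = (2 * m + 1) + 1 + 1 by ring, Nat.factorial_succ (2 * m + 1 + 1),
    Nat.factorial_succ (2 * m + 1), Nat.factorial_succ m]
  push_cast
  have : ((2 * m + 1).factorial : ℝ) ≠ 0 := by positivity
  field_simp
  ring

lemma factor_pos (m : ℕ) : 0 < factor m := by unfold factor; positivity

lemma integral_one_sub_sq_pow (m : ℕ) : ∫ k in (-1 : ℝ)..1, (1 - k ^ 2) ^ m = factor m := by
  induction m with
  | zero => simp [factor]; norm_num
  | succ m ih =>
    have h1 := integral_one_sub_sq_pow_succ m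
    rw [ih, ← factor_succ] at h1
    exact mul_left_cancel₀ (by positivity) h1

lemma integral_mul_one_sub_sq_pow (m : ℕ) : ∫ k in (-1 : ℝ)..1, k * (1 - k ^ 2) ^ m = 0 := by
  have h := intervalIntegral.integral_comp_neg (a := -1) (b := 1) fun k : ℝ => k * (1 - k ^ 2) ^ m
  simp only [neg_neg, neg_sq, neg_mul, intervalIntegral.integral_neg] at h
  linarith

/-- The factors of the recursions for the moments of order at most one. -/
noncomputable def momentFactor (m e : ℕ) : ℝ :=
  if e ≤ 1 then factor m else 2 * factor m - factor (m + 1)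

lemma integral_momentFactor (m : ℕ) {e : ℕ} (he : e ≤ 2) :
    ∫ k in (-1 : ℝ)..1, (1 - k ^ 2) ^ m * (1 + k) ^ e = momentFactor m e := by
  have i1 : IntervalIntegrable (fun k : ℝ => (1 - k ^ 2) ^ m) volume (-1) 1 := by
    apply Continuous.intervalIntegrable; fun_prop
  have i2 : IntervalIntegrable (fun k : ℝ => k * (1 - k ^ 2) ^ m) volume (-1) 1 := by
    apply Continuous.intervalIntegrable; fun_prop
  have i3 : IntervalIntegrable (fun k : ℝ => (1 - k ^ 2) ^ (m + 1)) volume (-1) 1 := by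
    apply Continuous.intervalIntegrable; fun_prop
  interval_cases e
  · simp [momentFactor, integral_one_sub_sq_pow]
  · rw [show (fun k : ℝ => (1 - k ^ 2) ^ m * (1 + k) ^ 1) =
      fun k => (1 - k ^ 2) ^ m + k * (1 - k ^ 2) ^ m by ext k; ring,
      intervalIntegral.integral_add i1 i2, integral_one_sub_sq_pow, integral_mul_one_sub_sq_pow]
    simp [momentFactor]
  · rw [show (fun k : ℝ => (1 - k ^ 2) ^ m * (1 + k) ^ 2) =
      fun k => (2 * (1 - k ^ 2) ^ m + 2 * (k * (1 - k ^ 2) ^ m)) - (1 - k ^ 2) ^ (m + 1) by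
        ext k; ring,
      intervalIntegral.integral_sub ((i1.const_mul 2).add (i2.const_mul 2)) i3,
      intervalIntegral.integral_add (i1.const_mul 2) (i2.const_mul 2),
      intervalIntegral.integral_const_mul, intervalIntegral.integral_const_mul,
      integral_one_sub_sq_pow, integral_mul_one_sub_sq_pow, integral_one_sub_sq_pow]
    simp [momentFactor]

lemma lintegral_momentFactor (m : ℕ) {e : ℕ} (he : e ≤ 2) :
    ∫⁻ k in Set.Ioo (-1 : ℝ) 1, ENNReal.ofReal ((1 - k ^ 2) ^ m * (1 + k) ^ e) =
      ENNReal.ofReal (momentFactor m e) := by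
  rw [← integral_momentFactor m he, lintegral_Ioo_ofReal (by norm_num) (by fun_prop)]
  intro k hk
  have h1 : 0 ≤ 1 - k ^ 2 := by nlinarith [hk.1, hk.2]
  have h2 : 0 ≤ 1 + k := by linarith [hk.1]
  positivity

lemma stableMoment_zero (s : ℕ) : stableMoment s 0 = 1 := by
  have : stable 0 = Set.univ := by
    ext a; simp [stable, croots]
  rw [stableMoment, this, Measure.volume_pi_eq_dirac 0]
  simp

lemma exists_eq_two_mul_add (N : ℕ) : ∃ m r, r ≤ 1 ∧ N = 2 * m + r :=
  ⟨N / 2, N % 2, by omega, by omega⟩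

lemma D_succ (m r : ℕ) (hr : r ≤ 1) : D (2 * m + r + 1) = factor m * D (2 * m + r) := by
  interval_cases r
  · have h1 : ¬ Even (2 * m + 0 + 1) := by simp [parity_simps]
    have h2 : Even (2 * m + 0) := by simp
    rw [D, if_neg h1, D, if_pos h2, show (2 * m + 0 + 1) / 2 = m by omega,
      show (2 * m + 0) / 2 = m by omega]
  · have h1 : Even (2 * m + 1 + 1) := by simp [parity_simps]
    have h2 : ¬ Even (2 * m + 1) := by simp [parity_simps]
    rw [D, if_pos h1, D, if_neg h2, show (2 * m + 1 + 1) / 2 = m + 1 by omega,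
      show (2 * m + 1) / 2 = m by omega, Finset.prod_range_succ]
    ring

lemma D_pos (N : ℕ) : 0 < D N := by
  have : 0 < ∏ k ∈ Finset.range (N / 2), factor k ^ 2 :=
    Finset.prod_pos fun k _ => pow_pos (factor_pos k) 2
  unfold D
  split_ifs
  · exact this
  · exact mul_pos (factor_pos _) this

theorem stableMoment_order_zero (N : ℕ) : stableMoment 0 N = ENNReal.ofReal (D N) := by
  induction N with
  | zero => rw [stableMoment_zero]; simp [D]
  | succ N ih =>
    obtain ⟨m, r, hr, rfl⟩ := exists_eq_two_mul_add N
    rw [stableMoment_succ _ _ _ hr, ih, lintegral_momentFactor _ (by omega), D_succ m r hr,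
      momentFactor, if_pos (by omega), ENNReal.ofReal_mul (factor_pos m).le]

/-- The factor `(N + 1) * (N + 2) / 4` is the one cancelled by the integral over the dominant root
in the Perron volume. The two parities in `DPerron` reflect the integrand of the recursion step, `(1
+ k)` or `(1 + k) ^ 2` times `(1 - k ^ 2) ^ m`. -/
theorem stableMoment_order_one (N : ℕ) :
    stableMoment 1 N = ENNReal.ofReal ((N + 1) * (N + 2) / 4 * DPerron (N + 1)) := by
  induction N with
  | zero => rw [stableMoment_zero]; simp [DPerron, D, factor]; norm_num
  | succ N ih =>
    obtain ⟨m, r, hr, rfl⟩ := exists_eq_two_mul_add N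
    have hmf : 0 ≤ momentFactor m (r + 1) := by
      unfold momentFactor
      split_ifs
      · exact (factor_pos m).le
      · have := factor_succ m
        have := factor_pos (m + 1)
        nlinarith
    rw [stableMoment_succ _ _ _ hr, ih, lintegral_momentFactor _ (by omega),
      ← ENNReal.ofReal_mul hmf]
    congr 1
    interval_cases r
    · have h1 : ¬ Even (2 * m + 0 + 1) := by simp [parity_simps]
      have h2 : Even (2 * m + 0 + 1 + 1) := by simp [parity_simps]
      have h3 := D_succ m 1 le_rfl
      rw [DPerron, if_neg h1, DPerron, if_pos h2, momentFactor, if_pos (by omega)]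
      rw [show 2 * m + 0 + 1 + 1 = 2 * m + 1 + 1 by ring, h3]
      push_cast
      field_simp
      ring
    · have h1 : ¬ Even (2 * m + 1 + 1 + 1) := by simp [parity_simps]
      have h2 : Even (2 * m + 1 + 1) := by simp [parity_simps]
      have h3 := D_succ (m + 1) 0 (by omega)
      have h4 := factor_succ m
      rw [DPerron, if_pos h2, DPerron, if_neg h1, momentFactor, if_neg (by omega),
        show 2 * m + 1 + 1 + 1 = 2 * (m + 1) + 0 + 1 by ring, h3,
        show 2 * (m + 1) + 0 = 2 * m + 1 + 1 by ring]
      have h5 : factor m = (2 * m + 3) / (2 * m + 2) * factor (m + 1) := by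
        field_simp; linarith
      rw [h5]
      push_cast
      field_simp
      ring

end Schur

end PerronCount

namespace PerronCount

open MeasureTheory
open scoped Topology ENNReal

/-! ### The volume of the polynomials with a dominant root -/

section Perron

variable {N : ℕ}

/-- The coefficients, except the constant one, of `(X - r) * r ^ N * Q (X / r)`, where `Q` is the
monic polynomial with coefficient vector `b`. -/
def tailMap {K : Type*} [CommRing K] (r : K) (b : Fin N → K) (i : Fin N) : K :=
  r ^ (N - (i : ℕ)) * (b i - (Fin.snoc b 1 : Fin (N + 1) → K) i.succ)

lemma tailMap_identity {K : Type*} [CommRing K] (r z : K) (b : Fin N → K) :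
    z ^ (N + 1) + ∑ i : Fin N, tailMap r b i * z ^ ((i : ℕ) + 1) =
      (z - r) * (z ^ N + ∑ i : Fin N, r ^ (N - (i : ℕ)) * b i * z ^ (i : ℕ)) +
        r ^ (N + 1) * (Fin.snoc b 1 : Fin (N + 1) → K) 0 := by
  set e : Fin (N + 1) → K := Fin.snoc b 1 with he
  have h1 : z ^ N + ∑ i : Fin N, r ^ (N - (i : ℕ)) * b i * z ^ (i : ℕ) =
      ∑ j : Fin (N + 1), r ^ (N - (j : ℕ)) * e j * z ^ (j : ℕ) := by
    rw [Fin.sum_univ_castSucc, add_comm]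
    simp [he]
  have h2 : z * ∑ j : Fin (N + 1), r ^ (N - (j : ℕ)) * e j * z ^ (j : ℕ) =
      z ^ (N + 1) + ∑ i : Fin N, r ^ (N - (i : ℕ)) * b i * z ^ ((i : ℕ) + 1) := by
    rw [Fin.sum_univ_castSucc, mul_add, Finset.mul_sum, add_comm]
    congr 1
    · simp [he]; ring
    · refine Finset.sum_congr rfl fun i _ => ?_
      simp [he]; ring
  have h3 : r * ∑ j : Fin (N + 1), r ^ (N - (j : ℕ)) * e j * z ^ (j : ℕ) =
      r ^ (N + 1) * e 0 + ∑ i : Fin N, r ^ (N - (i : ℕ)) * e i.succ * z ^ ((i : ℕ) + 1) := by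
    rw [Fin.sum_univ_succ, mul_add, Finset.mul_sum]
    congr 1
    · simp; ring
    · refine Finset.sum_congr rfl fun i _ => ?_
      have : N - (i : ℕ) = N - (i.succ : ℕ) + 1 := by
        rw [Fin.val_succ]; have := i.2; omega
      rw [this, pow_succ, Fin.val_succ]; ring
  rw [h1, sub_mul, h2, h3]
  simp only [tailMap, mul_sub, sub_mul, Finset.sum_sub_distrib, ← he]
  ring

/-- The constant coefficient that makes `r` a root, for given higher coefficients `t`. -/
noncomputable def headFun (r : ℝ) (t : Fin N → ℝ) : ℝ :=
  -(r ^ (N + 1) + ∑ i : Fin N, t i * r ^ ((i : ℕ) + 1))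

/-- The coefficient vector of `(X - r) * r ^ N * Q (X / r)`. -/
noncomputable def domPoly (r : ℝ) (b : Fin N → ℝ) : Fin (N + 1) → ℝ :=
  Fin.cons (headFun r (tailMap r b)) (tailMap r b)

lemma ofReal_tailMap (r : ℝ) (b : Fin N → ℝ) (i : Fin N) :
    ((tailMap r b i : ℝ) : ℂ) = tailMap (r : ℂ) (fun i => (b i : ℂ)) i := by
  have : ∀ j : Fin (N + 1), (((Fin.snoc b 1 : Fin (N + 1) → ℝ) j : ℝ) : ℂ) =
      (Fin.snoc (fun i => (b i : ℂ)) 1 : Fin (N + 1) → ℂ) j := by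
    intro j; refine Fin.lastCases ?_ (fun i => ?_) j <;> simp
  simp only [tailMap, Complex.ofReal_mul, Complex.ofReal_pow, Complex.ofReal_sub, this]

lemma polyEval_domPoly_eq (r : ℝ) (b : Fin N → ℝ) (z : ℂ) :
    polyEval (domPoly r b) z =
      (z - r) * (z ^ N + ∑ i : Fin N, (r : ℂ) ^ (N - (i : ℕ)) * b i * z ^ (i : ℕ)) := by
  have h1 := tailMap_identity (r : ℂ) z fun i => (b i : ℂ)
  have h2 := tailMap_identity (r : ℂ) r fun i => (b i : ℂ)
  rw [polyEval, Fin.sum_univ_succ]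
  simp only [domPoly, Fin.cons_zero, Fin.cons_succ, Fin.val_zero, pow_zero, mul_one, Fin.val_succ,
    headFun, Complex.ofReal_neg, Complex.ofReal_add, Complex.ofReal_pow, Complex.ofReal_sum,
    Complex.ofReal_mul, ofReal_tailMap]
  rw [sub_self, zero_mul, zero_add] at h2
  linear_combination h1 - h2

lemma scaled_eval {r : ℝ} (hr : r ≠ 0) (b : Fin N → ℝ) (z : ℂ) :
    z ^ N + ∑ i : Fin N, (r : ℂ) ^ (N - (i : ℕ)) * b i * z ^ (i : ℕ) =
      (r : ℂ) ^ N * polyEval b (z / r) := by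
  have hr' : (r : ℂ) ≠ 0 := by exact_mod_cast hr
  rw [polyEval, mul_add, div_pow, mul_div_cancel₀ _ (pow_ne_zero _ hr'), Finset.mul_sum]
  congr 1
  refine Finset.sum_congr rfl fun i _ => ?_
  rw [div_pow, pow_sub₀ _ hr' i.2.le]
  field_simp

/-- The parameters of the polynomials with a dominant nonzero root in the open unit disc. -/
def domParam (N : ℕ) : Set (ℝ × (Fin N → ℝ)) := {p | p.1 ≠ 0 ∧ |p.1| < 1 ∧ p.2 ∈ stable N}

lemma mem_croots_iff_polyEval {a : Fin N → ℝ} {z : ℂ} : z ∈ croots a ↔ polyEval a z = 0 := Iff.rfl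

lemma self_mem_croots_domPoly (r : ℝ) (b : Fin N → ℝ) : (r : ℂ) ∈ croots (domPoly r b) := by
  rw [mem_croots_iff_polyEval, polyEval_domPoly_eq, sub_self, zero_mul]

lemma norm_lt_of_mem_croots_domPoly {r : ℝ} {b : Fin N → ℝ} (h : (r, b) ∈ domParam N) {z : ℂ}
    (hz : z ∈ croots (domPoly r b)) (hne : z ≠ r) : ‖z‖ < |r| := by
  have hr' : (r : ℂ) ≠ 0 := by exact_mod_cast h.1
  rw [mem_croots_iff_polyEval, polyEval_domPoly_eq, scaled_eval h.1, mul_eq_zero, sub_eq_zero,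
    or_iff_right hne, mul_eq_zero, or_iff_right (pow_ne_zero _ hr')] at hz
  have := h.2.2 _ hz
  rwa [norm_div, Complex.norm_real, Real.norm_eq_abs, div_lt_one (abs_pos.2 h.1)] at this

/-- Two different dominant roots would each have to be larger than the other. -/
lemma root_eq_of_domPoly_eq {r r' : ℝ} {b b' : Fin N → ℝ} (h : (r, b) ∈ domParam N)
    (h' : (r', b') ∈ domParam N) (he : domPoly r b = domPoly r' b') : r = r' := by
  by_contra hne
  have h1 := norm_lt_of_mem_croots_domPoly h' (z := r) (he ▸ self_mem_croots_domPoly r b)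
    (by exact_mod_cast hne)
  have h2 := norm_lt_of_mem_croots_domPoly h (z := r') (he ▸ self_mem_croots_domPoly r' b')
    (by exact_mod_cast Ne.symm hne)
  rw [Complex.norm_real, Real.norm_eq_abs] at h1 h2
  exact lt_asymm h1 h2

/-- The linear part of `tailMap r`. -/
noncomputable def tailMatrix (N : ℕ) (r : ℝ) : Matrix (Fin N) (Fin N) ℝ :=
  Matrix.of fun i j => r ^ (N - (i : ℕ)) *
    ((if i = j then 1 else 0) - if (i : ℕ) + 1 = j then 1 else 0)

/-- The matrix is upper triangular with diagonal entries `r ^ (N - i)`. -/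
lemma det_tailMatrix (N : ℕ) (r : ℝ) : (tailMatrix N r).det = r ^ tri N := by
  rw [Matrix.det_of_isUpperTriangular]
  · simp [tailMatrix, Finset.prod_pow_eq_pow_sum, sum_sub_eq_tri]
  · intro i j hij
    have hij' : (j : ℕ) < i := hij
    have h1 : i ≠ j := by rintro rfl; omega
    have h2 : (i : ℕ) + 1 ≠ j := by omega
    simp [tailMatrix, h1, h2]

/-- For fixed `r` the map is affine; the translation comes from the leading coefficient `1` of `Q`.
-/
lemma tailMap_eq (r : ℝ) (b : Fin N → ℝ) :
    tailMap r b = Matrix.toLin' (tailMatrix N r) b + tailMap r 0 := by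
  ext i
  have hs : (Fin.snoc b 1 : Fin (N + 1) → ℝ) i.succ =
      (∑ j : Fin N, if (i : ℕ) + 1 = j then b j else 0) +
        (Fin.snoc (0 : Fin N → ℝ) 1 : Fin (N + 1) → ℝ) i.succ := by
    by_cases hi : (i : ℕ) + 1 = N
    · have h1 : i.succ = Fin.last N := Fin.ext hi
      rw [h1, Fin.snoc_last, Fin.snoc_last, Finset.sum_eq_zero, zero_add]
      intro j _
      have := j.2
      rw [if_neg (by omega)]
    · have hi' : (i : ℕ) + 1 < N := by have := i.2; omega
      have h1 : i.succ = Fin.castSucc ⟨i + 1, hi'⟩ := rfl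
      rw [h1, Fin.snoc_castSucc, Fin.snoc_castSucc, Finset.sum_eq_single ⟨i + 1, hi'⟩]
      · simp
      · intro j _ hj
        rw [if_neg]
        intro h
        exact hj (Fin.ext h.symm)
      · simp
  have hm : Matrix.toLin' (tailMatrix N r) b i =
      r ^ (N - (i : ℕ)) * (b i - ∑ j : Fin N, if (i : ℕ) + 1 = j then b j else 0) := by
    rw [Matrix.toLin'_apply, Matrix.mulVec, dotProduct]
    simp only [tailMatrix, Matrix.of_apply, mul_assoc, ← Finset.mul_sum, sub_mul,
      Finset.sum_sub_distrib, ite_mul, one_mul, zero_mul]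
    simp
  rw [Pi.add_apply, hm]
  simp only [tailMap]
  rw [hs, Pi.zero_apply]
  ring

lemma tailMap_injective {r : ℝ} (hr : r ≠ 0) :
    Function.Injective (tailMap r : (Fin N → ℝ) → Fin N → ℝ) := by
  intro b b' h
  rw [tailMap_eq, tailMap_eq r b'] at h
  have h2 := add_right_cancel h
  rw [Matrix.toLin'_apply, Matrix.toLin'_apply] at h2
  refine Matrix.mulVec_injective_of_isUnit ?_ h2
  rw [Matrix.isUnit_iff_isUnit_det, det_tailMatrix]
  exact (pow_ne_zero _ hr).isUnit

lemma lintegral_tailMap {r : ℝ} (hr : r ≠ 0) {G : (Fin N → ℝ) → ℝ≥0∞} (hG : Measurable G) :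
    ∫⁻ t, G t = ENNReal.ofReal (|r| ^ tri N) * ∫⁻ b, G (tailMap r b) := by
  have hdet : LinearMap.det (Matrix.toLin' (tailMatrix N r)) = r ^ tri N := by
    rw [LinearMap.det_toLin', det_tailMatrix]
  rw [← lintegral_add_right_eq_self G (tailMap r 0),
    lintegral_eq_det_mul_lintegral_comp (A := Matrix.toLin' (tailMatrix N r))
      (by rw [hdet]; exact pow_ne_zero _ hr) (by fun_prop), hdet, abs_pow]
  simp only [← tailMap_eq]

lemma continuous_tailMap : Continuous fun p : ℝ × (Fin N → ℝ) => tailMap p.1 p.2 := by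
  refine continuous_pi fun i => ?_
  unfold tailMap
  have : Continuous fun p : ℝ × (Fin N → ℝ) => (Fin.snoc p.2 1 : Fin (N + 1) → ℝ) i.succ := by
    refine Fin.lastCases (motive := fun j => Continuous fun p : ℝ × (Fin N → ℝ) =>
      (Fin.snoc p.2 1 : Fin (N + 1) → ℝ) j) ?_ (fun j => ?_) i.succ
    · simpa using continuous_const
    · simp only [Fin.snoc_castSucc]; fun_prop
  fun_prop

lemma measurableSet_domParam (N : ℕ) : MeasurableSet (domParam N) := by
  have h1 : MeasurableSet {p : ℝ × (Fin N → ℝ) | p.1 ≠ 0} :=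
    (isOpen_ne_fun continuous_fst continuous_const).measurableSet
  have h2 : MeasurableSet {p : ℝ × (Fin N → ℝ) | |p.1| < 1} :=
    (isOpen_lt (by fun_prop) continuous_const).measurableSet
  exact h1.inter (h2.inter (measurable_snd (isOpen_stable N).measurableSet))

/-- The pairs of a dominant root and the vector of the higher coefficients. -/
def domRootTail (N : ℕ) : Set (ℝ × (Fin N → ℝ)) :=
  (fun p : ℝ × (Fin N → ℝ) => (p.1, tailMap p.1 p.2)) '' domParam N

/-- An injective continuous image of a Borel set is Borel (Lusin–Souslin). -/
lemma measurableSet_domRootTail (N : ℕ) : MeasurableSet (domRootTail N) := by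
  refine (measurableSet_domParam N).image_of_continuousOn_injOn
    (continuous_fst.prodMk continuous_tailMap).continuousOn ?_
  rintro ⟨r, b⟩ h ⟨r', b'⟩ - he
  obtain ⟨h1, h2⟩ := Prod.mk.inj he
  simp only at h1
  subst h1
  exact Prod.ext rfl (tailMap_injective h.1 h2)

lemma tailMap_mem_domRootTail {r : ℝ} {b : Fin N → ℝ} (hr : r ≠ 0) :
    (r, tailMap r b) ∈ domRootTail N ↔ |r| < 1 ∧ b ∈ stable N := by
  constructor
  · rintro ⟨⟨r', b'⟩, h, he⟩
    obtain ⟨h1, h2⟩ := Prod.mk.inj he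
    simp only at h1
    subst h1
    rw [← tailMap_injective hr h2]
    exact h.2
  · intro h
    exact ⟨(r, b), ⟨hr, h⟩, rfl⟩

/-- The polynomials with a dominant nonzero root in the open unit disc. -/
def domSet (N : ℕ) : Set (Fin (N + 1) → ℝ) :=
  (fun p : ℝ × (Fin N → ℝ) => domPoly p.1 p.2) '' domParam N

lemma continuous_headFun : Continuous fun p : ℝ × (Fin N → ℝ) => headFun p.1 p.2 := by
  unfold headFun; fun_prop

lemma measurableSet_domSet (N : ℕ) : MeasurableSet (domSet N) := by
  refine (measurableSet_domParam N).image_of_continuousOn_injOn ?_ ?_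
  · have h : Continuous fun p : ℝ × (Fin N → ℝ) => headFun p.1 (tailMap p.1 p.2) :=
      continuous_headFun.comp (continuous_fst.prodMk continuous_tailMap)
    have h2 := continuous_tailMap (N := N)
    refine Continuous.continuousOn (continuous_pi fun i => ?_)
    refine Fin.cases ?_ (fun j => ?_) i
    · simpa [domPoly] using h
    · simp only [domPoly, Fin.cons_succ]; fun_prop
  · rintro ⟨r, b⟩ h ⟨r', b'⟩ h' he
    have h1 := root_eq_of_domPoly_eq h h' he
    subst h1
    have h2 := (Fin.cons_inj.1 he).2
    exact Prod.ext rfl (tailMap_injective h.1 h2)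

lemma section_domSet (t : Fin N → ℝ) :
    {x : ℝ | (Fin.cons x t : Fin (N + 1) → ℝ) ∈ domSet N} =
      (fun r => headFun r t) '' {r | (r, t) ∈ domRootTail N} := by
  ext x
  constructor
  · rintro ⟨⟨r, b⟩, h, he⟩
    obtain ⟨h1, h2⟩ := Fin.cons_inj.1 he
    simp only at h1 h2
    exact ⟨r, ⟨(r, b), h, by simp [h2]⟩, by rw [← h1, ← h2]⟩
  · rintro ⟨r, ⟨⟨r', b⟩, h, he⟩, rfl⟩
    obtain ⟨h1, h2⟩ := Prod.mk.inj he
    simp only at h1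
    subst h1
    exact ⟨(r', b), h, by rw [← h2]; rfl⟩

lemma injOn_headFun (t : Fin N → ℝ) :
    Set.InjOn (fun r => headFun r t) {r | (r, t) ∈ domRootTail N} := by
  rintro r ⟨⟨r₁, b₁⟩, h₁, he₁⟩ r' ⟨⟨r₂, b₂⟩, h₂, he₂⟩ he
  obtain ⟨rfl, h3⟩ := Prod.mk.inj he₁
  obtain ⟨rfl, h4⟩ := Prod.mk.inj he₂
  refine root_eq_of_domPoly_eq h₁ h₂ ?_
  simp only at he h3 h4 ⊢
  rw [domPoly, domPoly, h3, h4, he]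

/-- The derivative of `headFun` with respect to the root. -/
noncomputable def headDeriv (r : ℝ) (t : Fin N → ℝ) : ℝ :=
  -((N + 1) * r ^ N + ∑ i : Fin N, t i * (((i : ℕ) + 1) * r ^ (i : ℕ)))

lemma hasDerivAt_headFun (r : ℝ) (t : Fin N → ℝ) :
    HasDerivAt (fun r => headFun r t) (headDeriv r t) r := by
  unfold headFun headDeriv
  refine HasDerivAt.neg (HasDerivAt.add ?_ (HasDerivAt.fun_sum fun i _ => ?_))
  · simpa using hasDerivAt_pow (N + 1) r
  · simpa using (hasDerivAt_pow ((i : ℕ) + 1) r).const_mul (t i)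

/-- The derivative of the constant coefficient with respect to the root, the others being fixed, is
minus the derivative of the polynomial at its root `r`, which is `r ^ N * Q 1`. -/
lemma abs_headDeriv_tailMap {r : ℝ} (b : Fin N → ℝ) :
    |headDeriv r (tailMap r b)| = |r| ^ N * |1 + ∑ i, b i| := by
  have h1 := hasDerivAt_headFun r (tailMap r b)
  set S : ℝ → ℝ := fun x => x ^ N + ∑ i : Fin N, r ^ (N - (i : ℕ)) * b i * x ^ (i : ℕ) with hS
  -- With the tail frozen at `r`, `headFun` is `-(x - r) * S x` up to a constant, so only `S r`
  -- survives in the derivative at `r`.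
  have hfun : (fun x => headFun x (tailMap r b)) =
      fun x => -((x - r) * S x + r ^ (N + 1) * (Fin.snoc b 1 : Fin (N + 1) → ℝ) 0) := by
    ext x
    rw [headFun, tailMap_identity]
  have hSd : DifferentiableAt ℝ S r := by fun_prop
  have h2 : HasDerivAt (fun x => -((x - r) * S x + r ^ (N + 1) * (Fin.snoc b 1 : Fin (N + 1) → ℝ) 0))
      (-(1 * S r + (r - r) * deriv S r)) r :=
    ((((hasDerivAt_id r).sub_const r).mul hSd.hasDerivAt).add_const _).neg
  rw [hfun] at h1
  rw [h1.unique h2, sub_self, zero_mul, add_zero, one_mul, abs_neg]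
  have : S r = r ^ N * (1 + ∑ i, b i) := by
    rw [hS, mul_add, mul_one, Finset.mul_sum]
    simp only
    congr 1
    refine Finset.sum_congr rfl fun i _ => ?_
    rw [mul_right_comm, ← pow_add, Nat.sub_add_cancel i.2.le]
  rw [this, abs_mul, abs_pow]

/-- Two changes of variables under Fubini: for fixed tail the constant coefficient is replaced by
the dominant root, and for fixed root the tail is replaced by the stable vector. The densities are
`|r| ^ N * |Q 1|` and `|r| ^ tri N`. -/
theorem volume_domSet (N : ℕ) : volume (domSet N) =
    (∫⁻ r in Set.Ioo (-1 : ℝ) 1, ENNReal.ofReal (|r| ^ (tri N + N))) * stableMoment 1 N := by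
  have hE := measurableSet_domRootTail N
  set F : ℝ × (Fin N → ℝ) → ℝ≥0∞ :=
    (domRootTail N).indicator fun p => ENNReal.ofReal |headDeriv p.1 p.2| with hF
  have hFm : Measurable F := by
    refine Measurable.indicator ?_ hE
    unfold headDeriv
    fun_prop
  have hsec : ∀ t, MeasurableSet {r : ℝ | (r, t) ∈ domRootTail N} := fun t =>
    (measurable_id.prodMk measurable_const) hE
  have h1 : volume (domSet N) = ∫⁻ t : Fin N → ℝ, ∫⁻ r : ℝ, F (r, t) := by
    rw [volume_eq_lintegral_cons_symm (measurableSet_domSet N)]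
    refine lintegral_congr fun t => ?_
    rw [section_domSet, ← setLIntegral_one, lintegral_image_eq_lintegral_abs_deriv_mul (hsec t)
      (fun r _ => (hasDerivAt_headFun r t).hasDerivWithinAt) (injOn_headFun t),
      ← lintegral_indicator (hsec t)]
    refine lintegral_congr fun r => ?_
    simp only [mul_one, hF]
    rfl
  rw [h1, lintegral_lintegral_swap (by exact (hFm.comp measurable_swap).aemeasurable),
    ← lintegral_mul_const _ (by fun_prop), ← lintegral_indicator measurableSet_Ioo]
  refine lintegral_congr_ae ?_
  have hne : ∀ᵐ r : ℝ, r ≠ 0 := by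
    rw [ae_iff]; simp
  filter_upwards [hne] with r hr
  have hGm : Measurable fun t => F (r, t) := hFm.comp (measurable_const.prodMk measurable_id)
  rw [lintegral_tailMap hr hGm]
  by_cases hk : r ∈ Set.Ioo (-1 : ℝ) 1
  · rw [Set.indicator_of_mem hk, pow_add, ENNReal.ofReal_mul (by positivity), mul_assoc, stableMoment,
      ← lintegral_const_mul _ (measurable_stableMoment 1 N)]
    congr 1
    refine lintegral_congr fun b => ?_
    by_cases hb : b ∈ stable N
    · rw [hF, Set.indicator_of_mem ((tailMap_mem_domRootTail hr).2 ⟨abs_lt.2 hk, hb⟩),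
        Set.indicator_of_mem hb, abs_headDeriv_tailMap, pow_one, ENNReal.ofReal_mul (by positivity)]
    · rw [hF, Set.indicator_of_notMem (fun h => hb ((tailMap_mem_domRootTail hr).1 h).2),
        Set.indicator_of_notMem hb, mul_zero]
  · rw [Set.indicator_of_notMem hk]
    have : ∀ b, F (r, tailMap r b) = 0 := fun b => by
      rw [hF, Set.indicator_of_notMem]
      exact fun h => hk (abs_lt.1 ((tailMap_mem_domRootTail hr).1 h).1)
    simp [this]

lemma lintegral_abs_pow (e : ℕ) : ∫⁻ r in Set.Ioo (-1 : ℝ) 1, ENNReal.ofReal (|r| ^ e) =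
    ENNReal.ofReal (2 / (e + 1)) := by
  rw [lintegral_Ioo_ofReal (by norm_num) (by fun_prop) (fun x _ => by positivity)]
  congr 1
  have h : ∀ a b : ℝ, IntervalIntegrable (fun x : ℝ => |x| ^ e) volume a b := fun a b =>
    Continuous.intervalIntegrable (by fun_prop) _ _
  have h1 : ∫ x in (0 : ℝ)..1, |x| ^ e = 1 / (e + 1) := by
    rw [intervalIntegral.integral_congr (g := fun x => x ^ e)]
    · simp
    · intro x hx
      rw [Set.uIcc_of_le zero_le_one] at hx
      simp only [abs_of_nonneg hx.1]
  have h2 : ∫ x in (-1 : ℝ)..0, |x| ^ e = 1 / (e + 1) := by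
    rw [← h1]
    have := intervalIntegral.integral_comp_neg (a := 0) (b := 1) fun x : ℝ => |x| ^ e
    simp only [abs_neg, neg_zero] at this
    exact this.symm
  rw [← intervalIntegral.integral_add_adjacent_intervals (h (-1) 0) (h 0 1), h1, h2]
  ring

lemma domSet_subset (N : ℕ) : domSet N ⊆ unitRegion (N + 1) HasDominant := by
  rintro _ ⟨⟨r, b⟩, h, rfl⟩
  have hn : ‖(r : ℂ)‖ = |r| := by rw [Complex.norm_real, Real.norm_eq_abs]
  refine ⟨fun z hz => ?_, r, self_mem_croots_domPoly r b, fun w hw hne => ?_⟩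
  · by_cases hne : z = r
    · rw [hne, hn]; exact h.2.1
    · exact (norm_lt_of_mem_croots_domPoly h hz hne).trans h.2.1
  · rw [hn]; exact norm_lt_of_mem_croots_domPoly h hw hne

lemma polyEval_injective {a b : Fin N → ℝ} (h : ∀ z, polyEval a z = polyEval b z) : a = b := by
  have h1 : (monicPoly fun i => (a i : ℂ)) = monicPoly fun i => (b i : ℂ) :=
    Polynomial.funext fun z => by rw [eval_monicPoly, eval_monicPoly]; exact h z
  funext i
  exact_mod_cast congrFun (monicPoly_injective h1) i

lemma exists_real_factor {a : Fin (N + 1) → ℝ} {r : ℝ} (h : (r : ℂ) ∈ croots a) :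
    ∃ q : Fin N → ℝ, (monicPoly fun i => (a i : ℂ)) =
      (Polynomial.X - Polynomial.C (r : ℂ)) * monicPoly fun i => (q i : ℂ) := by
  have hmap : ∀ {n : ℕ} (c : Fin n → ℝ),
      (monicPoly fun i => (c i : ℂ)) = (monicPoly c).map Complex.ofRealHom := fun c => by
    rw [map_monicPoly]; rfl
  have hroot : (monicPoly a).IsRoot r := by
    rw [mem_croots, eval_monicPoly] at h
    rw [Polynomial.IsRoot, eval_monicPoly]
    exact_mod_cast h
  obtain ⟨Q, hQ⟩ := Polynomial.dvd_iff_isRoot.2 hroot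
  have hm : Q.Monic := (Polynomial.monic_X_sub_C r).of_mul_monic_left (hQ ▸ monic_monicPoly a)
  have hd : Q.natDegree = N := by
    have h1 := congrArg Polynomial.natDegree hQ
    rw [natDegree_monicPoly, (Polynomial.monic_X_sub_C r).natDegree_mul hm,
      Polynomial.natDegree_X_sub_C] at h1
    omega
  refine ⟨fun i => Q.coeff i, ?_⟩
  rw [hmap a, hmap fun i : Fin N => Q.coeff i, monicPoly_coeff hm hd, hQ]
  simp

/-- The dominant root is real because its conjugate ties with it, and nonzero because the constant
coefficient is. Dividing it out and scaling the other roots by `1 / r` gives the stable factor. -/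
lemma mem_domSet_of_dominant {a : Fin (N + 1) → ℝ} {z : Fin (N + 1) → ℂ} (hz : IsRootList a z)
    (hg : IsGeneric z) (h0 : a 0 ≠ 0) (ha : a ∈ unitRegion (N + 1) HasDominant) : a ∈ domSet N := by
  obtain ⟨h1, w, hw, hdom⟩ := ha
  have hconj : (starRingEnd ℂ) w = w := by
    by_contra hne
    have := hdom _ (conj_mem_croots hw) hne
    rw [RCLike.norm_conj] at this
    exact lt_irrefl _ this
  obtain ⟨r, rfl⟩ := Complex.conj_eq_iff_real.1 hconj
  have hr0 : r ≠ 0 := by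
    rintro rfl
    apply h0
    have : polyEval a 0 = 0 := by
      rw [Complex.ofReal_zero] at hw; exact hw
    rw [polyEval, Fin.sum_univ_succ] at this
    simpa using this
  have hr0' : (r : ℂ) ≠ 0 := by exact_mod_cast hr0
  obtain ⟨q, hq⟩ := exists_real_factor hw
  obtain ⟨i, hi⟩ : ∃ i, z i = r := by
    have := hw
    rwa [hz.croots_eq] at this
  have hQ : (monicPoly fun i => (q i : ℂ)) =
      ∏ j : Fin N, (Polynomial.X - Polynomial.C (z (i.succAbove j))) := by
    refine mul_left_cancel₀ (Polynomial.X_sub_C_ne_zero (r : ℂ)) ?_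
    rw [← hq, show (monicPoly fun i => (a i : ℂ)) = _ from hz, Fin.prod_univ_succAbove _ i, hi]
  have heval : ∀ x : ℂ, polyEval a x = (x - r) * polyEval q x := fun x => by
    have := congrArg (Polynomial.eval x) hq
    rw [Polynomial.eval_mul, eval_monicPoly, eval_monicPoly] at this
    rw [polyEval, this, polyEval]
    simp
  -- Dominance only speaks of roots different from `r`; genericity excludes a multiple root at `r`.
  have hqr : polyEval q r ≠ 0 := by
    have := congrArg (Polynomial.eval (r : ℂ)) hQ
    rw [eval_monicPoly, Polynomial.eval_prod] at this
    rw [polyEval, this, Finset.prod_ne_zero_iff]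
    intro j _
    simp only [Polynomial.eval_sub, Polynomial.eval_X, Polynomial.eval_C]
    rw [← hi, sub_ne_zero]
    exact hg.injective _ _ (Fin.succAbove_ne i j).symm
  set b : Fin N → ℝ := fun i => q i / r ^ (N - (i : ℕ)) with hb
  have hbq : ∀ x : ℂ, x ^ N + ∑ i : Fin N, (r : ℂ) ^ (N - (i : ℕ)) * b i * x ^ (i : ℕ) =
      polyEval q x := fun x => by
    rw [polyEval]
    congr 1
    refine Finset.sum_congr rfl fun i _ => ?_
    rw [hb]
    push_cast
    rw [mul_div_cancel₀ _ (pow_ne_zero _ hr0')]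
  refine ⟨(r, b), ⟨hr0, ?_, fun x hx => ?_⟩, polyEval_injective fun x => ?_⟩
  · have := h1 _ hw
    rwa [Complex.norm_real, Real.norm_eq_abs] at this
  · have h2 := scaled_eval hr0 b (r * x)
    rw [hbq, mul_div_cancel_left₀ _ hr0', mem_croots_iff_polyEval.1 hx, mul_zero] at h2
    have h3 : (r : ℂ) * x ∈ croots a := by
      rw [mem_croots_iff_polyEval, heval, h2, mul_zero]
    have h4 : (r : ℂ) * x ≠ r := fun he => hqr (he ▸ h2)
    have h5 := hdom _ h3 h4
    rw [norm_mul] at h5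
    exact (mul_lt_iff_lt_one_right (norm_pos_iff.2 hr0')).1 h5
  · rw [polyEval_domPoly_eq, hbq, heval]

theorem volume_unitRegion_hasDominant (N : ℕ) :
    volume (unitRegion (N + 1) HasDominant) = ENNReal.ofReal (DPerron (N + 1)) := by
  obtain ⟨R, hR, hgen⟩ := exists_generic_polynomial (N + 1)
  -- The factor `X 0` also discards the null set of polynomials with a root at zero.
  have hX : R * MvPolynomial.X 0 ≠ 0 := mul_ne_zero hR (MvPolynomial.X_ne_zero 0)
  have h1 : volume (unitRegion (N + 1) HasDominant) = volume (domSet N) := by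
    refine le_antisymm ?_ (measure_mono (domSet_subset N))
    rw [← volume_unitRegion_eq hX]
    refine measure_mono fun a ha => ?_
    obtain ⟨z, hz⟩ := exists_isRootList a
    have h2 := ha.2
    rw [map_mul, MvPolynomial.eval_X, mul_ne_zero_iff] at h2
    exact mem_domSet_of_dominant hz (hgen a z hz h2.1) h2.2 ha.1
  rw [h1, volume_domSet, lintegral_abs_pow, stableMoment_order_one,
    ← ENNReal.ofReal_mul (by positivity)]
  congr 1
  have h2 : ((tri N + N : ℕ) : ℝ) + 1 = (N + 1) * (N + 2) / 2 := by
    have : (tri N + N + 1) * 2 = (N + 1) * (N + 2) := by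
      rw [add_assoc, ← tri_succ, tri]
      exact Nat.div_mul_cancel (Nat.even_mul_succ_self (N + 1)).two_dvd
    have h3 : ((tri N + N + 1 : ℕ) : ℝ) * 2 = (N + 1) * (N + 2) := by exact_mod_cast this
    push_cast at h3 ⊢
    linarith
  rw [h2]
  have h3 : ((N : ℝ) + 1) * (N + 2) ≠ 0 := by positivity
  field_simp
  ring

lemma DPerron_pos (hN : 1 ≤ N) : 0 < DPerron N := by
  have h := D_pos N
  have hN' : (0 : ℝ) < N := by exact_mod_cast hN
  rw [DPerron]
  split_ifs <;> positivity

theorem volume_unitRegion_true (N : ℕ) :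
    volume (unitRegion N fun _ => True) = ENNReal.ofReal (D N) := by
  have h : unitRegion N (fun _ => True) = stable N := by
    ext a; simp [unitRegion, stable]
  rw [h, ← stableMoment_order_zero, stableMoment]
  simp only [pow_zero, ENNReal.ofReal_one]
  rw [lintegral_indicator (isOpen_stable N).measurableSet, setLIntegral_one]

end Perron

end PerronCount

namespace PerronCount

open MeasureTheory
open scoped Topology ENNReal

/-! ### Integrals of symmetric functions over sorted tuples -/

section Symmetrization

lemma measurePreserving_comp_perm {ι α : Type*} [Fintype ι] [MeasurableSpace α] (μ : Measure α)
    [SigmaFinite μ] (σ : Equiv.Perm ι) :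
    MeasurePreserving (fun x : ι → α => x ∘ σ) (Measure.pi fun _ => μ) (Measure.pi fun _ => μ) := by
  convert! measurePreserving_piCongrLeft (fun _ : ι => μ) σ.symm using 1
  funext x i
  have := Equiv.piCongrLeft_apply_apply (fun _ : ι => α) σ.symm x (σ i)
  rw [Equiv.symm_apply_apply] at this
  rw [MeasurableEquiv.coe_piCongrLeft, this]
  rfl

variable {α : Type*} [NormedAddCommGroup α] [NormedSpace ℝ α] [FiniteDimensional ℝ α]
  [MeasureSpace α] [BorelSpace α] {n : ℕ}

lemma measurableSet_strictMono_comp {key : α →ₗ[ℝ] ℝ} :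
    MeasurableSet {x : Fin n → α | StrictMono (key ∘ x)} := by
  have hc : Continuous key := key.continuous_of_finiteDimensional
  have : {x : Fin n → α | StrictMono (key ∘ x)} =
      ⋂ i, ⋂ j, ⋂ _ : i < j, {x | key (x i) < key (x j)} := by
    ext x; simp [StrictMono]
  rw [this]
  refine MeasurableSet.iInter fun i => MeasurableSet.iInter fun j => MeasurableSet.iInter fun _ => ?_
  exact (isOpen_lt (by fun_prop) (by fun_prop)).measurableSet

variable [(volume : Measure α).IsAddHaarMeasure]

/-- Each coincidence of keys defines a proper linear subspace, a null set. -/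
lemma ae_injective_comp {key : α →ₗ[ℝ] ℝ} (hkey : key ≠ 0) :
    ∀ᵐ x : Fin n → α, Function.Injective (key ∘ x) := by
  have h : ∀ i j : Fin n, i ≠ j → ∀ᵐ x : Fin n → α, key (x i) ≠ key (x j) := by
    intro i j hij
    set s : Submodule ℝ (Fin n → α) :=
      LinearMap.ker (key.comp (LinearMap.proj i) - key.comp (LinearMap.proj j)) with hs
    have hmem : ∀ x, x ∈ s ↔ key (x i) = key (x j) := fun x => by
      simp [hs, sub_eq_zero]
    have hne : s ≠ ⊤ := by
      intro htop
      apply hkey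
      ext v
      have := (hmem (Pi.single i v)).1 (htop ▸ Submodule.mem_top)
      simpa [Pi.single_eq_of_ne hij.symm] using this
    rw [ae_iff]
    refine measure_mono_null (fun x hx => ?_) (Measure.addHaar_submodule volume s hne)
    exact (hmem x).2 (not_not.1 hx)
  have h2 : ∀ᵐ x : Fin n → α, ∀ i j : Fin n, i ≠ j → key (x i) ≠ key (x j) := by
    rw [ae_all_iff]; intro i
    rw [ae_all_iff]; intro j
    by_cases hij : i = j
    · exact ae_of_all _ fun x h => absurd hij h
    · filter_upwards [h i j hij] with x hx _ using hx
  filter_upwards [h2] with x hx i j hij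
  by_contra hne
  exact hx i j hne hij

/-- The integral of a symmetric function is `n!` times the integral over the sorted tuples. -/
theorem lintegral_eq_factorial_mul_sorted {key : α →ₗ[ℝ] ℝ} (hkey : key ≠ 0)
    {f : (Fin n → α) → ℝ≥0∞} (hf : Measurable f)
    (hsym : ∀ (σ : Equiv.Perm (Fin n)) x, f (x ∘ σ) = f x) :
    ∫⁻ x, f x = n.factorial * ∫⁻ x in {x | StrictMono (key ∘ x)}, f x := by
  classical
  set S : Set (Fin n → α) := {x | StrictMono (key ∘ x)} with hS
  have hSm : MeasurableSet S := measurableSet_strictMono_comp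
  -- When the keys are distinct, exactly one permutation sorts the tuple.
  have h1 : ∀ᵐ x : Fin n → α, f x = ∑ σ : Equiv.Perm (Fin n), S.indicator f (x ∘ σ) := by
    filter_upwards [ae_injective_comp (n := n) hkey] with x hx
    have hmono := Tuple.monotone_sort (key ∘ x)
    have hsort : x ∘ Tuple.sort (key ∘ x) ∈ S :=
      hmono.strictMono_of_injective (hx.comp (Equiv.injective _))
    rw [Finset.sum_eq_single (Tuple.sort (key ∘ x)), Set.indicator_of_mem hsort, hsym]
    · intro τ _ hτ
      refine Set.indicator_of_notMem (fun hmem => hτ ?_) _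
      have h2 : StrictMono ((key ∘ x) ∘ τ) := hmem
      have := Tuple.unique_monotone h2.monotone hmono
      ext i
      exact congrArg _ (hx (congrFun this i))
    · simp
  have hfS : Measurable (S.indicator f) := hf.indicator hSm
  have hfσ : ∀ σ : Equiv.Perm (Fin n), Measurable fun x : Fin n → α => S.indicator f (x ∘ σ) :=
    fun σ => hfS.comp (measurePreserving_comp_perm volume σ).measurable
  rw [lintegral_congr_ae h1, lintegral_finsetSum _ fun σ _ => hfσ σ]
  have h2 : ∀ σ : Equiv.Perm (Fin n), ∫⁻ x : Fin n → α, S.indicator f (x ∘ σ) = ∫⁻ x in S, f x :=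
    fun σ => by
      rw [← lintegral_indicator hSm]
      exact (measurePreserving_comp_perm volume σ).lintegral_comp hfS
  rw [Finset.sum_congr rfl fun σ _ => h2 σ, Finset.sum_const, Finset.card_univ, Fintype.card_perm,
    Fintype.card_fin, nsmul_eq_mul]

end Symmetrization

/-! ### Real roots as coordinates: the Jacobian is the Vandermonde product -/

section CoefficientMap

open Polynomial

lemma differentiable_coeff_prod {E ι : Type*} [NormedAddCommGroup E] [NormedSpace ℝ E]
    (s : Finset ι) {q : ι → E → ℝ[X]} (hq : ∀ k i, Differentiable ℝ fun x => (q k x).coeff i) (i : ℕ) :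
    Differentiable ℝ fun x => (∏ k ∈ s, q k x).coeff i := by
  classical
  induction s using Finset.induction_on generalizing i with
  | empty => simp
  | insert k s hk ih =>
    simp only [Finset.prod_insert hk, coeff_mul]
    exact Differentiable.fun_sum fun p _ => (hq k _).mul (ih _)

variable {N : ℕ}

/-- The coefficient vector of the monic polynomial with roots `x`. -/
noncomputable def rootCoef (x : Fin N → ℝ) (i : Fin N) : ℝ := (∏ j, (X - C (x j))).coeff i

lemma monicPoly_rootCoef (x : Fin N → ℝ) : monicPoly (rootCoef x) = ∏ j, (X - C (x j)) :=
  monicPoly_coeff (monic_prod_of_monic _ _ fun j _ => monic_X_sub_C _)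
    (by rw [natDegree_prod_of_monic _ _ fun j _ => monic_X_sub_C _]; simp)

lemma isRootList_rootCoef (x : Fin N → ℝ) : IsRootList (rootCoef x) fun i => (x i : ℂ) := by
  have h := congrArg (Polynomial.map Complex.ofRealHom) (monicPoly_rootCoef x)
  rw [map_monicPoly] at h
  rw [IsRootList]
  refine h.trans ?_
  simp [Polynomial.map_prod]

lemma differentiable_rootCoef : Differentiable ℝ (rootCoef : (Fin N → ℝ) → Fin N → ℝ) := by
  refine differentiable_pi.2 fun i => differentiable_coeff_prod _ (fun k j => ?_) _
  simp only [coeff_sub, coeff_C]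
  split_ifs <;> fun_prop

lemma eval_rootCoef (x : Fin N → ℝ) (y : ℝ) :
    y ^ N + ∑ i, rootCoef x i * y ^ (i : ℕ) = ∏ j, (y - x j) := by
  rw [← eval_monicPoly, monicPoly_rootCoef, eval_prod]; simp

/-- Differentiate `∏ (y - x j)` in `x` and put `y = x m`: every term still containing the factor `y
- x m` vanishes. The Vandermonde matrix thus makes the Jacobian diagonal. -/
lemma vandermonde_mulVec_fderiv_rootCoef (x v : Fin N → ℝ) (m : Fin N) :
    (Matrix.vandermonde x).mulVec (fderiv ℝ rootCoef x v) m =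
      (-∏ j ∈ {m}ᶜ, (x m - x j)) * v m := by
  set y := x m with hy
  have h1 : HasFDerivAt (fun x : Fin N → ℝ => y ^ N + ∑ i, rootCoef x i * y ^ (i : ℕ))
      (∑ i : Fin N, y ^ (i : ℕ) • (ContinuousLinearMap.proj i).comp (fderiv ℝ rootCoef x)) x := by
    refine HasFDerivAt.const_add _ (HasFDerivAt.fun_sum fun i _ => ?_)
    have := (hasFDerivAt_pi'.1 (differentiable_rootCoef x).hasFDerivAt) i
    exact this.mul_const _
  have hG : DifferentiableAt ℝ (fun x : Fin N → ℝ => ∏ j ∈ {m}ᶜ, (y - x j)) x := by fun_prop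
  have h2 : HasFDerivAt (fun x : Fin N → ℝ => (y - x m) * ∏ j ∈ {m}ᶜ, (y - x j))
      ((y - x m) • fderiv ℝ (fun x : Fin N → ℝ => ∏ j ∈ {m}ᶜ, (y - x j)) x +
        (∏ j ∈ {m}ᶜ, (y - x j)) • (-ContinuousLinearMap.proj (R := ℝ) m)) x :=
    ((hasFDerivAt_apply m x).const_sub y).mul hG.hasFDerivAt
  have h3 : (fun x : Fin N → ℝ => y ^ N + ∑ i, rootCoef x i * y ^ (i : ℕ)) =
      fun x => (y - x m) * ∏ j ∈ {m}ᶜ, (y - x j) := by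
    funext x
    rw [eval_rootCoef, ← Finset.prod_mul_prod_compl {m}, Finset.prod_singleton]
  rw [h3] at h1
  have h4 := congrArg (fun L => L v) (h1.unique h2)
  simp only [← hy, sub_self, zero_smul, zero_add, sum_apply,
    smul_apply, ContinuousLinearMap.comp_apply, ContinuousLinearMap.proj_apply,
    neg_apply, smul_eq_mul] at h4
  rw [Matrix.mulVec, dotProduct]
  simp only [Matrix.vandermonde_apply, ← hy]
  rw [h4]; ring

/-- The absolute value of the product of the differences. -/
noncomputable def absDisc (x : Fin N → ℝ) : ℝ := |(Matrix.vandermonde x).det|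

lemma prod_abs_sub_eq (x : Fin N → ℝ) : ∏ m, |∏ j ∈ {m}ᶜ, (x m - x j)| = absDisc x ^ 2 := by
  simp only [Finset.abs_prod]
  rw [← Finset.prod_prod_Ioi_mul_eq_prod_prod_off_diag fun j m => |x m - x j|, absDisc,
    Matrix.det_vandermonde, Finset.abs_prod, ← Finset.prod_pow]
  refine Finset.prod_congr rfl fun i _ => ?_
  rw [Finset.abs_prod, ← Finset.prod_pow]
  refine Finset.prod_congr rfl fun j _ => ?_
  rw [abs_sub_comm (x i) (x j), sq]

/-- The determinant of the diagonal matrix is, in absolute value, the square of the Vandermonde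
product; one factor cancels. -/
lemma abs_det_fderiv_rootCoef {x : Fin N → ℝ} (hx : Function.Injective x) :
    |(fderiv ℝ rootCoef x).det| = absDisc x := by
  have h1 : (Matrix.toLin' (Matrix.vandermonde x)).comp
      (fderiv ℝ rootCoef x : (Fin N → ℝ) →ₗ[ℝ] Fin N → ℝ) =
      Matrix.toLin' (Matrix.diagonal fun m => -∏ j ∈ {m}ᶜ, (x m - x j)) := by
    refine LinearMap.ext fun v => ?_
    funext m
    rw [Matrix.toLin'_apply, Matrix.mulVec_diagonal, ← vandermonde_mulVec_fderiv_rootCoef]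
    rfl
  have h2 := congrArg LinearMap.det h1
  rw [LinearMap.det_comp, LinearMap.det_toLin', LinearMap.det_toLin', Matrix.det_diagonal] at h2
  have h3 := congrArg abs h2
  rw [abs_mul, Finset.abs_prod] at h3
  simp only [abs_neg] at h3
  rw [prod_abs_sub_eq, sq] at h3
  have h4 : absDisc x ≠ 0 := abs_ne_zero.2 (Matrix.det_vandermonde_ne_zero_iff.2 hx)
  exact mul_left_cancel₀ h4 h3

lemma continuous_absDisc : Continuous (absDisc : (Fin N → ℝ) → ℝ) := by
  unfold absDisc
  simp only [Matrix.det_vandermonde]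
  fun_prop

lemma absDisc_comp_perm (σ : Equiv.Perm (Fin N)) (x : Fin N → ℝ) : absDisc (x ∘ σ) = absDisc x := by
  have : Matrix.vandermonde (x ∘ σ) = (Matrix.vandermonde x).submatrix σ id := by
    ext i j; simp [Matrix.vandermonde_apply]
  rw [absDisc, this, Matrix.det_permute, abs_mul]
  rcases Int.units_eq_one_or (Equiv.Perm.sign σ) with h | h <;> simp [absDisc, h]

/-- The cube in which the roots vary. -/
def cube (N : ℕ) : Set (Fin N → ℝ) := Set.univ.pi fun _ => Set.Ioo (-1) 1

lemma measurableSet_cube (N : ℕ) : MeasurableSet (cube N) :=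
  MeasurableSet.univ_pi fun _ => measurableSet_Ioo

lemma rootCoef_mem_unitRegion {x : Fin N → ℝ} (hx : x ∈ cube N) :
    rootCoef x ∈ unitRegion N AllReal := by
  have h := (isRootList_rootCoef x).croots_eq
  constructor
  · rintro z hz
    rw [h] at hz
    obtain ⟨i, rfl⟩ := hz
    simp only [Complex.norm_real, Real.norm_eq_abs]
    exact abs_lt.2 (hx i trivial)
  · rintro z hz
    rw [h] at hz
    obtain ⟨i, rfl⟩ := hz
    simp

lemma injOn_rootCoef : Set.InjOn (rootCoef : (Fin N → ℝ) → _) {x | StrictMono x} := by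
  intro x hx y hy h
  have h1 := (isRootList_rootCoef x).croots_eq
  rw [h, (isRootList_rootCoef y).croots_eq] at h1
  refine (StrictMono.range_inj hx hy).1 ?_
  ext t
  have h2 := Set.ext_iff.1 h1 (t : ℂ)
  simpa using h2.symm

lemma exists_strictMono_of_allReal {a : Fin N → ℝ} {z : Fin N → ℂ} (hz : IsRootList a z)
    (hg : IsGeneric z) (ha : a ∈ unitRegion N AllReal) :
    ∃ x : Fin N → ℝ, StrictMono x ∧ x ∈ cube N ∧ rootCoef x = a := by
  set u : Fin N → ℝ := fun i => (z i).re
  have hu : ∀ i, (u i : ℂ) = z i := fun i =>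
    Complex.ext rfl (by simpa using (ha.2 _ (hz.mem i)).symm)
  have huinj : Function.Injective u := fun i j hij => by
    by_contra hne
    exact hg.injective i j hne (by rw [← hu, ← hu, hij])
  have hperm := hz.comp_perm (Tuple.sort u)
  refine ⟨u ∘ Tuple.sort u, (Tuple.monotone_sort u).strictMono_of_injective
    (huinj.comp (Equiv.injective _)), fun i _ => ?_, ?_⟩
  · have := ha.1 _ (hz.mem (Tuple.sort u i))
    rw [← hu, Complex.norm_real, Real.norm_eq_abs] at this
    exact abs_lt.1 this
  · have h1 := isRootList_rootCoef (u ∘ Tuple.sort u)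
    rw [IsRootList] at h1 hperm
    simp only [Function.comp_apply, hu] at h1 hperm
    rw [← hperm] at h1
    funext i
    exact_mod_cast congrFun (monicPoly_injective h1) i

/-- The sorted root tuple is an injective coordinate on almost all of the region. Removing the
sorting condition costs `N!`. -/
theorem factorial_mul_volume_unitRegion_allReal (N : ℕ) :
    (N.factorial : ℝ≥0∞) * volume (unitRegion N AllReal) =
      ∫⁻ x in cube N, ENNReal.ofReal (absDisc x) := by
  obtain ⟨R, hR, hgen⟩ := exists_generic_polynomial N
  set S : Set (Fin N → ℝ) := {x | StrictMono (LinearMap.id (R := ℝ) ∘ x)} with hS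
  have hSm : MeasurableSet S := measurableSet_strictMono_comp
  have h1 : volume (unitRegion N AllReal) = volume (rootCoef '' (S ∩ cube N)) := by
    refine le_antisymm ?_ (measure_mono ?_)
    · rw [← volume_unitRegion_eq hR]
      refine measure_mono fun a ha => ?_
      obtain ⟨z, hz⟩ := exists_isRootList a
      obtain ⟨x, hx, hx2, rfl⟩ := exists_strictMono_of_allReal hz (hgen a z hz ha.2) ha.1
      exact ⟨x, ⟨hx, hx2⟩, rfl⟩
    · rintro _ ⟨x, hx, rfl⟩
      exact rootCoef_mem_unitRegion hx.2
  have h2 : volume (rootCoef '' (S ∩ cube N)) =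
      ∫⁻ x in S, (cube N).indicator (fun x => ENNReal.ofReal (absDisc x)) x := by
    rw [setLIntegral_indicator (measurableSet_cube N), Set.inter_comm,
      ← lintegral_abs_det_fderiv_eq_addHaar_image volume ((measurableSet_cube N).inter hSm)
      (fun x _ => (differentiable_rootCoef x).hasFDerivAt.hasFDerivWithinAt)
      (injOn_rootCoef.mono fun x hx => hx.2)]
    refine setLIntegral_congr_fun ((measurableSet_cube N).inter hSm) fun x hx => ?_
    rw [abs_det_fderiv_rootCoef (x := x) (StrictMono.injective hx.2)]
  have hid : (LinearMap.id : ℝ →ₗ[ℝ] ℝ) ≠ 0 := fun h => one_ne_zero (congrArg (fun L => L 1) h)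
  rw [h1, h2, ← lintegral_eq_factorial_mul_sorted hid]
  · rw [lintegral_indicator (measurableSet_cube N)]
  · exact (ENNReal.measurable_ofReal.comp continuous_absDisc.measurable).indicator
      (measurableSet_cube N)
  · intro σ x
    have : x ∘ σ ∈ cube N ↔ x ∈ cube N := by
      simp only [cube, Set.mem_univ_pi, Function.comp_apply]
      exact ⟨fun h i => by simpa using h (σ.symm i), fun h i => h _⟩
    by_cases hx : x ∈ cube N
    · rw [Set.indicator_of_mem hx, Set.indicator_of_mem (this.2 hx), absDisc_comp_perm]
    · rw [Set.indicator_of_notMem hx, Set.indicator_of_notMem (mt this.1 hx)]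

end CoefficientMap

end PerronCount

namespace PerronCount

open MeasureTheory
open scoped Topology ENNReal

/-! ### A Selberg integral on the cube by Aomoto's method -/

section SelbergIntegral

variable {n : ℕ}

/-- Lebesgue measure on the cube of side length two centred at the origin. -/
noncomputable def cubeMeasure (n : ℕ) : Measure (Fin n → ℝ) :=
  Measure.pi fun _ => volume.restrict (Set.Ioc (-1 : ℝ) 1)

lemma cubeMeasure_eq_restrict (n : ℕ) :
    cubeMeasure n = volume.restrict (Set.univ.pi fun _ : Fin n => Set.Ioc (-1 : ℝ) 1) :=
  (Measure.restrict_pi_pi (fun _ : Fin n => (volume : Measure ℝ)) fun _ => Set.Ioc (-1 : ℝ) 1).symm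

lemma ae_mem_cubeMeasure (n : ℕ) : ∀ᵐ x ∂cubeMeasure n, ∀ i, x i ∈ Set.Ioc (-1 : ℝ) 1 := by
  rw [cubeMeasure_eq_restrict]
  filter_upwards [ae_restrict_mem (MeasurableSet.univ_pi fun _ => measurableSet_Ioc)] with x hx i
  exact hx i trivial

lemma integrable_cubeMeasure {f : (Fin n → ℝ) → ℝ} (hf : Continuous f) :
    Integrable f (cubeMeasure n) := by
  rw [cubeMeasure_eq_restrict]
  refine (hf.continuousOn.integrableOn_compact
    (isCompact_univ_pi fun _ => isCompact_Icc (a := (-1 : ℝ)) (b := 1))).mono_set ?_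
  exact Set.pi_mono fun _ _ => Set.Ioc_subset_Icc_self

lemma integral_cubeMeasure_comp_perm (σ : Equiv.Perm (Fin n)) (f : (Fin n → ℝ) → ℝ) :
    ∫ x, f (x ∘ σ) ∂cubeMeasure n = ∫ x, f x ∂cubeMeasure n := by
  refine (measurePreserving_comp_perm (volume.restrict (Set.Ioc (-1 : ℝ) 1)) σ).integral_comp ?_ f
  refine Measurable.measurableEmbedding (measurePreserving_comp_perm volume σ).measurable ?_
  intro x y h
  funext i
  simpa using congrFun h (σ.symm i)

lemma integral_cubeMeasure_cons {f : (Fin (n + 1) → ℝ) → ℝ} (hf : Integrable f (cubeMeasure (n + 1))) :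
    ∫ x, f x ∂cubeMeasure (n + 1) =
      ∫ y, (∫ t in (-1 : ℝ)..1, f (Fin.cons t y)) ∂cubeMeasure n := by
  set μ : Measure ℝ := volume.restrict (Set.Ioc (-1 : ℝ) 1)
  have hmp : MeasurePreserving (fun p : ℝ × (Fin n → ℝ) => (Fin.cons p.1 p.2 : Fin (n + 1) → ℝ))
      (μ.prod (cubeMeasure n)) (cubeMeasure (n + 1)) := by
    have := (measurePreserving_piFinSuccAbove (fun _ : Fin (n + 1) => μ) 0).symm
    convert! this using 1
    ext p i
    simp [MeasurableEquiv.piFinSuccAbove, Fin.insertNthEquiv]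
  have hemb : MeasurableEmbedding
      fun p : ℝ × (Fin n → ℝ) => (Fin.cons p.1 p.2 : Fin (n + 1) → ℝ) := by
    refine Measurable.measurableEmbedding hmp.measurable ?_
    rintro ⟨a, b⟩ ⟨c, d⟩ h
    obtain ⟨h1, h2⟩ := Fin.cons_inj.1 h
    exact Prod.ext h1 h2
  have : SFinite (cubeMeasure n) := by unfold cubeMeasure; infer_instance
  rw [← hmp.integral_comp hemb, integral_prod_symm]
  · refine integral_congr_ae (ae_of_all _ fun y => ?_)
    simp only
    rw [intervalIntegral.integral_of_le (by norm_num)]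
  · exact (hmp.integrable_comp_emb hemb).2 hf

lemma absDisc_nonneg (x : Fin n → ℝ) : 0 ≤ absDisc x := abs_nonneg _

lemma absDisc_cons (t : ℝ) (y : Fin n → ℝ) :
    absDisc (Fin.cons t y : Fin (n + 1) → ℝ) = (∏ j, |y j - t|) * absDisc y := by
  rw [absDisc, Matrix.det_vandermonde, Fin.prod_univ_succ, Fin.prod_Ioi_zero, abs_mul,
    Finset.abs_prod, absDisc, Matrix.det_vandermonde]
  congr 2
  refine Finset.prod_congr rfl fun i _ => ?_
  rw [Fin.prod_Ioi_succ]
  simp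

lemma absDisc_eq_zero {x : Fin n → ℝ} {i j : Fin n} (hij : i ≠ j) (h : x i = x j) :
    absDisc x = 0 := by
  rw [absDisc, abs_eq_zero]
  by_contra hne
  exact hij (Matrix.det_vandermonde_ne_zero_iff.1 hne h)

/-- The denominator cancels one factor of the product. At `t = y j` the quotient is zero by
convention, so the bound holds there as well. -/
lemma abs_prod_div_le (y : Fin n → ℝ) (t : ℝ) (j : Fin n) :
    |(∏ l, |y l - t|) / (t - y j)| ≤ ∏ l ∈ {j}ᶜ, |y l - t| := by
  have h0 : 0 ≤ ∏ l ∈ {j}ᶜ, |y l - t| := Finset.prod_nonneg fun _ _ => abs_nonneg _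
  rw [← Finset.prod_mul_prod_compl {j}, Finset.prod_singleton, abs_div, abs_mul, abs_abs,
    abs_of_nonneg h0, abs_sub_comm (y j) t, mul_div_right_comm]
  exact mul_le_of_le_one_left h0 (div_self_le_one _)

lemma abs_absDisc_div_le (x : Fin (n + 1) → ℝ) (j : Fin n) :
    |absDisc x / (x 0 - x j.succ)| ≤
      (∏ l ∈ {j}ᶜ, |Fin.tail x l - x 0|) * absDisc (Fin.tail x) := by
  conv_lhs => rw [← Fin.cons_self_tail x, absDisc_cons, Fin.cons_zero, Fin.cons_succ]
  rw [mul_div_right_comm, abs_mul, abs_of_nonneg (absDisc_nonneg _)]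
  exact mul_le_mul_of_nonneg_right (abs_prod_div_le _ _ _) (absDisc_nonneg _)

lemma integrable_mul_absDisc_div {ψ : (Fin (n + 1) → ℝ) → ℝ} (hψ : Continuous ψ) (j : Fin n) :
    Integrable (fun x => ψ x * (absDisc x / (x 0 - x j.succ))) (cubeMeasure (n + 1)) := by
  have hw := continuous_absDisc (N := n + 1)
  have htail : Continuous fun x : Fin (n + 1) → ℝ => absDisc (Fin.tail x) := by
    refine continuous_absDisc.comp (continuous_pi fun i => ?_)
    exact continuous_apply _
  have hc : Continuous fun x : Fin (n + 1) → ℝ =>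
      |ψ x| * ((∏ l ∈ {j}ᶜ, |Fin.tail x l - x 0|) * absDisc (Fin.tail x)) := by
    unfold Fin.tail at htail ⊢
    fun_prop
  refine (integrable_cubeMeasure hc).mono' ?_ (ae_of_all _ fun x => ?_)
  · refine Measurable.aestronglyMeasurable ?_
    have := hw.measurable
    have := hψ.measurable
    fun_prop
  · rw [Real.norm_eq_abs, abs_mul]
    exact mul_le_mul_of_nonneg_left (abs_absDisc_div_le x j) (abs_nonneg _)

lemma hasDerivAt_abs_sub {c t : ℝ} (h : t ≠ c) :
    HasDerivAt (fun t => |c - t|) (|c - t| / (t - c)) t := by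
  have h1 : c - t ≠ 0 := sub_ne_zero.2 h.symm
  have h2 : t - c ≠ 0 := sub_ne_zero.2 h
  have := (hasDerivAt_abs h1).comp t ((hasDerivAt_id t).const_sub c)
  convert! this using 1
  rw [div_eq_iff h2]
  rcases lt_or_gt_of_ne h1 with h3 | h3
  · simp [abs_of_neg h3, sign_neg h3]
  · simp [abs_of_pos h3, sign_pos h3]

/-- The fundamental theorem of calculus for `φ t * ∏ |y l - t|`, which is continuous and
differentiable outside the finite set of the `y l`. The derivative of `|c - t|` is written as a
quotient so that all terms carry the full product. -/
lemma integral_deriv_mul_prod_abs {φ φ' : ℝ → ℝ} (hφ : ∀ t, HasDerivAt φ (φ' t) t)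
    (hφ' : Continuous φ') (y : Fin n → ℝ) :
    ∫ t in (-1 : ℝ)..1, (φ' t * (∏ l, |y l - t|) +
        ∑ j, φ t * ((∏ l, |y l - t|) / (t - y j))) =
      φ 1 * (∏ l, |y l - 1|) - φ (-1) * (∏ l, |y l - -1|) := by
  have hφc : Continuous φ := continuous_iff_continuousAt.2 fun t => (hφ t).continuousAt
  refine integral_eq_of_hasDerivAt_off_countable (fun t => φ t * ∏ l, |y l - t|) _
    (s := Set.range y) (Set.countable_range y) (by fun_prop) ?_ ?_
  · rintro t ⟨-, ht⟩
    have hne : ∀ j, t ≠ y j := fun j h => ht ⟨j, h.symm⟩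
    have h1 := (hφ t).mul (HasDerivAt.fun_finsetProd (u := Finset.univ)
      fun j _ => hasDerivAt_abs_sub (hne j))
    convert! h1 using 1
    rw [Finset.mul_sum]
    congr 1
    refine Finset.sum_congr rfl fun j _ => ?_
    rw [← Finset.prod_erase_mul _ _ (Finset.mem_univ j), smul_eq_mul, mul_div_assoc]
  · refine IntervalIntegrable.add (Continuous.intervalIntegrable (by fun_prop) _ _) ?_
    have hj : ∀ j ∈ (Finset.univ : Finset (Fin n)), IntervalIntegrable
        (fun t => φ t * ((∏ l, |y l - t|) / (t - y j))) volume (-1) 1 := fun j _ => by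
      have hc : Continuous fun t => |φ t| * ∏ l ∈ {j}ᶜ, |y l - t| := by fun_prop
      refine (hc.intervalIntegrable (-1) 1).mono_fun' ?_ (ae_of_all _ fun t => ?_)
      · refine Measurable.aestronglyMeasurable ?_
        have := hφc.measurable
        fun_prop
      · simp only
        rw [Real.norm_eq_abs, abs_mul]
        exact mul_le_mul_of_nonneg_left (abs_prod_div_le y t j) (abs_nonneg _)
    have h2 := IntervalIntegrable.sum Finset.univ hj
    simpa only [Finset.sum_fn] using h2

/-- Integration by parts in the first variable. -/
lemma integral_parts {φ φ' : ℝ → ℝ} (hφ : ∀ t, HasDerivAt φ (φ' t) t) (hφ' : Continuous φ')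
    {g : (Fin n → ℝ) → ℝ} (hg : Continuous g) :
    ∫ x, φ' (x 0) * g (Fin.tail x) * absDisc x ∂cubeMeasure (n + 1) +
      ∑ j : Fin n, ∫ x, φ (x 0) * g (Fin.tail x) * (absDisc x / (x 0 - x j.succ))
        ∂cubeMeasure (n + 1) =
    ∫ y, g y * (φ 1 * absDisc (Fin.cons 1 y : Fin (n + 1) → ℝ) -
      φ (-1) * absDisc (Fin.cons (-1) y : Fin (n + 1) → ℝ)) ∂cubeMeasure n := by
  have hφc : Continuous φ := continuous_iff_continuousAt.2 fun t => (hφ t).continuousAt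
  have hw := continuous_absDisc (N := n + 1)
  have hgt : Continuous fun x : Fin (n + 1) → ℝ => g (Fin.tail x) :=
    hg.comp (continuous_pi fun i => continuous_apply _)
  have hi1 : Integrable (fun x : Fin (n + 1) → ℝ => φ' (x 0) * g (Fin.tail x) * absDisc x)
      (cubeMeasure (n + 1)) := integrable_cubeMeasure (by fun_prop)
  have hi2 : ∀ j : Fin n, Integrable (fun x : Fin (n + 1) → ℝ =>
      φ (x 0) * g (Fin.tail x) * (absDisc x / (x 0 - x j.succ))) (cubeMeasure (n + 1)) :=
    fun j => integrable_mul_absDisc_div (by fun_prop) j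
  rw [← integral_finsetSum _ fun j _ => hi2 j,
    ← integral_add hi1 (integrable_finsetSum _ fun j _ => hi2 j)]
  refine (integral_cubeMeasure_cons (hi1.add (integrable_finsetSum _ fun j _ => hi2 j))).trans ?_
  refine integral_congr_ae (ae_of_all _ fun y => ?_)
  have h := integral_deriv_mul_prod_abs hφ hφ' y
  simp only [Pi.add_apply, Fin.cons_zero, Fin.tail_cons, Fin.cons_succ, absDisc_cons]
  have h2 : g y * absDisc y * (φ 1 * (∏ l, |y l - 1|) - φ (-1) * (∏ l, |y l - -1|)) =
      g y * (φ 1 * ((∏ l, |y l - 1|) * absDisc y) - φ (-1) * ((∏ l, |y l - -1|) * absDisc y)) := by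
    ring
  rw [← h2, ← h, ← intervalIntegral.integral_const_mul]
  refine intervalIntegral.integral_congr fun t _ => ?_
  rw [mul_add, Finset.mul_sum]
  congr 1
  · ring
  · refine Finset.sum_congr rfl fun j _ => ?_
    ring

/-- The factor `absDisc x / (x 0 - x j.succ)` changes sign when the two variables are swapped, so
only the antisymmetric part of `ψ` matters, and that part is divisible by `x 0 - x j.succ`. -/
lemma integral_antisymm {ψ θ : (Fin (n + 1) → ℝ) → ℝ} (hψ : Continuous ψ) (j : Fin n)
    (h : ∀ x, ψ x - ψ (x ∘ Equiv.swap 0 j.succ) = (x 0 - x j.succ) * θ x) :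
    ∫ x, ψ x * (absDisc x / (x 0 - x j.succ)) ∂cubeMeasure (n + 1) =
      1 / 2 * ∫ x, θ x * absDisc x ∂cubeMeasure (n + 1) := by
  have hσ : Continuous fun x : Fin (n + 1) → ℝ => ψ (x ∘ Equiv.swap 0 j.succ) :=
    hψ.comp (continuous_pi fun i => continuous_apply _)
  have h1 : ∫ x, ψ x * (absDisc x / (x 0 - x j.succ)) ∂cubeMeasure (n + 1) =
      -∫ x, ψ (x ∘ Equiv.swap 0 j.succ) * (absDisc x / (x 0 - x j.succ)) ∂cubeMeasure (n + 1) := by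
    rw [← integral_cubeMeasure_comp_perm (Equiv.swap 0 j.succ), ← integral_neg]
    refine integral_congr_ae (ae_of_all _ fun x => ?_)
    simp only [absDisc_comp_perm, Function.comp_apply, Equiv.swap_apply_left,
      Equiv.swap_apply_right]
    rw [← neg_sub (x 0) (x j.succ), div_neg, mul_neg]
  have h2 : ∫ x, θ x * absDisc x ∂cubeMeasure (n + 1) =
      ∫ x, ψ x * (absDisc x / (x 0 - x j.succ)) ∂cubeMeasure (n + 1) -
      ∫ x, ψ (x ∘ Equiv.swap 0 j.succ) * (absDisc x / (x 0 - x j.succ)) ∂cubeMeasure (n + 1) := by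
    rw [← integral_sub (integrable_mul_absDisc_div hψ j) (integrable_mul_absDisc_div hσ j)]
    refine integral_congr_ae (ae_of_all _ fun x => ?_)
    simp only
    rw [← sub_mul, h]
    -- On the diagonal the quotient is zero by convention; `absDisc` vanishes there too, so no
    -- exceptional set is needed.
    by_cases hx : x 0 = x j.succ
    · rw [absDisc_eq_zero (Fin.succ_ne_zero j).symm hx]; simp
    · have := sub_ne_zero.2 hx
      field_simp
  rw [h2]
  linarith

/-- The integral of `∏ i ∈ s, (1 + x i)` against the product of the differences. -/
noncomputable def discMoment (s : Finset (Fin n)) : ℝ :=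
  ∫ x, (∏ i ∈ s, (1 + x i)) * absDisc x ∂cubeMeasure n

lemma discMoment_map (σ : Equiv.Perm (Fin n)) (s : Finset (Fin n)) :
    discMoment (s.map σ.toEmbedding) = discMoment s := by
  rw [discMoment, discMoment,
    ← integral_cubeMeasure_comp_perm σ fun x => (∏ i ∈ s, (1 + x i)) * absDisc x]
  simp [absDisc_comp_perm]

lemma integral_discMoment_combination (a b c : ℝ) (s t u : Finset (Fin n)) :
    ∫ x, (a * (∏ i ∈ s, (1 + x i)) + b * (∏ i ∈ t, (1 + x i)) + c * (∏ i ∈ u, (1 + x i))) *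
      absDisc x ∂cubeMeasure n = a * discMoment s + b * discMoment t + c * discMoment u := by
  have hw := continuous_absDisc (N := n)
  have hi : ∀ (a : ℝ) (s : Finset (Fin n)), Integrable
      (fun x => a * ((∏ i ∈ s, (1 + x i)) * absDisc x)) (cubeMeasure n) := fun a s =>
    integrable_cubeMeasure (by fun_prop)
  rw [discMoment, discMoment, discMoment, ← integral_const_mul, ← integral_const_mul,
    ← integral_const_mul, ← integral_add (hi _ _) (hi _ _), ← integral_add _ (hi _ _)]
  · refine integral_congr_ae (ae_of_all _ fun x => ?_)
    simp only
    ring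
  · exact (hi _ _).add (hi _ _)

/-- Aomoto's recursion: integrate by parts with `(1 + t) * (1 - t)`, whose boundary terms vanish.
Antisymmetrization turns each term of the logarithmic derivative back into moments of the same kind,
one rule for `j ∈ s` and another for `j ∉ s`. -/
lemma discMoment_insert_zero (s : Finset (Fin n)) :
    discMoment (insert 0 (s.map (Fin.succEmb n))) * (2 * n + 4 - s.card) =
      2 * discMoment (s.map (Fin.succEmb n)) * (n + 2 - s.card) := by
  set s' : Finset (Fin (n + 1)) := s.map (Fin.succEmb n) with hs'
  have h0 : (0 : Fin (n + 1)) ∉ s' := by simp [hs']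
  set G : (Fin (n + 1) → ℝ) → ℝ := fun x => ∏ i ∈ s', (1 + x i) with hG
  have hGt : ∀ x, ∏ i ∈ s, (1 + Fin.tail x i) = G x := fun x => by simp [hG, hs', Fin.tail]
  have hparts := integral_parts (n := n) (φ := fun t => (1 + t) * (1 - t)) (φ' := fun t => -2 * t)
    (fun t => by
      have := ((hasDerivAt_id t).const_add 1).mul ((hasDerivAt_id t).const_sub 1)
      convert! this using 1
      simp; ring) (by fun_prop) (g := fun y => ∏ i ∈ s, (1 + y i)) (by fun_prop)
  simp only [hGt] at hparts
  have hbdry : ∀ y : Fin n → ℝ, (∏ i ∈ s, (1 + y i)) *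
      ((1 + 1) * (1 - 1) * absDisc (Fin.cons 1 y : Fin (n + 1) → ℝ) -
        (1 + -1) * (1 - -1) * absDisc (Fin.cons (-1) y : Fin (n + 1) → ℝ)) = 0 := fun y => by ring
  simp only [hbdry, integral_zero] at hparts
  have hins : ∀ x : Fin (n + 1) → ℝ, ∏ i ∈ insert 0 s', (1 + x i) = (1 + x 0) * G x := fun x =>
    Finset.prod_insert h0
  have hfirst : ∫ x, -2 * x 0 * G x * absDisc x ∂cubeMeasure (n + 1) =
      2 * discMoment s' + (-2) * discMoment (insert 0 s') + 0 * discMoment s' := by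
    rw [← integral_discMoment_combination]
    refine integral_congr_ae (ae_of_all _ fun x => ?_)
    simp only [hins]
    ring
  -- Swapping fixes `G`, and the antisymmetric part is `-(x 0 + x j.succ) * G`, rewritten through `1
  -- + x 0` and `1 + x j.succ`.
  have hnot : ∀ j ∉ s, ∫ x, (1 + x 0) * (1 - x 0) * G x * (absDisc x / (x 0 - x j.succ))
      ∂cubeMeasure (n + 1) = discMoment s' - discMoment (insert 0 s') := by
    intro j hj
    have hj' : j.succ ∉ s' := by simpa [hs'] using hj
    have hfix : ∀ i ∈ s', Equiv.swap 0 j.succ i = i := fun i hi =>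
      Equiv.swap_apply_of_ne_of_ne (fun h => h0 (h ▸ hi)) (fun h => hj' (h ▸ hi))
    have hGs : ∀ x : Fin (n + 1) → ℝ, G (x ∘ Equiv.swap 0 j.succ) = G x := fun x =>
      Finset.prod_congr rfl fun i hi => by rw [Function.comp_apply, hfix i hi]
    have hmap : discMoment (insert j.succ s') = discMoment (insert 0 s') := by
      rw [← discMoment_map (Equiv.swap 0 j.succ) (insert 0 s')]
      have hs : s'.map (Equiv.swap 0 j.succ).toEmbedding = s' := by
        ext i
        rw [Finset.mem_map_equiv, Equiv.symm_swap]
        constructor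
        · intro hi
          have := hfix _ hi
          rw [Equiv.swap_apply_self] at this
          rw [this]; exact hi
        · intro hi; rw [hfix i hi]; exact hi
      rw [Finset.map_insert, hs]
      simp
    rw [integral_antisymm (θ := fun x => 2 * (∏ i ∈ s', (1 + x i)) +
      (-1) * (∏ i ∈ insert 0 s', (1 + x i)) + (-1) * (∏ i ∈ insert j.succ s', (1 + x i)))
      (by fun_prop) j, integral_discMoment_combination, hmap]
    · ring
    · intro x
      rw [hGs, hins, Finset.prod_insert hj']
      simp only [Function.comp_apply, Equiv.swap_apply_left]
      change _ = (x 0 - x j.succ) * (2 * G x + -1 * ((1 + x 0) * G x) + -1 * ((1 + x j.succ) * G x))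
      ring
  -- Here `(1 + x 0) * (1 + x j.succ)` is a common symmetric factor, and only `1 - x 0` is
  -- antisymmetrized.
  have hmem : ∀ j ∈ s, ∫ x, (1 + x 0) * (1 - x 0) * G x * (absDisc x / (x 0 - x j.succ))
      ∂cubeMeasure (n + 1) = -(1 / 2) * discMoment (insert 0 s') := by
    intro j hj
    have hj' : j.succ ∈ s' := by simpa [hs'] using hj
    have hGe : ∀ x : Fin (n + 1) → ℝ, G x = (1 + x j.succ) * ∏ i ∈ s'.erase j.succ, (1 + x i) :=
      fun x => (Finset.mul_prod_erase _ _ hj').symm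
    have hfix : ∀ i ∈ s'.erase j.succ, Equiv.swap 0 j.succ i = i := fun i hi =>
      Equiv.swap_apply_of_ne_of_ne (fun h => h0 (h ▸ Finset.mem_of_mem_erase hi))
        (Finset.ne_of_mem_erase hi)
    rw [integral_antisymm (θ := fun x => (-1) * (∏ i ∈ insert 0 s', (1 + x i)) +
      0 * (∏ i ∈ s', (1 + x i)) + 0 * (∏ i ∈ s', (1 + x i)))
      (by fun_prop) j, integral_discMoment_combination]
    · ring
    · intro x
      have hp : ∏ i ∈ s'.erase j.succ, (1 + (x ∘ Equiv.swap 0 j.succ) i) =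
          ∏ i ∈ s'.erase j.succ, (1 + x i) :=
        Finset.prod_congr rfl fun i hi => by rw [Function.comp_apply, hfix i hi]
      rw [hins, hGe (x ∘ _), hp, hGe x]
      simp only [Function.comp_apply, Equiv.swap_apply_left, Equiv.swap_apply_right]
      ring
  rw [hfirst, ← Finset.sum_add_sum_compl s, Finset.sum_congr rfl hmem,
    Finset.sum_congr rfl fun j hj => hnot j (Finset.mem_compl.1 hj), Finset.sum_const,
    Finset.sum_const, Finset.card_compl, Fintype.card_fin, nsmul_eq_mul, nsmul_eq_mul,
    Nat.cast_sub (by simpa using s.card_le_univ)] at hparts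
  linarith

/-- The moments depend only on the cardinality of the set, so the new index may be moved to `0`. -/
lemma discMoment_insert {p : Fin n} {s : Finset (Fin n)} (hp : p ∉ s) :
    discMoment (insert p s) * (2 * n + 2 - s.card) = 2 * discMoment s * (n + 1 - s.card) := by
  obtain ⟨m, rfl⟩ : ∃ m, n = m + 1 := ⟨n - 1, by have := p.2; omega⟩
  set σ := Equiv.swap 0 p with hσ
  have h0 : (0 : Fin (m + 1)) ∉ s.map σ.toEmbedding := by
    rw [Finset.mem_map_equiv, hσ, Equiv.symm_swap, Equiv.swap_apply_left]; exact hp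
  obtain ⟨t, ht⟩ : ∃ t : Finset (Fin m), t.map (Fin.succEmb m) = s.map σ.toEmbedding := by
    refine ⟨Finset.univ.filter fun j => j.succ ∈ s.map σ.toEmbedding, ?_⟩
    ext i
    refine Fin.cases ?_ (fun j => ?_) i
    · simpa using h0
    · simp
  have h1 := discMoment_insert_zero t
  have hc : t.card = s.card := by
    have := congrArg Finset.card ht
    simpa using this
  have h2 : insert 0 (s.map σ.toEmbedding) = (insert p s).map σ.toEmbedding := by
    rw [Finset.map_insert]; simp [hσ]
  rw [ht, h2, discMoment_map, discMoment_map, hc] at h1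
  push_cast
  linarith

lemma discMoment_mul_prod (s : Finset (Fin n)) :
    discMoment s * ∏ c ∈ Finset.range s.card, (2 * n + 2 - c : ℝ) =
      discMoment (∅ : Finset (Fin n)) * ∏ c ∈ Finset.range s.card, (2 * (n + 1 - c) : ℝ) := by
  induction s using Finset.induction_on with
  | empty => simp
  | insert p s hp ih =>
    rw [Finset.card_insert_of_notMem hp, Finset.prod_range_succ, Finset.prod_range_succ]
    linear_combination (∏ c ∈ Finset.range s.card, (2 * n + 2 - c : ℝ)) * discMoment_insert hp +
      (2 * (n + 1 - s.card)) * ih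

lemma discMoment_univ (n : ℕ) : discMoment (Finset.univ : Finset (Fin n)) * (2 * n + 2).factorial =
    discMoment (∅ : Finset (Fin n)) * (2 ^ n * (n + 1).factorial * (n + 2).factorial) := by
  have h := discMoment_mul_prod (Finset.univ : Finset (Fin n))
  rw [Finset.card_univ, Fintype.card_fin] at h
  have h1 : ∏ c ∈ Finset.range n, (2 * n + 2 - c : ℝ) = ((2 * n + 2).descFactorial n : ℝ) := by
    rw [Nat.descFactorial_eq_prod_range, Nat.cast_prod]
    refine Finset.prod_congr rfl fun c hc => ?_
    rw [Finset.mem_range] at hc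
    rw [Nat.cast_sub (by omega)]; push_cast; ring
  have h2 : ∏ c ∈ Finset.range n, (2 * (n + 1 - c) : ℝ) = 2 ^ n * ((n + 1).factorial : ℝ) := by
    rw [Finset.prod_mul_distrib, Finset.prod_const, Finset.card_range]
    congr 1
    have h3 := Nat.factorial_mul_descFactorial (Nat.le_succ n)
    rw [Nat.succ_sub (le_refl n), Nat.sub_self, Nat.factorial_one, one_mul] at h3
    rw [← h3, Nat.descFactorial_eq_prod_range, Nat.cast_prod]
    refine Finset.prod_congr rfl fun c hc => ?_
    rw [Finset.mem_range] at hc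
    rw [Nat.cast_sub (by omega)]; push_cast; ring
  have h4 : ((n + 2).factorial : ℝ) * (2 * n + 2).descFactorial n = (2 * n + 2).factorial := by
    have := Nat.factorial_mul_descFactorial (show n ≤ 2 * n + 2 by omega)
    rw [show 2 * n + 2 - n = n + 2 by omega] at this
    exact_mod_cast this
  rw [h1, h2] at h
  rw [← h4]
  linear_combination ((n + 2).factorial : ℝ) * h

/-- Integrate by parts with `t - 1`: only the boundary at `-1` survives, and there the Vandermonde
product supplies exactly `∏ (1 + y j)`. This links dimension `n + 1` to the top moment in dimension
`n`. -/
lemma discMoment_empty_succ (n : ℕ) : discMoment (∅ : Finset (Fin (n + 1))) * (n + 2) =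
    4 * discMoment (Finset.univ : Finset (Fin n)) := by
  have hparts := integral_parts (n := n) (φ := fun t => t - 1) (φ' := fun _ => 1)
    (fun t => (hasDerivAt_id t).sub_const 1) (by fun_prop) (g := fun _ => 1) (by fun_prop)
  have hj : ∀ j : Fin n, ∫ x, (x 0 - 1) * 1 * (absDisc x / (x 0 - x j.succ)) ∂cubeMeasure (n + 1) =
      1 / 2 * discMoment (∅ : Finset (Fin (n + 1))) := fun j => by
    rw [integral_antisymm (θ := fun _ => 1) (by fun_prop) j, discMoment]
    · simp
    · intro x; simp
  have h1 : ∫ y, (1 : ℝ) * ((1 - 1) * absDisc (Fin.cons 1 y : Fin (n + 1) → ℝ) -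
      (-1 - 1) * absDisc (Fin.cons (-1) y : Fin (n + 1) → ℝ)) ∂cubeMeasure n =
      2 * discMoment (Finset.univ : Finset (Fin n)) := by
    rw [discMoment, ← integral_const_mul]
    refine integral_congr_ae ?_
    filter_upwards [ae_mem_cubeMeasure n] with y hy
    rw [absDisc_cons (-1)]
    have : ∏ j, |y j - -1| = ∏ j, (1 + y j) := Finset.prod_congr rfl fun j _ => by
      rw [sub_neg_eq_add, add_comm, abs_of_pos]
      linarith [(hy j).1]
    rw [this]; ring
  have h2 : ∫ x : Fin (n + 1) → ℝ, 1 * 1 * absDisc x ∂cubeMeasure (n + 1) =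
      discMoment (∅ : Finset (Fin (n + 1))) := by
    rw [discMoment]; simp
  rw [Finset.sum_congr rfl fun j _ => hj j, h1, h2, Finset.sum_const, Finset.card_univ,
    Fintype.card_fin, nsmul_eq_mul] at hparts
  linarith

lemma DReal_succ (n : ℕ) : DReal (n + 1) =
    DReal n * ((2 : ℝ) ^ (n + 1) * (n.factorial : ℝ) ^ 2 / ((2 * n + 1).factorial : ℝ)) := by
  rw [DReal, Finset.prod_range_succ]; rfl

/-- Going from the empty to the full moment inside dimension `n` and across to dimension `n + 1`
closes the induction. -/
theorem discMoment_empty (n : ℕ) :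
    discMoment (∅ : Finset (Fin n)) = n.factorial * DReal n := by
  induction n with
  | zero =>
    simp [discMoment, DReal, absDisc, cubeMeasure, Measure.real]
  | succ n ih =>
    have h1 := discMoment_empty_succ n
    have h2 := discMoment_univ n
    rw [ih] at h2
    rw [DReal_succ]
    have h3 : ((2 * n + 2).factorial : ℝ) = (2 * n + 2) * (2 * n + 1).factorial := by
      rw [Nat.factorial_succ]; push_cast; ring
    have h4 : ((n + 2).factorial : ℝ) = (n + 2) * (n + 1).factorial := by
      rw [Nat.factorial_succ]; push_cast; ring
    have h5 : ((n + 1).factorial : ℝ) = (n + 1) * n.factorial := by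
      rw [Nat.factorial_succ]; push_cast; ring
    have h6 : ((2 * n + 1).factorial : ℝ) ≠ 0 := by positivity
    rw [h3, h4, h5] at h2
    rw [h5]
    have h7 : ((n : ℝ) + 2) ≠ 0 := by positivity
    have h8 : ((n : ℝ) + 1) ≠ 0 := by positivity
    rw [mul_div_assoc', mul_div_assoc', eq_div_iff h6]
    refine mul_left_cancel₀ (mul_ne_zero h7 h8) ?_
    linear_combination ((n : ℝ) + 1) * (2 * n + 1).factorial * h1 + 2 * h2

theorem volume_unitRegion_allReal (N : ℕ) :
    volume (unitRegion N AllReal) = ENNReal.ofReal (DReal N) := by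
  have h1 : ∫⁻ x in cube N, ENNReal.ofReal (absDisc x) =
      ENNReal.ofReal (discMoment (∅ : Finset (Fin N))) := by
    have hr : (volume : Measure (Fin N → ℝ)).restrict (cube N) = cubeMeasure N := by
      rw [cubeMeasure, cube, volume_pi, Measure.restrict_pi_pi]
      congr 1
      funext _
      exact Measure.restrict_congr_set Ioo_ae_eq_Ioc
    rw [hr, ← ofReal_integral_eq_lintegral_ofReal (integrable_cubeMeasure continuous_absDisc)
      (ae_of_all _ absDisc_nonneg), discMoment]
    simp
  have h2 := factorial_mul_volume_unitRegion_allReal N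
  rw [h1, discMoment_empty, ENNReal.ofReal_mul (by positivity), ENNReal.ofReal_natCast] at h2
  exact (ENNReal.mul_right_inj (by exact_mod_cast N.factorial_ne_zero)
    (ENNReal.natCast_ne_top _)).1 h2

end SelbergIntegral

end PerronCount

namespace PerronCount

open MeasureTheory
open scoped Topology ENNReal ComplexConjugate

/-! ### Conjugate pairs and the Vandermonde determinant in real form -/

section PairIndex

variable {n : ℕ}

/-- The block diagonal matrix with `n` blocks of size two, block `k` in rows `2k` and `2k+1`. -/
def pairBlock {K : Type*} [Zero K] (B : Fin n → Matrix (Fin 2) (Fin 2) K) :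
    Matrix (Fin (n * 2)) (Fin (n * 2)) K :=
  (Matrix.blockDiagonal B).submatrix (finProdFinEquiv.symm.trans (Equiv.prodComm _ _))
    (finProdFinEquiv.symm.trans (Equiv.prodComm _ _))

lemma det_pairBlock {K : Type*} [CommRing K] (B : Fin n → Matrix (Fin 2) (Fin 2) K) :
    (pairBlock B).det = ∏ k, (B k).det := by
  rw [pairBlock, Matrix.det_submatrix_equiv_self, Matrix.det_blockDiagonal]

lemma sum_pairBlock_mul {K : Type*} [CommRing K] (B : Fin n → Matrix (Fin 2) (Fin 2) K)
    (v : Fin (n * 2) → K) (k : Fin n) (b : Fin 2) :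
    ∑ i, pairBlock B (finProdFinEquiv (k, b)) i * v i =
      B k b 0 * v (finProdFinEquiv (k, 0)) + B k b 1 * v (finProdFinEquiv (k, 1)) := by
  rw [← Equiv.sum_comp finProdFinEquiv, Fintype.sum_prod_type, Finset.sum_eq_single k]
  · simp [pairBlock, Matrix.blockDiagonal_apply, Fin.sum_univ_two]
  · intro l _ hl
    simp [pairBlock, Matrix.blockDiagonal_apply, hl.symm]
  · simp

lemma forall_pair_iff {P : Fin (n * 2) → Prop} :
    (∀ i, P i) ↔ ∀ k, P (finProdFinEquiv (k, 0)) ∧ P (finProdFinEquiv (k, 1)) := by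
  rw [← finProdFinEquiv.forall_congr_right, Prod.forall]
  simp [Fin.forall_fin_two]

/-- The tuple `z₀, conj z₀, z₁, conj z₁, …`. -/
noncomputable def conjPair (z : Fin n → ℂ) (i : Fin (n * 2)) : ℂ :=
  if (finProdFinEquiv.symm i).2 = 0 then z (finProdFinEquiv.symm i).1
  else conj (z (finProdFinEquiv.symm i).1)

@[simp] lemma conjPair_zero (z : Fin n → ℂ) (k : Fin n) :
    conjPair z (finProdFinEquiv (k, 0)) = z k := by simp [conjPair]

@[simp] lemma conjPair_one (z : Fin n → ℂ) (k : Fin n) :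
    conjPair z (finProdFinEquiv (k, 1)) = conj (z k) := by simp [conjPair]

lemma prod_pair {K : Type*} [CommMonoid K] (g : Fin (n * 2) → K) :
    ∏ i, g i = ∏ k, g (finProdFinEquiv (k, 0)) * g (finProdFinEquiv (k, 1)) := by
  rw [← Equiv.prod_comp finProdFinEquiv, Fintype.prod_prod_type]
  simp [Fin.prod_univ_two]

/-- The matrix with rows the real and the imaginary parts of the powers of `z k`. -/
noncomputable def powMatrix (z : Fin n → ℂ) : Matrix (Fin (n * 2)) (Fin (n * 2)) ℝ :=
  Matrix.of fun i j => if (finProdFinEquiv.symm i).2 = 0 then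
    (z (finProdFinEquiv.symm i).1 ^ (j : ℕ)).re else (z (finProdFinEquiv.symm i).1 ^ (j : ℕ)).im

@[simp] lemma powMatrix_zero (z : Fin n → ℂ) (k : Fin n) (j : Fin (n * 2)) :
    powMatrix z (finProdFinEquiv (k, 0)) j = (z k ^ (j : ℕ)).re := by
  rw [powMatrix, Matrix.of_apply, Equiv.symm_apply_apply, if_pos rfl]

@[simp] lemma powMatrix_one (z : Fin n → ℂ) (k : Fin n) (j : Fin (n * 2)) :
    powMatrix z (finProdFinEquiv (k, 1)) j = (z k ^ (j : ℕ)).im := by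
  rw [powMatrix, Matrix.of_apply, Equiv.symm_apply_apply, if_neg one_ne_zero]

/-- A power of `z k` and its conjugate are obtained from its real and imaginary parts by a two by
two matrix of determinant `-2i`. -/
lemma det_vandermonde_conjPair (z : Fin n → ℂ) :
    (Matrix.vandermonde (conjPair z)).det = (-2 * Complex.I) ^ n * ((powMatrix z).det : ℂ) := by
  have h1 : Matrix.vandermonde (conjPair z) =
      pairBlock (fun _ => !![1, Complex.I; 1, -Complex.I]) * (powMatrix z).map Complex.ofRealHom := by
    ext i j
    revert i
    rw [forall_pair_iff]
    intro k
    rw [Matrix.mul_apply, Matrix.mul_apply, sum_pairBlock_mul, sum_pairBlock_mul]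
    simp only [Matrix.vandermonde_apply, Matrix.map_apply, conjPair_zero, conjPair_one,
      powMatrix_zero, powMatrix_one]
    constructor
    · apply Complex.ext <;> simp
    · rw [← map_pow]
      generalize z k ^ (j : ℕ) = w
      apply Complex.ext <;> simp
  rw [h1, Matrix.det_mul, det_pairBlock, ← RingHom.mapMatrix_apply, ← RingHom.map_det]
  congr 1
  rw [Finset.prod_const, Finset.card_univ, Fintype.card_fin, Matrix.det_fin_two]
  congr 1
  simp
  ring

lemma prod_prod_Ioi_eq_ite {N : ℕ} {K : Type*} [CommMonoid K] (g : Fin N → Fin N → K) :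
    ∏ i, ∏ j ∈ Finset.Ioi i, g i j = ∏ i, ∏ j, if i < j then g i j else 1 := by
  refine Finset.prod_congr rfl fun i _ => ?_
  rw [← Finset.prod_filter]
  congr 1
  ext j; simp

lemma finProdFinEquiv_lt_iff {k l : Fin n} {b c : Fin 2} :
    finProdFinEquiv (k, b) < finProdFinEquiv (l, c) ↔ k < l ∨ k = l ∧ b < c := by
  rw [Fin.lt_def, Fin.lt_def, Fin.lt_def, Fin.ext_iff]
  simp only [finProdFinEquiv_apply_val]
  have := b.2
  have := c.2
  omega

/-- The determinant of `powMatrix z` is nonnegative when all `z k` lie in the upper half plane. -/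
lemma det_powMatrix_nonneg {z : Fin n → ℂ} (hz : ∀ k, 0 < (z k).im) : 0 ≤ (powMatrix z).det := by
  set ζ := conjPair z with hζ
  have hblock : ∀ k l : Fin n, ∃ r : ℝ, 0 ≤ r ∧
      ((if finProdFinEquiv (k, (0 : Fin 2)) < finProdFinEquiv (l, (0 : Fin 2)) then
        ζ (finProdFinEquiv (l, 0)) - ζ (finProdFinEquiv (k, 0)) else 1) *
      (if finProdFinEquiv (k, (0 : Fin 2)) < finProdFinEquiv (l, (1 : Fin 2)) then
        ζ (finProdFinEquiv (l, 1)) - ζ (finProdFinEquiv (k, 0)) else 1)) *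
      ((if finProdFinEquiv (k, (1 : Fin 2)) < finProdFinEquiv (l, (0 : Fin 2)) then
        ζ (finProdFinEquiv (l, 0)) - ζ (finProdFinEquiv (k, 1)) else 1) *
      (if finProdFinEquiv (k, (1 : Fin 2)) < finProdFinEquiv (l, (1 : Fin 2)) then
        ζ (finProdFinEquiv (l, 1)) - ζ (finProdFinEquiv (k, 1)) else 1)) =
      (if k = l then -2 * Complex.I else 1) * (r : ℂ) := by
    intro k l
    simp only [finProdFinEquiv_lt_iff, hζ, conjPair_zero, conjPair_one]
    -- The Vandermonde product is grouped by pairs: two different pairs contribute squared moduli,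
    -- and a single pair contributes `conj (z k) - z k = -2i * Im (z k)`.
    rcases lt_trichotomy k l with h | h | h
    · refine ⟨Complex.normSq (z l - z k) * Complex.normSq (conj (z l) - z k),
        mul_nonneg (Complex.normSq_nonneg _) (Complex.normSq_nonneg _), ?_⟩
      simp only [h, h.ne, true_or, if_true, if_false, one_mul]
      push_cast
      rw [← Complex.mul_conj, ← Complex.mul_conj]
      simp only [map_sub, Complex.conj_conj]
      ring
    · subst h
      refine ⟨(z k).im, (hz k).le, ?_⟩
      simp only [lt_irrefl, false_or, true_and, if_true]
      apply Complex.ext <;> simp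
      ring
    · refine ⟨1, zero_le_one, ?_⟩
      simp [h.not_gt, h.ne']
  choose r hr0 hr using hblock
  have h1 : (Matrix.vandermonde ζ).det =
      (-2 * Complex.I) ^ n * ((∏ k, ∏ l, r k l : ℝ) : ℂ) := by
    rw [Matrix.det_vandermonde, prod_prod_Ioi_eq_ite fun i j => ζ j - ζ i, prod_pair]
    simp only [prod_pair (n := n) (K := ℂ), ← Finset.prod_mul_distrib, hr]
    push_cast
    simp only [Finset.prod_mul_distrib]
    congr 1
    simp
  rw [det_vandermonde_conjPair] at h1
  have h2 : (-2 * Complex.I) ^ n ≠ 0 := pow_ne_zero _ (by simp)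
  have h3 := mul_left_cancel₀ h2 h1
  have h4 : (powMatrix z).det = ∏ k, ∏ l, r k l := by exact_mod_cast h3
  rw [h4]
  exact Finset.prod_nonneg fun k _ => Finset.prod_nonneg fun l _ => hr0 k l

/-- The derivative at the root `z k` of the polynomial with roots `conjPair z`, up to sign. -/
noncomputable def pairDeriv (z : Fin n → ℂ) (k : Fin n) : ℂ :=
  -∏ j ∈ {finProdFinEquiv (k, 0)}ᶜ, (z k - conjPair z j)

/-- Conjugate roots have derivatives of equal modulus, so the left side is the product of the moduli
over all roots, which is the squared modulus of the Vandermonde determinant. -/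
lemma prod_normSq_pairDeriv (z : Fin n → ℂ) :
    ∏ k, Complex.normSq (pairDeriv z k) = 4 ^ n * (powMatrix z).det ^ 2 := by
  set ζ := conjPair z with hζ
  have h1 : ∏ i, ∏ j ∈ {i}ᶜ, ‖ζ i - ζ j‖ = ‖(Matrix.vandermonde ζ).det‖ ^ 2 := by
    rw [← Finset.prod_prod_Ioi_mul_eq_prod_prod_off_diag fun j m => ‖ζ m - ζ j‖,
      Matrix.det_vandermonde, norm_prod, ← Finset.prod_pow]
    refine Finset.prod_congr rfl fun i _ => ?_
    rw [norm_prod, ← Finset.prod_pow]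
    refine Finset.prod_congr rfl fun j _ => ?_
    rw [norm_sub_rev (ζ i) (ζ j), sq]
  have h2 : ∀ k, ∏ j ∈ {finProdFinEquiv (k, (1 : Fin 2))}ᶜ, ‖ζ (finProdFinEquiv (k, 1)) - ζ j‖ =
      ∏ j ∈ {finProdFinEquiv (k, (0 : Fin 2))}ᶜ, ‖ζ (finProdFinEquiv (k, 0)) - ζ j‖ := by
    intro k
    set τ : Equiv.Perm (Fin (n * 2)) := finProdFinEquiv.permCongr
      (Equiv.prodCongr (Equiv.refl (Fin n)) (Equiv.swap (0 : Fin 2) 1)) with hτ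
    have hτ0 : ∀ l, τ (finProdFinEquiv (l, 0)) = finProdFinEquiv (l, 1) := fun l => by
      simp [hτ, Equiv.permCongr_apply]
    have hτ1 : ∀ l, τ (finProdFinEquiv (l, 1)) = finProdFinEquiv (l, 0) := fun l => by
      simp [hτ, Equiv.permCongr_apply]
    have hconj : ∀ j, ζ (τ j) = conj (ζ j) := by
      rw [forall_pair_iff]
      intro l
      rw [hτ0, hτ1]
      simp [hζ]
    refine (Finset.prod_equiv τ (fun j => ?_) fun j _ => ?_).symm
    · simp only [Finset.mem_compl, Finset.mem_singleton]
      rw [← hτ0, τ.injective.eq_iff]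
    · rw [← hτ0, hconj, hconj, ← map_sub, RCLike.norm_conj]
  have h3 : ∀ k, Complex.normSq (pairDeriv z k) =
      (∏ j ∈ {finProdFinEquiv (k, (0 : Fin 2))}ᶜ, ‖ζ (finProdFinEquiv (k, 0)) - ζ j‖) *
      ∏ j ∈ {finProdFinEquiv (k, (1 : Fin 2))}ᶜ, ‖ζ (finProdFinEquiv (k, 1)) - ζ j‖ := by
    intro k
    rw [h2, Complex.normSq_eq_norm_sq, pairDeriv, norm_neg, norm_prod, sq, hζ, conjPair_zero]
  rw [Finset.prod_congr rfl fun k _ => h3 k, ← prod_pair fun i => ∏ j ∈ {i}ᶜ, ‖ζ i - ζ j‖, h1,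
    det_vandermonde_conjPair, norm_mul, mul_pow, Complex.norm_real, Real.norm_eq_abs, sq_abs]
  congr 1
  simp only [norm_pow, norm_mul, norm_neg, Complex.norm_ofNat, Complex.norm_I, mul_one]
  rw [← pow_mul, mul_comm, pow_mul]
  norm_num

end PairIndex

/-! ### The Jacobian of the coefficients in terms of nonreal roots -/

section QuadraticCoefficients

open Polynomial

variable {n : ℕ}

/-- The coefficient vector of the product of the real quadratic polynomials with roots `z k`. -/
noncomputable def quadCoef (z : Fin n → ℂ) (i : Fin (n * 2)) : ℝ :=
  (∏ k, (X ^ 2 + (C (-(2 * (z k).re)) * X + C (Complex.normSq (z k))))).coeff i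

lemma monic_quadratic (b c : ℝ) : (X ^ 2 + (C b * X + C c)).Monic :=
  monic_X_pow_add (degree_linear_lt.trans_le (by norm_num))

lemma monicPoly_quadCoef (z : Fin n → ℂ) : monicPoly (quadCoef z) =
    ∏ k, (X ^ 2 + (C (-(2 * (z k).re)) * X + C (Complex.normSq (z k)))) := by
  refine monicPoly_coeff (monic_prod_of_monic _ _ fun k _ => monic_quadratic _ _) ?_
  rw [natDegree_prod_of_monic _ _ fun k _ => monic_quadratic _ _]
  have : ∀ k, (X ^ 2 + (C (-(2 * (z k).re)) * X + C (Complex.normSq (z k)))).natDegree = 2 :=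
    fun k => by compute_degree!
  rw [Finset.sum_congr rfl fun k _ => this k]
  simp

lemma isRootList_quadCoef (z : Fin n → ℂ) : IsRootList (quadCoef z) (conjPair z) := by
  have h := congrArg (Polynomial.map Complex.ofRealHom) (monicPoly_quadCoef z)
  rw [map_monicPoly] at h
  rw [IsRootList]
  refine h.trans ?_
  rw [prod_pair fun i => X - C (conjPair z i), Polynomial.map_prod]
  refine Finset.prod_congr rfl fun k _ => ?_
  rw [conjPair_zero, conjPair_one]
  have h1 : (C (conj (z k)) : ℂ[X]) = C (2 * (z k).re : ℂ) - C (z k) := by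
    rw [← C_sub]
    congr 1
    apply Complex.ext <;> simp
    ring
  have h2 : (C (Complex.normSq (z k) : ℂ) : ℂ[X]) = C (z k) * C (conj (z k)) := by
    rw [← C_mul, Complex.mul_conj]
  simp only [Polynomial.map_add, Polynomial.map_pow, map_X, Polynomial.map_mul, map_C,
    Complex.ofRealHom_eq_coe, Complex.ofReal_neg, Complex.ofReal_mul, Complex.ofReal_ofNat]
  rw [h2, h1, C_neg]
  ring

lemma differentiable_quadCoef : Differentiable ℝ (quadCoef : (Fin n → ℂ) → _) := by
  refine differentiable_pi.2 fun i => differentiable_coeff_prod _ (fun k j => ?_) _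
  have h1 : Differentiable ℝ fun x : Fin n → ℂ => (x k).re :=
    Complex.reCLM.differentiable.comp (differentiable_apply k)
  have h2 : Differentiable ℝ fun x : Fin n → ℂ => (x k).im :=
    Complex.imCLM.differentiable.comp (differentiable_apply k)
  simp only [coeff_add, coeff_C_mul, coeff_C, Complex.normSq_apply]
  split_ifs <;> fun_prop

lemma differentiable_conjPair (i : Fin (n * 2)) : Differentiable ℝ fun z : Fin n → ℂ => conjPair z i := by
  revert i
  rw [forall_pair_iff]
  intro k
  simp only [conjPair_zero, conjPair_one]
  exact ⟨differentiable_apply k, Complex.conjCLE.differentiable.comp (differentiable_apply k)⟩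

/-- Evaluate at the root `z k`: in the derivative of the product only the variation of the factor
vanishing there survives, the conjugate factor being among those kept fixed. -/
lemma sum_fderiv_quadCoef (z v : Fin n → ℂ) (k : Fin n) :
    ∑ j, ((fderiv ℝ quadCoef z v j : ℝ) : ℂ) * z k ^ (j : ℕ) = pairDeriv z k * v k := by
  set y := z k with hy
  have h1 : HasFDerivAt (fun x : Fin n → ℂ =>
        y ^ (n * 2) + ∑ j, (quadCoef x j : ℂ) * y ^ (j : ℕ))
      (∑ j : Fin (n * 2), y ^ (j : ℕ) • Complex.ofRealCLM.comp
        ((ContinuousLinearMap.proj j).comp (fderiv ℝ quadCoef z))) z := by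
    refine HasFDerivAt.const_add _ (HasFDerivAt.fun_sum fun j _ => ?_)
    have := (hasFDerivAt_pi'.1 (differentiable_quadCoef z).hasFDerivAt) j
    exact (Complex.ofRealCLM.hasFDerivAt.comp z this).mul_const _
  set s : Finset (Fin (n * 2)) := {finProdFinEquiv (k, 0)}ᶜ with hs
  have hG : DifferentiableAt ℝ (fun x : Fin n → ℂ => ∏ j ∈ s, (y - conjPair x j)) z := by
    have := fun i => differentiable_conjPair (n := n) i
    fun_prop
  have h2 : HasFDerivAt (fun x : Fin n → ℂ => (y - x k) * ∏ j ∈ s, (y - conjPair x j))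
      ((y - z k) • fderiv ℝ (fun x : Fin n → ℂ => ∏ j ∈ s, (y - conjPair x j)) z +
        (∏ j ∈ s, (y - conjPair z j)) • (-ContinuousLinearMap.proj (R := ℝ) k)) z :=
    ((hasFDerivAt_apply k z).const_sub y).mul hG.hasFDerivAt
  have h3 : (fun x : Fin n → ℂ => y ^ (n * 2) + ∑ j, (quadCoef x j : ℂ) * y ^ (j : ℕ)) =
      fun x => (y - x k) * ∏ j ∈ s, (y - conjPair x j) := by
    funext x
    rw [(isRootList_quadCoef x).eval_eq, ← Finset.prod_mul_prod_compl {finProdFinEquiv (k, 0)},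
      Finset.prod_singleton, conjPair_zero]
  rw [h3] at h1
  have h5 : ((y - z k) • fderiv ℝ (fun x : Fin n → ℂ => ∏ j ∈ s, (y - conjPair x j)) z +
        (∏ j ∈ s, (y - conjPair z j)) • (-ContinuousLinearMap.proj (R := ℝ) k) :
          (Fin n → ℂ) →L[ℝ] ℂ) v =
      (∏ j ∈ s, (y - conjPair z j)) * -v k := by
    change (y - z k) * fderiv ℝ (fun x : Fin n → ℂ => ∏ j ∈ s, (y - conjPair x j)) z v +
      (∏ j ∈ s, (y - conjPair z j)) * -v k = _
    rw [← hy, sub_self, zero_mul, zero_add]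
  have h4 := (DFunLike.congr_fun (h1.unique h2) v).trans h5
  rw [pairDeriv, ← hy, ← hs, neg_mul, ← mul_neg, ← h4]
  simp only [sum_apply, smul_apply, ContinuousLinearMap.comp_apply, ContinuousLinearMap.proj_apply,
    smul_eq_mul, Complex.ofRealCLM_apply]
  exact Finset.sum_congr rfl fun j _ => mul_comm _ _

/-- The complex vector with given real and imaginary parts. -/
noncomputable def ofParts (n : ℕ) : (Fin (n * 2) → ℝ) →L[ℝ] (Fin n → ℂ) :=
  ContinuousLinearMap.pi fun k =>
    Complex.ofRealCLM.comp (ContinuousLinearMap.proj (finProdFinEquiv (k, 0))) +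
    Complex.I • Complex.ofRealCLM.comp (ContinuousLinearMap.proj (finProdFinEquiv (k, 1)))

lemma ofParts_re (c : Fin (n * 2) → ℝ) (k : Fin n) :
    (ofParts n c k).re = c (finProdFinEquiv (k, 0)) := by simp [ofParts]

lemma ofParts_im (c : Fin (n * 2) → ℝ) (k : Fin n) :
    (ofParts n c k).im = c (finProdFinEquiv (k, 1)) := by simp [ofParts]

/-- The vector of real and imaginary parts. -/
noncomputable def parts (z : Fin n → ℂ) (i : Fin (n * 2)) : ℝ :=
  if (finProdFinEquiv.symm i).2 = 0 then (z (finProdFinEquiv.symm i).1).re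
  else (z (finProdFinEquiv.symm i).1).im

@[simp] lemma parts_zero (z : Fin n → ℂ) (k : Fin n) :
    parts z (finProdFinEquiv (k, 0)) = (z k).re := by simp [parts]

@[simp] lemma parts_one (z : Fin n → ℂ) (k : Fin n) :
    parts z (finProdFinEquiv (k, 1)) = (z k).im := by simp [parts]

lemma ofParts_parts (z : Fin n → ℂ) : ofParts n (parts z) = z := by
  funext k
  apply Complex.ext
  · rw [ofParts_re, parts_zero]
  · rw [ofParts_im, parts_one]

lemma parts_ofParts (c : Fin (n * 2) → ℝ) : parts (ofParts n c) = c := by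
  funext i
  revert i
  rw [forall_pair_iff]
  intro k
  rw [parts_zero, parts_one, ofParts_re, ofParts_im]
  exact ⟨rfl, rfl⟩

lemma measurePreserving_parts (n : ℕ) :
    MeasurePreserving (parts : (Fin n → ℂ) → Fin (n * 2) → ℝ) := by
  have hm : Measurable (parts : (Fin n → ℂ) → Fin (n * 2) → ℝ) := by
    refine measurable_pi_lambda _ ?_
    rw [forall_pair_iff]
    intro k
    simp only [parts_zero, parts_one]
    constructor <;> fun_prop
  refine ⟨hm, ?_⟩
  refine (Measure.pi_eq fun s hs => ?_).symm
  rw [Measure.map_apply hm (MeasurableSet.univ_pi hs)]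
  have h1 : parts ⁻¹' Set.univ.pi s = Set.univ.pi fun k : Fin n =>
      Complex.measurableEquivRealProd ⁻¹'
        (s (finProdFinEquiv (k, 0)) ×ˢ s (finProdFinEquiv (k, 1))) := by
    ext z
    simp only [Set.mem_preimage, Set.mem_univ_pi, forall_pair_iff (P := fun i => parts z i ∈ s i),
      parts_zero, parts_one, Set.mem_prod]
    rfl
  rw [h1, volume_pi_pi, prod_pair]
  refine Finset.prod_congr rfl fun k _ => ?_
  rw [Complex.volume_preserving_equiv_real_prod.measure_preimage
    ((hs _).prod (hs _)).nullMeasurableSet, Measure.volume_eq_prod, Measure.prod_prod]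

/-- Multiplied by `powMatrix`, the Jacobian becomes block diagonal, block `k` being multiplication
by the complex number `pairDeriv z k`, of determinant its squared modulus. One factor of `(powMatrix
z).det` then cancels. -/
lemma abs_det_fderiv_quadCoef {c : Fin (n * 2) → ℝ} (hc : (powMatrix (ofParts n c)).det ≠ 0) :
    |((fderiv ℝ quadCoef (ofParts n c)).comp (ofParts n)).det| =
      4 ^ n * |(powMatrix (ofParts n c)).det| := by
  set z := ofParts n c with hz
  set B : Fin n → Matrix (Fin 2) (Fin 2) ℝ := fun k =>
    !![(pairDeriv z k).re, -(pairDeriv z k).im; (pairDeriv z k).im, (pairDeriv z k).re] with hB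
  have h1 : (Matrix.toLin' (powMatrix z)).comp
      ((fderiv ℝ quadCoef z).comp (ofParts n) : (Fin (n * 2) → ℝ) →ₗ[ℝ] Fin (n * 2) → ℝ) =
      Matrix.toLin' (pairBlock B) := by
    refine LinearMap.ext fun v => funext ?_
    rw [forall_pair_iff]
    intro k
    have h2 := sum_fderiv_quadCoef z (ofParts n v) k
    simp only [LinearMap.comp_apply, Matrix.toLin'_apply, Matrix.mulVec, dotProduct,
      sum_pairBlock_mul, powMatrix_zero, powMatrix_one]
    constructor
    · have h3 := congrArg Complex.re h2
      simp only [Complex.re_sum, Complex.re_ofReal_mul] at h3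
      rw [Complex.mul_re, ofParts_re, ofParts_im] at h3
      refine (Finset.sum_congr rfl fun j _ => mul_comm _ _).trans (h3.trans ?_)
      simp [hB, sub_eq_add_neg]
    · have h3 := congrArg Complex.im h2
      simp only [Complex.im_sum, Complex.im_ofReal_mul] at h3
      rw [Complex.mul_im, ofParts_re, ofParts_im] at h3
      refine (Finset.sum_congr rfl fun j _ => mul_comm _ _).trans (h3.trans ?_)
      simp [hB, add_comm]
  have h2 := congrArg LinearMap.det h1
  rw [LinearMap.det_comp, LinearMap.det_toLin', LinearMap.det_toLin', det_pairBlock] at h2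
  have h3 : ∀ k, (B k).det = Complex.normSq (pairDeriv z k) := fun k => by
    rw [Matrix.det_fin_two, Complex.normSq_apply]
    simp [hB]
  rw [Finset.prod_congr rfl fun k _ => h3 k, prod_normSq_pairDeriv] at h2
  have h4 : ((fderiv ℝ quadCoef z).comp (ofParts n)).det = 4 ^ n * (powMatrix z).det := by
    refine mul_left_cancel₀ hc (h2.trans ?_)
    ring
  rw [h4, abs_mul, abs_of_nonneg (by positivity : (0 : ℝ) ≤ 4 ^ n)]

end QuadraticCoefficients

end PerronCount

namespace PerronCount

open MeasureTheory
open scoped Topology ENNReal ComplexConjugate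

/-! ### The totally complex region as an integral over half discs -/

section ComplexVolume

variable {n : ℕ}

/-- The open upper half of the unit disc. -/
def halfDisc : Set ℂ := {z | 0 < z.im ∧ ‖z‖ < 1}

lemma measurableSet_halfDisc : MeasurableSet halfDisc :=
  ((isOpen_lt continuous_const Complex.continuous_im).inter
    (isOpen_lt continuous_norm continuous_const)).measurableSet

/-- The tuples in the upper half of the unit disc. -/
def halfBox (n : ℕ) : Set (Fin n → ℂ) := Set.univ.pi fun _ => halfDisc

lemma measurableSet_halfBox (n : ℕ) : MeasurableSet (halfBox n) :=
  MeasurableSet.univ_pi fun _ => measurableSet_halfDisc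

lemma conjPair_injective {z : Fin n → ℂ} (hz : ∀ k, 0 < (z k).im) (hinj : Function.Injective z) :
    Function.Injective (conjPair z) := by
  have hne : ∀ k l, z k ≠ conj (z l) := fun k l h => by
    have h1 := congrArg Complex.im h
    rw [Complex.conj_im] at h1
    linarith [hz k, hz l]
  refine forall_pair_iff.2 fun k => ⟨forall_pair_iff.2 fun l => ⟨fun h => ?_, fun h => ?_⟩,
    forall_pair_iff.2 fun l => ⟨fun h => ?_, fun h => ?_⟩⟩
  · rw [conjPair_zero, conjPair_zero] at h
    rw [hinj h]
  · rw [conjPair_zero, conjPair_one] at h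
    exact absurd h (hne _ _)
  · rw [conjPair_zero, conjPair_one] at h
    exact absurd h.symm (hne _ _)
  · rw [conjPair_one, conjPair_one] at h
    rw [hinj ((starRingEnd ℂ).injective h)]

lemma det_powMatrix_ne_zero {z : Fin n → ℂ} (hz : ∀ k, 0 < (z k).im)
    (hinj : Function.Injective z) : (powMatrix z).det ≠ 0 := by
  have h1 := Matrix.det_vandermonde_ne_zero_iff.2 (conjPair_injective hz hinj)
  rw [det_vandermonde_conjPair] at h1
  intro h
  simp [h] at h1

lemma abs_det_powMatrix_comp_perm (σ : Equiv.Perm (Fin n)) (z : Fin n → ℂ) :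
    |(powMatrix (z ∘ σ)).det| = |(powMatrix z).det| := by
  set τ : Equiv.Perm (Fin (n * 2)) := finProdFinEquiv.permCongr
    (Equiv.prodCongr σ (Equiv.refl (Fin 2))) with hτ
  have hτe : ∀ k b, τ (finProdFinEquiv (k, b)) = finProdFinEquiv (σ k, b) := fun k b => by
    simp [hτ, Equiv.permCongr_apply]
  have : powMatrix (z ∘ σ) = (powMatrix z).submatrix τ id := by
    ext i j
    revert i
    rw [forall_pair_iff]
    intro k
    simp only [Matrix.submatrix_apply, hτe, powMatrix_zero, powMatrix_one, id]
    exact ⟨rfl, rfl⟩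
  rw [this, Matrix.det_permute, abs_mul]
  rcases Int.units_eq_one_or (Equiv.Perm.sign τ) with h | h <;> simp [h]

lemma quadCoef_mem_unitRegion {z : Fin n → ℂ} (hz : z ∈ halfBox n) :
    quadCoef z ∈ unitRegion (n * 2) NoneReal := by
  have h := (isRootList_quadCoef z).croots_eq
  have hall : ∀ i, ‖conjPair z i‖ < 1 ∧ (conjPair z i).im ≠ 0 := by
    refine forall_pair_iff.2 fun k => ?_
    rw [conjPair_zero, conjPair_one, RCLike.norm_conj, Complex.conj_im]
    have := hz k trivial
    exact ⟨⟨this.2, this.1.ne'⟩, this.2, neg_ne_zero.2 this.1.ne'⟩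
  constructor
  · rintro w hw
    rw [h] at hw
    obtain ⟨i, rfl⟩ := hw
    exact (hall i).1
  · rintro w hw
    rw [h] at hw
    obtain ⟨i, rfl⟩ := hw
    exact (hall i).2

lemma range_subset_of_quadCoef_eq {z w : Fin n → ℂ} (hz : z ∈ halfBox n) (hw : w ∈ halfBox n)
    (h : quadCoef z = quadCoef w) (k : Fin n) : ∃ l, w l = z k := by
  have h1 : z k ∈ croots (quadCoef z) := by
    rw [(isRootList_quadCoef z).croots_eq]
    exact ⟨finProdFinEquiv (k, 0), conjPair_zero z k⟩
  rw [h, (isRootList_quadCoef w).croots_eq] at h1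
  obtain ⟨i, hi⟩ := h1
  have h2 : 0 < (conjPair w i).im := by rw [hi]; exact (hz k trivial).1
  have h3 : ∀ i, 0 < (conjPair w i).im → conjPair w i = z k → ∃ l, w l = z k := by
    refine forall_pair_iff.2 fun l => ⟨fun _ h => ⟨l, by rwa [conjPair_zero] at h⟩, fun h _ => ?_⟩
    rw [conjPair_one, Complex.conj_im] at h
    linarith [(hw l trivial).1]
  exact h3 i h2 hi

/-- The polynomial determines the set of roots in the upper half plane, and strictly increasing real
parts fix their order. -/
lemma injOn_quadCoef :
    Set.InjOn (quadCoef : (Fin n → ℂ) → _) ({z | StrictMono (Complex.reLm ∘ z)} ∩ halfBox n) := by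
  rintro z ⟨hz1, hz⟩ w ⟨hw1, hw⟩ h
  have h1 : Complex.reLm ∘ z = Complex.reLm ∘ w := by
    refine (StrictMono.range_inj hz1 hw1).1 (Set.Subset.antisymm ?_ ?_)
    · rintro _ ⟨k, rfl⟩
      obtain ⟨l, hl⟩ := range_subset_of_quadCoef_eq hz hw h k
      exact ⟨l, by rw [Function.comp_apply, hl, Function.comp_apply]⟩
    · rintro _ ⟨k, rfl⟩
      obtain ⟨l, hl⟩ := range_subset_of_quadCoef_eq hw hz h.symm k
      exact ⟨l, by rw [Function.comp_apply, hl, Function.comp_apply]⟩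
  funext k
  obtain ⟨l, hl⟩ := range_subset_of_quadCoef_eq hz hw h k
  have h2 : (Complex.reLm ∘ z) l = (Complex.reLm ∘ z) k := by
    rw [h1, Function.comp_apply, hl, ← h1, Function.comp_apply]
  rw [← hl, hz1.injective h2]

/-- Genericity makes the real parts of different conjugate pairs distinct, so the roots in the upper
half plane can be sorted strictly. -/
lemma exists_sorted_of_noneReal {a : Fin (n * 2) → ℝ} {ζ : Fin (n * 2) → ℂ} (hζ : IsRootList a ζ)
    (hg : IsGeneric ζ) (ha : a ∈ unitRegion (n * 2) NoneReal) :
    ∃ z : Fin n → ℂ, StrictMono (Complex.reLm ∘ z) ∧ z ∈ halfBox n ∧ quadCoef z = a := by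
  classical
  have hinj : Function.Injective ζ := fun i j hij => by
    by_contra hne
    exact hg.injective i j hne hij
  choose c hc using hζ.exists_conj
  have him : ∀ i, (ζ (c i)).im = -(ζ i).im := fun i => by rw [hc, Complex.conj_im]
  have hcinj : Function.Injective c := fun i j hij => by
    have := hc i
    rw [hij, hc j] at this
    exact (hinj ((starRingEnd ℂ).injective this)).symm
  have hne0 : ∀ i, (ζ i).im ≠ 0 := fun i => ha.2 _ (hζ.mem i)
  set U : Finset (Fin (n * 2)) := Finset.univ.filter fun i => 0 < (ζ i).im with hU
  have hmem : ∀ i, i ∈ U ↔ 0 < (ζ i).im := fun i => by simp [hU]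
  -- Conjugation injects the upper roots into the lower ones and conversely.
  have hcard : U.card = n := by
    have h1 : U.card ≤ Uᶜ.card := Finset.card_le_card_of_injOn c (fun i hi => by
      rw [Finset.mem_coe, hmem] at hi
      rw [Finset.mem_coe, Finset.mem_compl, hmem, him]
      linarith) hcinj.injOn
    have h2 : Uᶜ.card ≤ U.card := Finset.card_le_card_of_injOn c (fun i hi => by
      rw [Finset.mem_coe, Finset.mem_compl, hmem] at hi
      have := lt_of_le_of_ne (not_lt.1 hi) (hne0 i)
      rw [Finset.mem_coe, hmem, him]
      linarith) hcinj.injOn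
    have h3 := Finset.card_add_card_compl U
    rw [Fintype.card_fin] at h3
    omega
  set u : Fin n → Fin (n * 2) := fun k => U.orderEmbOfFin hcard k with hu
  have huinj : Function.Injective u := (U.orderEmbOfFin hcard).injective
  have huU : ∀ k, 0 < (ζ (u k)).im := fun k => (hmem _).1 (Finset.orderEmbOfFin_mem U hcard k)
  -- Equal real parts would give `ζ + conj ζ = ζ' + conj ζ'` for two different pairs.
  have hre : Function.Injective fun k => (ζ (u k)).re := fun k l hkl => by
    by_contra hne
    have hsum : ∀ i, ζ i + ζ (c i) = ((2 * (ζ i).re : ℝ) : ℂ) := fun i => by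
      rw [hc, Complex.add_conj]
    refine hg.add_ne_add (u k) (c (u k)) (u l) (c (u l)) (fun h => ?_) (fun h => hne (huinj h))
      (fun h => ?_) ?_
    · have := him (u k)
      rw [← h] at this
      linarith [huU k]
    · have := him (u l)
      rw [← h] at this
      linarith [huU k, huU l]
    · rw [hsum, hsum]
      simp only at hkl
      rw [hkl]
  set σ := Tuple.sort fun k => (ζ (u k)).re with hσ
  set z : Fin n → ℂ := fun k => ζ (u (σ k)) with hz
  have hmono : StrictMono (Complex.reLm ∘ z) :=
    (Tuple.monotone_sort fun k => (ζ (u k)).re).strictMono_of_injective (hre.comp σ.injective)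
  have hzim : ∀ k, 0 < (z k).im := fun k => huU _
  have hzinj : Function.Injective z := hinj.comp (huinj.comp σ.injective)
  refine ⟨z, hmono, fun k _ => ⟨hzim k, ha.1 _ (hζ.mem _)⟩, ?_⟩
  have hex : ∀ i, ∃ j, ζ j = conjPair z i := by
    refine forall_pair_iff.2 fun k => ⟨⟨u (σ k), by rw [conjPair_zero]⟩, c (u (σ k)), ?_⟩
    rw [conjPair_one, hc]
  choose τ hτ using hex
  have hτinj : Function.Injective τ := fun i j hij => by
    refine conjPair_injective hzim hzinj ?_
    rw [← hτ, ← hτ, hij]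
  have h1 := hζ.comp_perm (Equiv.ofBijective τ (Finite.injective_iff_bijective.1 hτinj))
  have h2 := isRootList_quadCoef z
  have h3 : ζ ∘ Equiv.ofBijective τ (Finite.injective_iff_bijective.1 hτinj) = conjPair z :=
    funext hτ
  rw [h3] at h1
  rw [IsRootList] at h1 h2
  rw [← h1] at h2
  funext i
  exact_mod_cast congrFun (monicPoly_injective h2) i

lemma measurable_det_powMatrix : Measurable fun z : Fin n → ℂ => (powMatrix z).det := by
  refine Continuous.measurable (Continuous.matrix_det (continuous_matrix ?_))
  refine forall_pair_iff.2 fun k => ⟨fun j => ?_, fun j => ?_⟩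
  · simp only [powMatrix_zero]; fun_prop
  · simp only [powMatrix_one]; fun_prop

/-- On the right the determinant carries no absolute value, thanks to `det_powMatrix_nonneg`; this
makes it possible to integrate it term by term. -/
theorem factorial_mul_volume_unitRegion_noneReal (n : ℕ) :
    (n.factorial : ℝ≥0∞) * volume (unitRegion (n * 2) NoneReal) =
      ∫⁻ z in halfBox n, ENNReal.ofReal (4 ^ n * (powMatrix z).det) := by
  obtain ⟨R, hR, hgen⟩ := exists_generic_polynomial (n * 2)
  set S : Set (Fin n → ℂ) := {z | StrictMono (Complex.reLm ∘ z)} with hS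
  have hSm : MeasurableSet S := measurableSet_strictMono_comp
  have hBm := measurableSet_halfBox n
  have hcm : Measurable (ofParts n) := (ofParts n).continuous.measurable
  set T : Set (Fin (n * 2) → ℝ) := ofParts n ⁻¹' (S ∩ halfBox n) with hT
  have hTm : MeasurableSet T := hcm (hSm.inter hBm)
  have hdm := measurable_det_powMatrix (n := n)
  set f : (Fin n → ℂ) → ℝ≥0∞ :=
    (halfBox n).indicator fun z => ENNReal.ofReal (4 ^ n * |(powMatrix z).det|) with hf
  have hfm : Measurable f := Measurable.indicator (by fun_prop) hBm
  have h1 : volume (unitRegion (n * 2) NoneReal) = volume ((quadCoef ∘ ofParts n) '' T) := by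
    refine le_antisymm ?_ (measure_mono ?_)
    · rw [← volume_unitRegion_eq hR]
      refine measure_mono fun a ha => ?_
      obtain ⟨ζ, hζ⟩ := exists_isRootList a
      obtain ⟨z, hz, hz2, rfl⟩ := exists_sorted_of_noneReal hζ (hgen a ζ hζ ha.2) ha.1
      refine ⟨parts z, ?_, ?_⟩
      · rw [hT, Set.mem_preimage, ofParts_parts]
        exact ⟨hz, hz2⟩
      · rw [Function.comp_apply, ofParts_parts]
    · rintro _ ⟨c, hc, rfl⟩
      exact quadCoef_mem_unitRegion hc.2
  have h2 : volume ((quadCoef ∘ ofParts n) '' T) = ∫⁻ z in S, f z := by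
    rw [← lintegral_abs_det_fderiv_eq_addHaar_image volume hTm
      (fun c _ => ((differentiable_quadCoef (ofParts n c)).hasFDerivAt.comp c
        (ofParts n).hasFDerivAt).hasFDerivWithinAt) ?_, ← lintegral_indicator hSm,
      ← lintegral_indicator hTm]
    · have h3 : ∀ c, T.indicator (fun c => ENNReal.ofReal
          |((fderiv ℝ quadCoef (ofParts n c)).comp (ofParts n)).det|) c =
          S.indicator f (ofParts n c) := by
        intro c
        by_cases hcS : ofParts n c ∈ S
        · rw [Set.indicator_of_mem hcS]
          by_cases hcB : ofParts n c ∈ halfBox n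
          · rw [hf, Set.indicator_of_mem hcB, Set.indicator_of_mem (show c ∈ T from ⟨hcS, hcB⟩),
              abs_det_fderiv_quadCoef]
            refine det_powMatrix_ne_zero (fun k => (hcB k trivial).1) fun k l hkl => ?_
            exact StrictMono.injective hcS (by rw [Function.comp_apply, hkl, Function.comp_apply])
          · rw [hf, Set.indicator_of_notMem hcB,
              Set.indicator_of_notMem (fun h : c ∈ T => hcB h.2)]
        · rw [Set.indicator_of_notMem hcS, Set.indicator_of_notMem (fun h : c ∈ T => hcS h.1)]
      have hm : Measurable fun c => S.indicator f (ofParts n c) := (hfm.indicator hSm).comp hcm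
      rw [lintegral_congr h3, ← (measurePreserving_parts n).lintegral_comp hm]
      simp only [ofParts_parts]
    · intro c hc d hd h
      have := injOn_quadCoef hc hd h
      rw [← parts_ofParts c, this, parts_ofParts]
  have hkey : Complex.reLm ≠ 0 := fun h => by
    have := congrArg (fun L => L 1) h
    simp at this
  rw [h1, h2, ← lintegral_eq_factorial_mul_sorted hkey hfm]
  · rw [hf, lintegral_indicator hBm]
    refine setLIntegral_congr_fun hBm fun z hz => ?_
    rw [abs_of_nonneg (det_powMatrix_nonneg fun k => (hz k trivial).1)]
  · intro σ z
    have : z ∘ σ ∈ halfBox n ↔ z ∈ halfBox n := by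
      simp only [halfBox, Set.mem_univ_pi, Function.comp_apply]
      exact ⟨fun h i => by simpa using h (σ.symm i), fun h i => h _⟩
    by_cases hx : z ∈ halfBox n
    · rw [hf, Set.indicator_of_mem hx, Set.indicator_of_mem (this.2 hx), abs_det_powMatrix_comp_perm]
    · rw [hf, Set.indicator_of_notMem hx, Set.indicator_of_notMem (mt this.1 hx)]

end ComplexVolume

end PerronCount

namespace PerronCount

/-! ### Collapsing a signed sum over permutations of paired indices -/

section PairedDeterminant

variable {n : ℕ} {R : Type*} [CommRing R]

/-- The permutation acting by `π₀` on the first and by `π₁` on the second copy of `Fin n`, after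
permuting the two copies over `k` by `ε k`. -/
def pairPerm (ε : Fin n → Equiv.Perm (Fin 2)) (π₀ π₁ : Equiv.Perm (Fin n)) :
    Equiv.Perm (Fin 2 × Fin n) :=
  Equiv.prodCongrRight ![π₀, π₁] * Equiv.prodCongrLeft ε

lemma pairPerm_apply (ε : Fin n → Equiv.Perm (Fin 2)) (π₀ π₁ : Equiv.Perm (Fin n)) (b : Fin 2)
    (k : Fin n) : pairPerm ε π₀ π₁ (b, k) = (ε k b, (![π₀, π₁] : Fin 2 → _) (ε k b) k) := rfl

lemma sign_pairPerm (ε : Fin n → Equiv.Perm (Fin 2)) (π₀ π₁ : Equiv.Perm (Fin n)) :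
    Equiv.Perm.sign (pairPerm ε π₀ π₁) =
      (∏ k, Equiv.Perm.sign (ε k)) * (Equiv.Perm.sign π₀ * Equiv.Perm.sign π₁) := by
  rw [pairPerm, Equiv.Perm.sign_mul, Equiv.Perm.sign_prodCongrRight,
    Equiv.Perm.sign_prodCongrLeft, Fin.prod_univ_two, mul_comm]
  rfl

lemma pairPerm_injective : Function.Injective
    fun p : (Fin n → Equiv.Perm (Fin 2)) × Equiv.Perm (Fin n) × Equiv.Perm (Fin n) =>
      pairPerm p.1 p.2.1 p.2.2 := by
  rintro ⟨ε, π₀, π₁⟩ ⟨ε', π₀', π₁'⟩ h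
  have h1 : ∀ b k, (ε k b, (![π₀, π₁] : Fin 2 → _) (ε k b) k) =
      (ε' k b, (![π₀', π₁'] : Fin 2 → _) (ε' k b) k) := fun b k => by
    rw [← pairPerm_apply, ← pairPerm_apply]
    exact congrArg (fun σ : Equiv.Perm (Fin 2 × Fin n) => σ (b, k)) h
  have hε : ε = ε' := funext fun k => Equiv.ext fun b => (Prod.mk.inj (h1 b k)).1
  subst hε
  have h2 : ∀ c k, (![π₀, π₁] : Fin 2 → Equiv.Perm (Fin n)) c k =
      (![π₀', π₁'] : Fin 2 → Equiv.Perm (Fin n)) c k := fun c k => by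
    simpa using (Prod.mk.inj (h1 ((ε k).symm c) k)).2
  have h3 : π₀ = π₀' := Equiv.ext fun k => h2 0 k
  have h4 : π₁ = π₁' := Equiv.ext fun k => h2 1 k
  rw [h3, h4]

/-- If the two images over every `k` have different first components, these components define a
permutation `ε k`, and following each component over all `k` defines `π₀` and `π₁`. -/
lemma exists_pairPerm_eq {σ : Equiv.Perm (Fin 2 × Fin n)}
    (hσ : ∀ k, (σ (0, k)).1 ≠ (σ (1, k)).1) : ∃ ε π₀ π₁, pairPerm ε π₀ π₁ = σ := by
  have hinj : ∀ k, Function.Injective fun b : Fin 2 => (σ (b, k)).1 := by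
    intro k b c hbc
    have := hσ k
    fin_cases b <;> fin_cases c
    · rfl
    · exact absurd hbc this
    · exact absurd hbc.symm this
    · rfl
  set ε : Fin n → Equiv.Perm (Fin 2) := fun k =>
    Equiv.ofBijective _ (Finite.injective_iff_bijective.1 (hinj k)) with hε
  have hεa : ∀ k b, ε k b = (σ (b, k)).1 := fun k b => rfl
  have hπ : ∀ c, Function.Injective fun k => (σ ((ε k).symm c, k)).2 := by
    intro c k l hkl
    have h1 : σ ((ε k).symm c, k) = σ ((ε l).symm c, l) := by
      refine Prod.ext ?_ hkl
      rw [← hεa, ← hεa, Equiv.apply_symm_apply, Equiv.apply_symm_apply]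
    exact (Prod.mk.inj (σ.injective h1)).2
  set π : Fin 2 → Equiv.Perm (Fin n) := fun c =>
    Equiv.ofBijective _ (Finite.injective_iff_bijective.1 (hπ c)) with hπd
  have hπa : ∀ c k, π c k = (σ ((ε k).symm c, k)).2 := fun c k => rfl
  refine ⟨ε, π 0, π 1, Equiv.ext fun ⟨b, k⟩ => ?_⟩
  have hvec : (![π 0, π 1] : Fin 2 → Equiv.Perm (Fin n)) = π := by
    funext c; fin_cases c <;> rfl
  rw [pairPerm_apply, hvec, hπa, Equiv.symm_apply_apply, hεa]

/-- A sum over permutations of `2n` objects which collapses to a determinant of size `n`. -/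
theorem sum_sign_mul_prod_pair (a : Fin 2 × Fin n → Fin 2 × Fin n → R)
    (ha : ∀ b p q, a (b, p) (b, q) = 0) :
    ∑ σ : Equiv.Perm (Fin 2 × Fin n), ((Equiv.Perm.sign σ : ℤ) : R) * ∏ k, a (σ (0, k)) (σ (1, k)) =
      n.factorial * (Matrix.of fun p q => a (0, p) (1, q) - a (1, q) (0, p)).det := by
  set B : Matrix (Fin n) (Fin n) R := Matrix.of fun p q => a (0, p) (1, q) - a (1, q) (0, p) with hB
  set g : Equiv.Perm (Fin 2 × Fin n) → R := fun σ =>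
    ((Equiv.Perm.sign σ : ℤ) : R) * ∏ k, a (σ (0, k)) (σ (1, k)) with hg
  -- A permutation outside the image of `pairPerm` sends some pair to indices with the same first
  -- component, where `a` vanishes.
  have h1 : ∑ p : (Fin n → Equiv.Perm (Fin 2)) × Equiv.Perm (Fin n) × Equiv.Perm (Fin n),
      g (pairPerm p.1 p.2.1 p.2.2) = ∑ σ, g σ := by
    refine Finset.sum_of_injOn (fun p => pairPerm p.1 p.2.1 p.2.2) pairPerm_injective.injOn
      (fun _ _ => Finset.mem_coe.2 (Finset.mem_univ _)) (fun σ _ hσ => ?_) fun _ _ => rfl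
    have h2 : ∃ k, (σ (0, k)).1 = (σ (1, k)).1 := by
      by_contra! hcon
      obtain ⟨ε, π₀, π₁, h⟩ := exists_pairPerm_eq hcon
      exact hσ ⟨(ε, π₀, π₁), Finset.mem_coe.2 (Finset.mem_univ _), h⟩
    obtain ⟨k, hk⟩ := h2
    have h3 : a (σ (0, k)) (σ (1, k)) = 0 := by
      have := ha (σ (1, k)).1 (σ (0, k)).2 (σ (1, k)).2
      rw [← hk] at this
      convert! this using 2
      rw [hk]
    rw [hg]
    simp only
    rw [Finset.prod_eq_zero (Finset.mem_univ k) h3, mul_zero]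
  -- Summing over the swaps independently at each `k` antisymmetrizes `a` into the entries of `B`.
  have h4 : ∀ π₀ π₁ : Equiv.Perm (Fin n), ∑ ε : Fin n → Equiv.Perm (Fin 2),
      g (pairPerm ε π₀ π₁) = ((Equiv.Perm.sign π₀ : ℤ) : R) * ((Equiv.Perm.sign π₁ : ℤ) : R) *
        ∏ k, B (π₀ k) (π₁ k) := by
    intro π₀ π₁
    have h5 : ∀ k, B (π₀ k) (π₁ k) = ∑ e : Equiv.Perm (Fin 2), ((Equiv.Perm.sign e : ℤ) : R) *
        a (e 0, (![π₀, π₁] : Fin 2 → Equiv.Perm (Fin n)) (e 0) k)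
          (e 1, (![π₀, π₁] : Fin 2 → Equiv.Perm (Fin n)) (e 1) k) := by
      intro k
      rw [Finset.sum_eq_add_of_mem (a := 1) (b := Equiv.swap 0 1) (Finset.mem_univ _)
        (Finset.mem_univ _) (by decide)]
      · simp [hB, sub_eq_add_neg]
      · intro e _ he
        exact absurd he (by revert e; decide)
    rw [Finset.prod_congr rfl fun k _ => h5 k, Finset.prod_univ_sum, Finset.mul_sum]
    refine Finset.sum_congr (by simp) fun ε _ => ?_
    rw [hg]
    simp only [pairPerm_apply, sign_pairPerm, Finset.prod_mul_distrib]
    push_cast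
    ring
  -- For each fixed `π₁` the sum over `π₀` is the same determinant, whence the factor `n!`.
  have h6 : ∀ π₁ : Equiv.Perm (Fin n), ∑ π₀ : Equiv.Perm (Fin n), ((Equiv.Perm.sign π₀ : ℤ) : R) *
      ((Equiv.Perm.sign π₁ : ℤ) : R) * ∏ k, B (π₀ k) (π₁ k) = B.det := by
    intro π₁
    have h7 := Matrix.det_permute' π₁ B
    rw [Matrix.det_apply'] at h7
    simp only [Matrix.submatrix_apply, id] at h7
    simp only [mul_right_comm _ (((Equiv.Perm.sign π₁ : ℤ) : R)), ← Finset.sum_mul]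
    rw [h7, mul_right_comm, ← Int.cast_mul, ← Units.val_mul, Int.units_mul_self]
    simp
  rw [← h1, Fintype.sum_prod_type_right, Fintype.sum_prod_type_right]
  simp only [h4, h6, Finset.sum_const, Finset.card_univ, Fintype.card_perm, Fintype.card_fin,
    nsmul_eq_mul]

end PairedDeterminant

/-! ### The Cauchy determinant -/

section CauchyDeterminant

open Polynomial

variable {n : ℕ}

/-- The absolute value of a Cauchy determinant. -/
theorem abs_det_cauchy {x y : Fin n → ℝ} (hx : Function.Injective x) (hxy : ∀ p q, y q ≠ x p) :
    |(Matrix.of fun p q => 1 / (y q - x p)).det| * ∏ p, ∏ q, |y q - x p| = absDisc x * absDisc y := by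
  -- The unnormalized Lagrange polynomials at the nodes `x`. Evaluated at `x` they give a diagonal
  -- matrix; evaluated at `y`, the Cauchy matrix with scaled columns. Comparing determinants
  -- eliminates the coefficient matrix `c`.
  set P : Fin n → ℝ[X] := fun p => ∏ k ∈ {p}ᶜ, (X - C (x k)) with hP
  have hdeg : ∀ p, (P p).natDegree < n := by
    intro p
    rw [natDegree_prod_of_monic _ _ fun j _ => monic_X_sub_C _]
    simp only [natDegree_X_sub_C, Finset.sum_const, Finset.card_compl, Fintype.card_fin,
      Finset.card_singleton, smul_eq_mul, mul_one]
    have := p.2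
    omega
  set c : Matrix (Fin n) (Fin n) ℝ := Matrix.of fun p m => (P p).coeff m with hc
  have heval : ∀ p (t : ℝ), ∑ m : Fin n, c p m * t ^ (m : ℕ) = ∏ k ∈ {p}ᶜ, (t - x k) := by
    intro p t
    have h1 : (P p).eval t = ∏ k ∈ {p}ᶜ, (t - x k) := by simp [hP, eval_prod]
    rw [← h1, eval_eq_sum_range' (hdeg p), Finset.sum_range]
    rfl
  have h1 : c * (Matrix.vandermonde x).transpose =
      Matrix.diagonal fun p => ∏ k ∈ {p}ᶜ, (x p - x k) := by
    ext p q
    rw [Matrix.mul_apply]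
    simp only [Matrix.transpose_apply, Matrix.vandermonde_apply]
    rw [heval]
    by_cases hpq : p = q
    · subst hpq; simp
    · rw [Matrix.diagonal_apply_ne _ hpq]
      exact Finset.prod_eq_zero (i := q) (by simpa using Ne.symm hpq) (sub_self _)
  have h2 : c * (Matrix.vandermonde y).transpose =
      (Matrix.of fun p q => 1 / (y q - x p)) * Matrix.diagonal fun q => ∏ p, (y q - x p) := by
    ext p q
    rw [Matrix.mul_apply, Matrix.mul_diagonal]
    simp only [Matrix.transpose_apply, Matrix.vandermonde_apply, Matrix.of_apply]
    rw [heval, ← Finset.prod_mul_prod_compl {p} fun p => y q - x p, Finset.prod_singleton,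
      ← mul_assoc, one_div_mul_cancel (sub_ne_zero.2 (hxy p q)), one_mul]
  have h3 := congrArg (fun A : Matrix (Fin n) (Fin n) ℝ => |A.det|) h1
  have h4 := congrArg (fun A : Matrix (Fin n) (Fin n) ℝ => |A.det|) h2
  simp only [Matrix.det_mul, Matrix.det_transpose, Matrix.det_diagonal, abs_mul] at h3 h4
  rw [Finset.abs_prod, prod_abs_sub_eq, sq] at h3
  have h5 : absDisc x ≠ 0 := abs_ne_zero.2 (Matrix.det_vandermonde_ne_zero_iff.2 hx)
  have h6 : |c.det| = absDisc x := mul_right_cancel₀ h5 h3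
  rw [h6] at h4
  rw [Finset.prod_comm]
  simp only [Finset.abs_prod] at h4
  exact h4.symm

end CauchyDeterminant

end PerronCount

namespace PerronCount

open MeasureTheory
open scoped Topology ENNReal ComplexConjugate

/-! ### Moments of the half disc and the integral of the determinant -/

section HalfDiscMoments

variable {n : ℕ}

lemma restrict_halfBox (n : ℕ) : (volume : Measure (Fin n → ℂ)).restrict (halfBox n) =
    Measure.pi fun _ => volume.restrict halfDisc := by
  rw [halfBox, volume_pi, Measure.restrict_pi_pi]

lemma integrableOn_halfBox {f : (Fin n → ℂ) → ℝ} (hf : Continuous f) :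
    IntegrableOn f (halfBox n) := by
  refine (hf.continuousOn.integrableOn_compact
    (isCompact_univ_pi fun _ => isCompact_closedBall (0 : ℂ) 1)).mono_set ?_
  refine Set.pi_mono fun _ _ z hz => ?_
  rw [mem_closedBall_zero_iff]
  exact hz.2.le

lemma integrableOn_halfDisc {f : ℂ → ℝ} (hf : Continuous f) : IntegrableOn f halfDisc := by
  refine (hf.continuousOn.integrableOn_compact (isCompact_closedBall (0 : ℂ) 1)).mono_set ?_
  intro z hz
  rw [mem_closedBall_zero_iff]
  exact hz.2.le

/-- The integral of `Re (z ^ j) * Im (z ^ l)` over the half disc. -/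
noncomputable def pairMoment (j l : ℕ) : ℝ := ∫ z in halfDisc, (z ^ j).re * (z ^ l).im

/-- The reflection `z ↦ -conj z` preserves the half disc and multiplies the integrand by `-(-1) ^ (j
+ l)`. -/
lemma pairMoment_eq_zero {j l : ℕ} (h : Even (j + l)) : pairMoment j l = 0 := by
  set φ : ℂ ≃ₗᵢ[ℝ] ℂ := Complex.conjLIE.trans (LinearIsometryEquiv.neg ℝ) with hφ
  have hφa : ∀ z, φ z = -conj z := fun z => rfl
  have h1 : φ ⁻¹' halfDisc = halfDisc := by
    ext z
    simp [halfDisc, hφa]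
  have h2 := φ.measurePreserving.setIntegral_preimage_emb
    φ.toHomeomorph.measurableEmbedding (fun z => (z ^ j).re * (z ^ l).im) halfDisc
  have h3 : ∀ z : ℂ, (φ z ^ j).re * (φ z ^ l).im = -((z ^ j).re * (z ^ l).im) := fun z => by
    have h4 : ∀ m : ℕ, φ z ^ m = ((-1 : ℝ) ^ m : ℝ) * conj (z ^ m) := fun m => by
      rw [hφa, neg_pow, map_pow]; push_cast; ring
    rw [h4, h4, Complex.re_ofReal_mul, Complex.im_ofReal_mul, Complex.conj_re, Complex.conj_im]
    have h5 : (-1 : ℝ) ^ j * (-1) ^ l = 1 := by rw [← pow_add]; exact h.neg_one_pow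
    linear_combination (-((z ^ j).re * (z ^ l).im)) * h5
  simp only [h1, h3, integral_neg] at h2
  rw [pairMoment]
  linarith

lemma integral_halfDisc_polar (m : ℕ) {d : ℝ} (hd : d ≠ 0) {g : ℂ → ℝ}
    (hg : ∀ r θ : ℝ, g (r * Complex.exp (θ * Complex.I)) = r ^ m * Real.sin (d * θ)) :
    ∫ z in halfDisc, g z = 1 / (m + 2) * ((1 - Real.cos (d * Real.pi)) / d) := by
  rw [← integral_indicator measurableSet_halfDisc, ← Complex.integral_comp_polarCoord_symm]
  have h1 : ∀ p ∈ polarCoord.target, p.1 • halfDisc.indicator g (Complex.polarCoord.symm p) =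
      (Set.Ioo (0 : ℝ) 1 ×ˢ Set.Ioo 0 Real.pi).indicator
        (fun p => p.1 ^ (m + 1) * Real.sin (d * p.2)) p := by
    rintro ⟨r, θ⟩ hp
    rw [polarCoord_target] at hp
    obtain ⟨hr, hθ⟩ := hp
    simp only [Set.mem_Ioi, Set.mem_Ioo] at hr hθ
    have hz : Complex.polarCoord.symm (r, θ) = r * Complex.exp (θ * Complex.I) := by
      rw [Complex.polarCoord_symm_apply, Complex.exp_mul_I, Complex.ofReal_cos, Complex.ofReal_sin]
    have him : (r * Complex.exp (θ * Complex.I)).im = r * Real.sin θ := by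
      rw [Complex.im_ofReal_mul, Complex.exp_ofReal_mul_I_im]
    have hnorm : ‖(r * Complex.exp (θ * Complex.I) : ℂ)‖ = r := by
      rw [norm_mul, Complex.norm_exp_ofReal_mul_I, mul_one, Complex.norm_real, Real.norm_eq_abs,
        abs_of_pos hr]
    have hiff : (r * Complex.exp (θ * Complex.I) : ℂ) ∈ halfDisc ↔
        (r, θ) ∈ Set.Ioo (0 : ℝ) 1 ×ˢ Set.Ioo 0 Real.pi := by
      simp only [halfDisc, Set.mem_ofPred_eq, him, hnorm, Set.mem_prod, Set.mem_Ioo]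
      constructor
      · rintro ⟨h2, h3⟩
        refine ⟨⟨hr, h3⟩, ?_, hθ.2⟩
        by_contra hcon
        have := Real.sin_nonpos_of_nonpos_of_neg_pi_le (not_lt.1 hcon) hθ.1.le
        nlinarith
      · rintro ⟨h2, h3⟩
        exact ⟨mul_pos hr (Real.sin_pos_of_mem_Ioo h3), h2.2⟩
    rw [hz]
    by_cases hmem : (r, θ) ∈ Set.Ioo (0 : ℝ) 1 ×ˢ Set.Ioo 0 Real.pi
    · rw [Set.indicator_of_mem hmem, Set.indicator_of_mem (hiff.2 hmem), hg, smul_eq_mul]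
      ring
    · rw [Set.indicator_of_notMem hmem, Set.indicator_of_notMem (mt hiff.1 hmem), smul_zero]
  have hms : MeasurableSet (Set.Ioo (0 : ℝ) 1 ×ˢ Set.Ioo 0 Real.pi) :=
    measurableSet_Ioo.prod measurableSet_Ioo
  have hsub : Set.Ioo (0 : ℝ) 1 ×ˢ Set.Ioo 0 Real.pi ⊆ polarCoord.target := by
    rw [polarCoord_target]
    exact Set.prod_mono Set.Ioo_subset_Ioi_self
      (Set.Ioo_subset_Ioo_left (by linarith [Real.pi_pos]))
  rw [setIntegral_congr_fun polarCoord.open_target.measurableSet h1, setIntegral_indicator hms,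
    Set.inter_eq_right.2 hsub, Measure.volume_eq_prod,
    setIntegral_prod_mul (fun r : ℝ => r ^ (m + 1)) fun θ => Real.sin (d * θ)]
  congr 1
  · rw [← integral_Ioc_eq_integral_Ioo, ← intervalIntegral.integral_of_le zero_le_one, integral_pow]
    push_cast
    ring
  · rw [← integral_Ioc_eq_integral_Ioo, ← intervalIntegral.integral_of_le Real.pi_pos.le,
      intervalIntegral.integral_comp_mul_left _ hd, integral_sin, smul_eq_mul, mul_zero,
      Real.cos_zero, div_eq_inv_mul]

/-- The difference integrates `Im (conj (z ^ (2 * p)) * z ^ (2 * q + 1))`, which is a power of `r`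
times `sin (d * θ)` with `d` odd. The radial and angular integrals produce the two factors of the
difference of squares. -/
lemma pairMoment_sub (p q : ℕ) : pairMoment (2 * p) (2 * q + 1) - pairMoment (2 * q + 1) (2 * p) =
    2 * (1 / ((2 * q + 2 : ℝ) ^ 2 - (2 * p + 1 : ℝ) ^ 2)) := by
  set d : ℝ := 2 * q + 1 - 2 * p with hd
  have hd' : d = ((2 * ((q : ℤ) - p) + 1 : ℤ) : ℝ) := by rw [hd]; push_cast; ring
  have hd0 : d ≠ 0 := by
    rw [hd']
    have : (2 * ((q : ℤ) - p) + 1 : ℤ) ≠ 0 := by omega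
    exact_mod_cast this
  have hcos : Real.cos (d * Real.pi) = -1 := by
    rw [hd', Real.cos_int_mul_pi]
    exact Odd.neg_one_zpow ⟨(q : ℤ) - p, rfl⟩
  have h1 : pairMoment (2 * p) (2 * q + 1) - pairMoment (2 * q + 1) (2 * p) =
      ∫ z in halfDisc, (conj (z ^ (2 * p)) * z ^ (2 * q + 1)).im := by
    rw [pairMoment, pairMoment, ← integral_sub (integrableOn_halfDisc (by fun_prop))
      (integrableOn_halfDisc (by fun_prop))]
    refine integral_congr_ae (ae_of_all _ fun z => ?_)
    simp only [Complex.mul_im, Complex.conj_re, Complex.conj_im]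
    ring
  rw [h1, integral_halfDisc_polar (2 * p + (2 * q + 1)) hd0, hcos]
  · have h2 : (2 * q + 2 : ℝ) ^ 2 - (2 * p + 1 : ℝ) ^ 2 = d * (2 * p + 2 * q + 3) := by
      rw [hd]; ring
    rw [h2]
    have h3 : (2 * p + 2 * q + 3 : ℝ) ≠ 0 := by positivity
    push_cast
    have h4 : (2 * p + (2 * q + 1) + 2 : ℝ) ≠ 0 := by positivity
    field_simp
    ring
  · intro r θ
    have h2 : conj (((r : ℂ) * Complex.exp (θ * Complex.I)) ^ (2 * p)) *
        ((r : ℂ) * Complex.exp (θ * Complex.I)) ^ (2 * q + 1) =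
        ((r ^ (2 * p + (2 * q + 1)) : ℝ) : ℂ) * Complex.exp ((d * θ : ℝ) * Complex.I) := by
      rw [map_pow, map_mul, Complex.conj_ofReal, ← Complex.exp_conj, map_mul, Complex.conj_ofReal,
        Complex.conj_I, mul_pow, mul_pow, ← Complex.exp_nat_mul, ← Complex.exp_nat_mul,
        mul_mul_mul_comm, ← Complex.exp_add, ← pow_add]
      push_cast
      congr 2
      rw [hd]
      push_cast
      ring
    rw [h2, Complex.im_ofReal_mul, Complex.exp_ofReal_mul_I_im]

/-- The Leibniz expansion with each exponent written as `b + 2 * p`, so that its parity becomes the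
first component used in `sum_sign_mul_prod_pair`. -/
lemma det_powMatrix_eq_sum (z : Fin n → ℂ) : (powMatrix z).det =
    ∑ σ : Equiv.Perm (Fin 2 × Fin n), ((Equiv.Perm.sign σ : ℤ) : ℝ) *
      ∏ k, (z k ^ ((σ (0, k)).1 + 2 * (σ (0, k)).2 : ℕ)).re *
        (z k ^ ((σ (1, k)).1 + 2 * (σ (1, k)).2 : ℕ)).im := by
  set e : Fin 2 × Fin n ≃ Fin (n * 2) := (Equiv.prodComm _ _).trans finProdFinEquiv with he
  have hev : ∀ i, ((e i : Fin (n * 2)) : ℕ) = i.1 + 2 * i.2 := fun i => by simp [he]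
  rw [← Matrix.det_transpose, ← Matrix.det_submatrix_equiv_self e, Matrix.det_apply']
  refine Finset.sum_congr rfl fun σ _ => ?_
  congr 1
  rw [Fintype.prod_prod_type, Fin.prod_univ_two, ← Finset.prod_mul_distrib]
  refine Finset.prod_congr rfl fun k _ => ?_
  simp only [Matrix.submatrix_apply, Matrix.transpose_apply]
  rw [show e (0, k) = finProdFinEquiv (k, 0) from rfl,
    show e (1, k) = finProdFinEquiv (k, 1) from rfl, powMatrix_zero, powMatrix_one, hev, hev]

/-- Each Leibniz term is a product of functions of single variables, hence integrates to a product
of moments. Moments of exponents of equal parity vanish, so the sum collapses to a Cauchy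
determinant in even and odd squares. -/
lemma integral_det_powMatrix (n : ℕ) : ∫ z in halfBox n, (powMatrix z).det =
    n.factorial * (2 ^ n * (Matrix.of fun p q : Fin n =>
      1 / ((2 * q + 2 : ℝ) ^ 2 - (2 * p + 1 : ℝ) ^ 2)).det) := by
  simp only [det_powMatrix_eq_sum]
  rw [integral_finsetSum _ fun σ _ => integrableOn_halfBox (by fun_prop)]
  simp only [integral_const_mul, restrict_halfBox]
  have h1 : ∀ σ : Equiv.Perm (Fin 2 × Fin n),
      ∫ z : Fin n → ℂ, (∏ k, (z k ^ ((σ (0, k)).1 + 2 * (σ (0, k)).2 : ℕ)).re *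
        (z k ^ ((σ (1, k)).1 + 2 * (σ (1, k)).2 : ℕ)).im)
        ∂(Measure.pi fun _ => volume.restrict halfDisc) =
      ∏ k, pairMoment ((σ (0, k)).1 + 2 * (σ (0, k)).2) ((σ (1, k)).1 + 2 * (σ (1, k)).2) :=
    fun σ => integral_fintype_prod_eq_prod (fun k (w : ℂ) =>
      (w ^ ((σ (0, k)).1 + 2 * (σ (0, k)).2 : ℕ)).re * (w ^ ((σ (1, k)).1 + 2 * (σ (1, k)).2 : ℕ)).im)
  simp only [h1]
  rw [sum_sign_mul_prod_pair fun i j : Fin 2 × Fin n => pairMoment (i.1 + 2 * i.2) (j.1 + 2 * j.2)]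
  · congr 1
    have h2 : (2 : ℝ) ^ n = 2 ^ Fintype.card (Fin n) := by rw [Fintype.card_fin]
    rw [h2, ← Matrix.det_smul]
    congr 1
    ext p q
    simp only [Matrix.of_apply, Matrix.smul_apply, smul_eq_mul]
    rw [← pairMoment_sub]
    simp only [Fin.val_zero, Fin.val_one, zero_add, add_comm 1]
  · intro b p q
    exact pairMoment_eq_zero ⟨b + p + q, by ring⟩

end HalfDiscMoments

/-! ### Evaluation of the totally complex constant -/

section ComplexConstant

/-- The product of the first `m` odd numbers. -/
def oddProd (m : ℕ) : ℝ := ∏ i ∈ Finset.range m, (2 * i + 1 : ℝ)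

lemma oddProd_pos (m : ℕ) : 0 < oddProd m := Finset.prod_pos fun i _ => by positivity

lemma oddProd_add (m k : ℕ) :
    oddProd (m + k) = oddProd m * ∏ i ∈ Finset.range k, (2 * (m + i) + 1 : ℝ) := by
  rw [oddProd, Finset.prod_range_add]
  push_cast
  rfl

lemma oddProd_succ (m : ℕ) : oddProd (m + 1) = oddProd m * (2 * m + 1) := by
  rw [oddProd, Finset.prod_range_succ]; rfl

lemma oddProd_reflect (m : ℕ) : ∏ i ∈ Finset.range m, (2 * m - 1 - 2 * i : ℝ) = oddProd m := by
  rw [oddProd, ← Finset.prod_range_reflect]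
  refine Finset.prod_congr rfl fun i hi => ?_
  rw [Finset.mem_range] at hi
  rw [Nat.cast_sub (by omega), Nat.cast_sub (by omega)]
  push_cast
  ring

lemma oddProd_mul_factorial (m : ℕ) :
    oddProd (m + 1) * (2 ^ m * m.factorial) = ((2 * m + 1).factorial : ℝ) := by
  induction m with
  | zero => simp [oddProd]
  | succ m ih =>
    rw [show 2 * (m + 1) + 1 = 2 * m + 1 + 1 + 1 by ring, Nat.factorial_succ (2 * m + 1 + 1),
      Nat.factorial_succ (2 * m + 1), Nat.factorial_succ m, oddProd_succ]
    push_cast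
    rw [← ih]
    ring

lemma prod_range_sub_self (n : ℕ) : ∏ i ∈ Finset.range n, ((n : ℝ) - i) = n.factorial := by
  rw [← Nat.descFactorial_self, Nat.descFactorial_eq_prod_range, Nat.cast_prod]
  refine Finset.prod_congr rfl fun i hi => ?_
  rw [Nat.cast_sub (Finset.mem_range.1 hi).le]

lemma factorial_mul_prod_range (m k : ℕ) :
    (m.factorial : ℝ) * ∏ i ∈ Finset.range k, ((m : ℝ) + 1 + i) = (m + k).factorial := by
  rw [← Nat.factorial_mul_ascFactorial, Nat.ascFactorial_eq_prod_range]
  push_cast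
  rfl

/-- As in the next three products, each difference of squares splits into two linear factors, and
each family of linear factors is a piece of a factorial or of an odd factorial. -/
lemma prod_abs_odd_sq_sub (n : ℕ) :
    ∏ p ∈ Finset.range n, |(2 * p + 1 : ℝ) ^ 2 - (2 * n + 1) ^ 2| =
      4 ^ n * ((2 * n).factorial : ℝ) := by
  have h1 : ∀ p ∈ Finset.range n, |(2 * p + 1 : ℝ) ^ 2 - (2 * n + 1) ^ 2| =
      4 * (((n : ℝ) - p) * (n + 1 + p)) := fun p hp => by
    have hp' : (p : ℝ) < n := by exact_mod_cast Finset.mem_range.1 hp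
    rw [abs_of_neg (by nlinarith)]
    ring
  rw [Finset.prod_congr rfl h1, Finset.prod_mul_distrib, Finset.prod_const, Finset.card_range,
    Finset.prod_mul_distrib, prod_range_sub_self, factorial_mul_prod_range, ← two_mul]

lemma prod_abs_even_sq_sub (n : ℕ) :
    (∏ q ∈ Finset.range n, |(2 * q + 2 : ℝ) ^ 2 - (2 * n + 2) ^ 2|) * (n + 1) =
      4 ^ n * ((2 * n + 1).factorial : ℝ) := by
  have h1 : ∀ q ∈ Finset.range n, |(2 * q + 2 : ℝ) ^ 2 - (2 * n + 2) ^ 2| =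
      4 * (((n : ℝ) - q) * (((n + 1 : ℕ) : ℝ) + 1 + q)) := fun p hp => by
    have hp' : (p : ℝ) < n := by exact_mod_cast Finset.mem_range.1 hp
    rw [abs_of_neg (by nlinarith)]
    push_cast
    ring
  have h2 := factorial_mul_prod_range (n + 1) n
  rw [show n + 1 + n = 2 * n + 1 by ring, Nat.factorial_succ n] at h2
  rw [Finset.prod_congr rfl h1, Finset.prod_mul_distrib, Finset.prod_const, Finset.card_range,
    Finset.prod_mul_distrib, prod_range_sub_self, ← h2]
  push_cast
  ring

lemma prod_abs_even_sq_sub_odd_sq (n : ℕ) :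
    ∏ p ∈ Finset.range (n + 1), |(2 * n + 2 : ℝ) ^ 2 - (2 * p + 1) ^ 2| = oddProd (2 * n + 2) := by
  have h1 : ∀ p ∈ Finset.range (n + 1), |(2 * n + 2 : ℝ) ^ 2 - (2 * p + 1) ^ 2| =
      (2 * ((n + 1 : ℕ) : ℝ) - 1 - 2 * p) * (2 * (((n + 1 : ℕ) : ℝ) + p) + 1) := fun p hp => by
    have hp' : (p : ℝ) ≤ n := by exact_mod_cast Finset.mem_range_succ_iff.1 hp
    rw [abs_of_pos (by nlinarith)]
    push_cast
    ring
  rw [Finset.prod_congr rfl h1, Finset.prod_mul_distrib, oddProd_reflect, ← oddProd_add]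
  congr 1
  ring

lemma prod_abs_even_sq_sub_odd_sq' (n : ℕ) :
    (∏ q ∈ Finset.range n, |(2 * q + 2 : ℝ) ^ 2 - (2 * n + 1) ^ 2|) * (2 * n + 1) =
      oddProd (2 * n + 1) := by
  have h1 : ∀ q ∈ Finset.range n, |(2 * q + 2 : ℝ) ^ 2 - (2 * n + 1) ^ 2| =
      (2 * (n : ℝ) - 1 - 2 * q) * (2 * (((n + 1 : ℕ) : ℝ) + q) + 1) := fun q hq => by
    have hq' : (q : ℝ) + 1 ≤ n := by exact_mod_cast Finset.mem_range.1 hq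
    rw [abs_of_neg (by nlinarith)]
    push_cast
    ring
  rw [Finset.prod_congr rfl h1, Finset.prod_mul_distrib, oddProd_reflect, mul_right_comm,
    ← oddProd_succ, ← oddProd_add]
  congr 1
  ring

lemma absDisc_snoc {n : ℕ} (y : Fin n → ℝ) (t : ℝ) :
    absDisc (Fin.snoc y t : Fin (n + 1) → ℝ) = (∏ j, |y j - t|) * absDisc y := by
  rw [← absDisc_cons, Fin.snoc_eq_cons_rotate]
  exact absDisc_comp_perm _ _

lemma absDisc_fin_succ (f : ℕ → ℝ) (n : ℕ) : absDisc (fun i : Fin (n + 1) => f i) =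
    (∏ j ∈ Finset.range n, |f j - f n|) * absDisc fun i : Fin n => f i := by
  have : (fun i : Fin (n + 1) => f i) = (Fin.snoc (fun i : Fin n => f i) (f n) : Fin (n + 1) → ℝ) := by
    funext i
    refine Fin.lastCases ?_ (fun j => ?_) i <;> simp
  rw [this, absDisc_snoc, Finset.prod_range]

lemma DComplex_succ (n : ℕ) : DComplex (n + 1) = DComplex n *
    (2 ^ (4 * n) * ((2 * n + 2) * (2 * n + 1)) / (n + 1 : ℝ) ^ 2 *
      ((2 : ℝ) ^ (2 * n + 1) * ((2 * n).factorial : ℝ) ^ 2 / ((4 * n + 1).factorial : ℝ)) *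
      ((2 : ℝ) ^ (2 * n + 2) * ((2 * n + 1).factorial : ℝ) ^ 2 / ((4 * n + 3).factorial : ℝ))) := by
  have h1 : 2 * (n + 1) * (n + 1 - 1) = 2 * n * (n - 1) + 4 * n := by
    cases n with
    | zero => rfl
    | succ m => simp only [Nat.add_sub_cancel]; ring
  have h2 : ((2 * (n + 1)).factorial : ℝ) = (2 * n + 2) * (2 * n + 1) * (2 * n).factorial := by
    rw [show 2 * (n + 1) = 2 * n + 1 + 1 by ring, Nat.factorial_succ, Nat.factorial_succ]
    push_cast
    ring
  have h3 : ((n + 1).factorial : ℝ) = (n + 1) * n.factorial := by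
    rw [Nat.factorial_succ]; push_cast; ring
  rw [DComplex, DComplex, h1, h2, h3, show 2 * (n + 1) = 2 * n + 1 + 1 by ring, DReal_succ,
    DReal_succ, show 2 * (2 * n) + 1 = 4 * n + 1 by ring,
    show 2 * (2 * n + 1) + 1 = 4 * n + 3 by ring, pow_add 2 (2 * n * (n - 1))]
  have h4 : (n.factorial : ℝ) ≠ 0 := by positivity
  have h5 : ((n : ℝ) + 1) ≠ 0 := by positivity
  have h6 : ((4 * n + 1).factorial : ℝ) ≠ 0 := by positivity
  have h7 : ((4 * n + 3).factorial : ℝ) ≠ 0 := by positivity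
  field_simp

/-- Induction on `n`: both sides acquire explicit products when the last odd and even nodes are
added. The factor `8 ^ n` unites `4 ^ n` from the Jacobian with `2 ^ n` from the moments. -/
lemma DComplex_eq_absDisc (n : ℕ) :
    8 ^ n * ((absDisc fun p : Fin n => (2 * (p : ℕ) + 1 : ℝ) ^ 2) *
      absDisc fun q : Fin n => (2 * (q : ℕ) + 2 : ℝ) ^ 2) =
    DComplex n * ∏ p : Fin n, ∏ q : Fin n, |(2 * (q : ℕ) + 2 : ℝ) ^ 2 - (2 * (p : ℕ) + 1) ^ 2| := by
  induction n with
  | zero => simp [absDisc, DComplex, DReal]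
  | succ n ih =>
    have hX := absDisc_fin_succ (fun p => (2 * p + 1 : ℝ) ^ 2) n
    have hY := absDisc_fin_succ (fun p => (2 * p + 2 : ℝ) ^ 2) n
    have ha := prod_abs_odd_sq_sub n
    have hb := prod_abs_even_sq_sub n
    have hc := prod_abs_even_sq_sub_odd_sq n
    have hd := prod_abs_even_sq_sub_odd_sq' n
    have hH : ∏ p : Fin (n + 1), ∏ q : Fin (n + 1),
        |(2 * (q : ℕ) + 2 : ℝ) ^ 2 - (2 * (p : ℕ) + 1) ^ 2| =
        (∏ p : Fin n, ∏ q : Fin n, |(2 * (q : ℕ) + 2 : ℝ) ^ 2 - (2 * (p : ℕ) + 1) ^ 2|) *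
        (∏ p ∈ Finset.range (n + 1), |(2 * n + 2 : ℝ) ^ 2 - (2 * p + 1) ^ 2|) *
        ∏ q ∈ Finset.range n, |(2 * q + 2 : ℝ) ^ 2 - (2 * n + 1) ^ 2| := by
      rw [Fin.prod_univ_castSucc]
      simp only [Fin.prod_univ_castSucc (n := n), Finset.prod_mul_distrib, Fin.val_castSucc,
        Fin.val_last, Finset.prod_range_succ]
      rw [← Finset.prod_range fun p => |(2 * n + 2 : ℝ) ^ 2 - (2 * (p : ℕ) + 1) ^ 2|,
        ← Finset.prod_range fun q => |(2 * (q : ℕ) + 2 : ℝ) ^ 2 - (2 * n + 1) ^ 2|]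
      ring
    rw [hX, hY, hH, DComplex_succ, ha, hc]
    have hn1 : ((n : ℝ) + 1) ≠ 0 := by positivity
    have hn2 : (2 * (n : ℝ) + 1) ≠ 0 := by positivity
    rw [← eq_div_iff hn1] at hb
    rw [← eq_div_iff hn2] at hd
    rw [hb, hd]
    have hf1 := oddProd_mul_factorial (2 * n)
    have hf2 := oddProd_mul_factorial (2 * n + 1)
    rw [show 2 * (2 * n) + 1 = 4 * n + 1 by ring] at hf1
    rw [show 2 * (2 * n + 1) + 1 = 4 * n + 3 by ring, show 2 * n + 1 + 1 = 2 * n + 2 by ring] at hf2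
    rw [← hf1, ← hf2]
    have ho1 := (oddProd_pos (2 * n + 1)).ne'
    have ho2 := (oddProd_pos (2 * n + 2)).ne'
    have hq1 : ((2 * n).factorial : ℝ) ≠ 0 := by positivity
    have hq2 : ((2 * n + 1).factorial : ℝ) ≠ 0 := by positivity
    have key : 8 * ((4 ^ n * ((2 * n).factorial : ℝ)) * (4 ^ n * ((2 * n + 1).factorial : ℝ) / (n + 1))) =
        (2 ^ (4 * n) * ((2 * n + 2) * (2 * n + 1)) / (n + 1 : ℝ) ^ 2 *
      ((2 : ℝ) ^ (2 * n + 1) * ((2 * n).factorial : ℝ) ^ 2 /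
        (oddProd (2 * n + 1) * (2 ^ (2 * n) * ((2 * n).factorial : ℝ)))) *
      ((2 : ℝ) ^ (2 * n + 2) * ((2 * n + 1).factorial : ℝ) ^ 2 /
        (oddProd (2 * n + 2) * (2 ^ (2 * n + 1) * ((2 * n + 1).factorial : ℝ))))) *
      (oddProd (2 * n + 2) * (oddProd (2 * n + 1) / (2 * n + 1))) := by
      have h4 : (4 : ℝ) ^ n = 2 ^ (2 * n) := by rw [pow_mul]; norm_num
      rw [h4]
      field_simp
      ring
    rw [pow_succ]
    linear_combination (8 * ((4 ^ n * ((2 * n).factorial : ℝ)) *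
      (4 ^ n * ((2 * n + 1).factorial : ℝ) / (n + 1)))) * ih +
      (DComplex n * ∏ p : Fin n, ∏ q : Fin n,
        |(2 * (q : ℕ) + 2 : ℝ) ^ 2 - (2 * (p : ℕ) + 1) ^ 2|) * key

theorem volume_unitRegion_noneReal (n : ℕ) :
    volume (unitRegion (n * 2) NoneReal) = ENNReal.ofReal (DComplex n) := by
  set Q : Matrix (Fin n) (Fin n) ℝ := Matrix.of fun p q : Fin n =>
    1 / ((2 * q + 2 : ℝ) ^ 2 - (2 * p + 1 : ℝ) ^ 2) with hQ
  have hcont : Continuous fun z : Fin n → ℂ => (powMatrix z).det := by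
    simp only [det_powMatrix_eq_sum]
    fun_prop
  have hpos : ∀ᵐ z ∂(volume : Measure (Fin n → ℂ)).restrict (halfBox n),
      0 ≤ 4 ^ n * (powMatrix z).det := by
    filter_upwards [ae_restrict_mem (measurableSet_halfBox n)] with z hz
    exact mul_nonneg (by positivity) (det_powMatrix_nonneg fun k => (hz k trivial).1)
  have h1 := factorial_mul_volume_unitRegion_noneReal n
  rw [← ofReal_integral_eq_lintegral_ofReal (integrableOn_halfBox (by fun_prop)) hpos,
    integral_const_mul, integral_det_powMatrix, ← hQ] at h1
  have h2 : 0 ≤ 4 ^ n * (n.factorial * (2 ^ n * Q.det)) := by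
    rw [hQ, ← integral_det_powMatrix, ← integral_const_mul]
    exact integral_nonneg_of_ae hpos
  -- The sign of the Cauchy determinant is read off from the integral of a nonnegative function.
  have h3 : 0 ≤ Q.det := by
    by_contra hcon
    have h4 : 0 < 4 ^ n * (n.factorial * (2 ^ n * -Q.det)) := by
      have : 0 < -Q.det := by linarith
      positivity
    linarith
  have hxy : ∀ p q : Fin n, (2 * (q : ℕ) + 2 : ℝ) ^ 2 ≠ (2 * (p : ℕ) + 1 : ℝ) ^ 2 := by
    intro p q h
    have h5 : (2 * (q : ℕ) + 2) ^ 2 = (2 * (p : ℕ) + 1) ^ 2 := by exact_mod_cast h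
    have h6 := Nat.pow_left_injective two_ne_zero h5
    omega
  have hinj : Function.Injective fun p : Fin n => (2 * (p : ℕ) + 1 : ℝ) ^ 2 := by
    intro p q h
    simp only at h
    have h5 : (2 * (p : ℕ) + 1) ^ 2 = (2 * (q : ℕ) + 1) ^ 2 := by exact_mod_cast h
    have h6 := Nat.pow_left_injective two_ne_zero h5
    exact Fin.ext (by omega)
  have h4 := abs_det_cauchy hinj hxy
  rw [← hQ, abs_of_nonneg h3] at h4
  have h5 := DComplex_eq_absDisc n
  rw [← h4] at h5
  have hH : ∏ p : Fin n, ∏ q : Fin n, |(2 * (q : ℕ) + 2 : ℝ) ^ 2 - (2 * (p : ℕ) + 1) ^ 2| ≠ 0 :=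
    Finset.prod_ne_zero_iff.2 fun p _ => Finset.prod_ne_zero_iff.2 fun q _ =>
      abs_ne_zero.2 (sub_ne_zero.2 (hxy p q))
  have h6 : 8 ^ n * Q.det = DComplex n := by
    refine mul_right_cancel₀ hH ?_
    linarith
  have h7 : 4 ^ n * (n.factorial * (2 ^ n * Q.det)) = n.factorial * DComplex n := by
    rw [← h6, show (8 : ℝ) = 4 * 2 by norm_num, mul_pow]
    ring
  rw [h7, ENNReal.ofReal_mul (by positivity), ENNReal.ofReal_natCast] at h1
  exact (ENNReal.mul_right_inj (by exact_mod_cast n.factorial_ne_zero)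
    (ENNReal.natCast_ne_top _)).1 h1

end ComplexConstant

end PerronCount

namespace PerronCount

lemma DReal_pos (N : ℕ) : 0 < DReal N := Finset.prod_pos fun k _ => by positivity

lemma DComplex_pos (n : ℕ) : 0 < DComplex n := by
  have := DReal_pos (2 * n)
  unfold DComplex
  positivity

end PerronCount

/-! ### Assembly of the four cases -/

open PerronCount MeasureTheory
theorem theorem1 (N : ℕ) (hN : 1 ≤ N) :
    PerronCount.CountAsymp N (PerronCount.algInt N) (PerronCount.D N) ∧
    PerronCount.CountAsymp N (PerronCount.algIntPerron N) (PerronCount.DPerron N) ∧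
    PerronCount.CountAsymp N (PerronCount.algIntReal N) (PerronCount.DReal N) ∧
    (∀ n : ℕ, N = 2 * n →
      PerronCount.CountAsymp N (PerronCount.algIntComplex N) (PerronCount.DComplex n)) := by
  refine ⟨?_, ?_, ?_, ?_⟩
  · rw [algInt_eq]
    refine countAsymp_of_type hN isLocallyConstantType_true isScaleInvariant_true (D_pos N) ?_
    rw [measureReal_def, volume_unitRegion_true, ENNReal.toReal_ofReal (D_pos N).le]
  · rw [algIntPerron_eq]
    refine countAsymp_of_type hN isLocallyConstantType_hasDominant isScaleInvariant_hasDominant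
      (DPerron_pos hN) ?_
    obtain ⟨M, rfl⟩ := Nat.exists_eq_add_of_le' hN
    rw [measureReal_def, volume_unitRegion_hasDominant, ENNReal.toReal_ofReal (DPerron_pos hN).le]
  · rw [algIntReal_eq]
    refine countAsymp_of_type hN isLocallyConstantType_allReal isScaleInvariant_allReal
      (DReal_pos N) ?_
    rw [measureReal_def, volume_unitRegion_allReal, ENNReal.toReal_ofReal (DReal_pos N).le]
  · rintro n hn
    obtain rfl : N = n * 2 := by omega
    rw [algIntComplex_eq]
    refine countAsymp_of_type hN isLocallyConstantType_noneReal isScaleInvariant_noneReal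
      (DComplex_pos n) ?_
    rw [measureReal_def, volume_unitRegion_noneReal, ENNReal.toReal_ofReal (DComplex_pos n).le]
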